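/- Let $A\in\mathbb R^{m\times n}$ have full row rank, $1\le m\le n$, let $b\in\mathbb R^m$, and let $f:\mathbb R^n\to\mathbb R$ be continuous on $\{x\ge 0\}$ and differentiable on $\{x>0\}$. Consider $\min f(x)$ subject to $Ax=b,\ x\ge 0$; put $\Omega=\{Ax=b,x\ge0\}$, $\Omega^\circ=\{Ax=b,x>0\}$, let $x^*\in\Omega$ be a global minimizer of $f$ on $\Omega$, and write $X=\mathrm{diag}(x)$, $e=(1,\dots,1)$. Let $0<\varepsilon\le\min\{\gamma,\tfrac12\}$ with $\gamma<1$, and let $\phi(x)=f(x)-\varepsilon\sum_i\ln x_i$. Assume: (1) $f$ is twice differentiable on $\Omega^\circ$, and for a constant $l\ge 0$, all $x\in\Omega^\circ$ and all $d,d'$ with $\|d\|,\|d'\|\le\gamma$, $AXd=AXd'=0$, one has $\|X(\nabla f(X(e+d))-\nabla f(X(e+d')))\|\le l\|d-d'\|$; (2) $\|X\nabla\phi(x)\|\le L_\phi$ for all $x\in\Omega^\circ$, where $L_\phi>0$; (3) $x_0\in\Omega^\circ$ satisfies $-\sum_i\ln x_i\ge-\sum_i\ln x_{0,i}-C_0$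 for all $x\in\Omega^\circ$. Algorithm. Let $\beta=\varepsilon/(l+2\varepsilon+2)$, $\delta=\min\{\varepsilon/(15L_\phi),\beta/(92L_\phi)\}$, $T=\max\{0,\lceil (f(x_0)-f(x^*)+(C_0-1)\varepsilon)(2l+4\varepsilon+4)/\varepsilon^2\rceil\}$, $\bar x_0=x_0$. For $t=0,\dots,T-1$: put $X_t=\mathrm{diag}(x_t)$, $\bar X_t=\mathrm{diag}(\bar x_t)$, $R_t=I-X_t^{-1}\bar X_t^2A^\top(A\bar X_t^2A^\top)^{-1}AX_t$, $g_t=R_tX_t\nabla\phi(x_t)$, $\tilde d_t=0$ if $g_t=0$ and $\tilde d_t=-\beta g_t/\|g_t\|$ otherwise, $x_{t+1}=x_t+X_t\tilde d_t$. If $\phi(x_{t+1})-\phi(x_t)>-\varepsilon^2/(2l+4\varepsilon+4)$, stop and return $x_t$. Otherwise form $\bar x_{t+1}$ from $\bar x_t$ by replacing the $i$-th coordinate by $x_{t+1,i}$ for all $i$ if $2^{\lceil\log_2n\rceil}$ divides $t+1$, and else for those $i$ for which some $k\le\lceil\log_2 n\rceil$ with $2^k\mid t+1$ satisfies $|\ln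 x_{t+1,i}-\ln x_{t+1-2^k,i}|\ge\delta/(2\lceil\log_2n\rceil)$. If the loop ends without stopping, return $x_T$. A point $x$ is an $\eta$-KKT point if $Ax=b$, $x>0$ and there are $\lambda\in\mathbb R^m$, $s\in\mathbb R^n_{\ge0}$ with $\|\nabla f(x)+A^\top\lambda-s\|_\infty\le\eta$ and $|x_is_i|\le\eta$ for all $i$. Computational model. Programs are algebraic computation trees over $\mathbb R$ whose basic steps are $+,-,\times,/,\sqrt{\cdot},\ln$, natural-number constants and comparisons; a call to an oracle for $f(x)$ or $\nabla f(x)$ costs one step plus the numbers of reals read and written. There is one program for each triple of natural numbers $(n,m,T)$; it receives $\varepsilon,l,L_\phi,x_0,A$ as input reals. Let $\omega\in[2,5/2]$ be an exponent of matrix multiplication, i.e. two $k\times k$ matrices can be multiplied in $O(k^\omega)$ steps in this model (without oracles). Theorem. If the algorithm stops early, the returned iterate $x_t$ is a $2\varepsilon$-KKT point of the problem; otherwise the final iterate $x_t$ $(t=T)$ satisfies $f(x_t)-f(x^*)\le\varepsilon$. There are programs, depending only on $\omega,n,m,T$, that compute the outcome of the algorithm (the returned point and whether it stopped early) with at most $$K_1\,\frac{\max\{l,1\}\,\max\{f(x_0)-f(x^*),\varepsilon\}}{\varepsilon^2}$$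 gradient evaluations, where $K_1$ depends only on $C_0$ (and $\omega$); so the number is $O(l(f(x_0)-f(x^*))/\varepsilon^2)$ when $l\ge1$ and $f(x_0)-f(x^*)\ge\varepsilon$. Their total running time is $\widetilde O(nm^{\omega-1}+nm/\varepsilon^2)$, i.e. at most $$K_2\,(1+\ln(n/\varepsilon))^p\Big(nm^{\omega-1}+\frac{nm}{\varepsilon^2}\Big)$$ steps, where $p$ depends only on $\omega$, and $K_2$ depends only on $\omega$, $C_0$, $l$, $L_\phi$ and an upper bound on $f(x_0)-f(x^*)$. -/

import Mathlib

namespace IPTR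

/-! ## The optimization problem `min f x` subject to `A x = b`, `x ≥ 0` -/

section Problem

variable {n m : ℕ}

/-- The feasible set `Ω = {A x = b, x ≥ 0}`. -/
def feasible (A : Matrix (Fin m) (Fin n) ℝ) (b : Fin m → ℝ) : Set (EuclideanSpace ℝ (Fin n)) :=
  {x | A.mulVec x.ofLp = b ∧ ∀ i, 0 ≤ x i}

/-- The strictly feasible set `Ω° = {A x = b, x > 0}`. -/
def strictlyFeasible (A : Matrix (Fin m) (Fin n) ℝ) (b : Fin m → ℝ) :
    Set (EuclideanSpace ℝ (Fin n)) :=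
  {x | A.mulVec x.ofLp = b ∧ ∀ i, 0 < x i}

/-- `X d`, where `X = diag x`. -/
noncomputable def scale (x d : EuclideanSpace ℝ (Fin n)) : EuclideanSpace ℝ (Fin n) :=
  WithLp.toLp 2 fun i => x i * d i

/-- `x` is an `ε`-KKT point of `min f` subject to `h = 0`, `c ≥ 0`: it is feasible with `c x > 0`
and there are approximate multipliers `lam` and `s ≥ 0`. -/
def IsApproxKKT {p : ℕ} (f : EuclideanSpace ℝ (Fin n) → ℝ)
    (h : Fin m → EuclideanSpace ℝ (Fin n) → ℝ) (c : Fin p → EuclideanSpace ℝ (Fin n) → ℝ)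
    (ε : ℝ) (x : EuclideanSpace ℝ (Fin n)) : Prop :=
  ∃ (lam : Fin m → ℝ) (s : Fin p → ℝ), (∀ i, 0 ≤ s i) ∧
    (∀ i, h i x = 0) ∧ (∀ i, 0 < c i x) ∧
    (∀ j, |(gradient f x + ∑ i, lam i • gradient (h i) x - ∑ i, s i • gradient (c i) x) j| ≤ ε) ∧
    (∀ i, |c i x * s i| ≤ ε)

/-- `f` is twice differentiable at the points of `Ω°`, and its scaled gradient is `l`-Lipschitz
along feasible displacements of length at most `γ`; note `X (e + d) = x + X d`. -/
def ScaledGradLipschitz (A : Matrix (Fin m) (Fin n) ℝ) (b : Fin m → ℝ)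
    (f : EuclideanSpace ℝ (Fin n) → ℝ) (γ l : ℝ) : Prop :=
  (∀ x ∈ strictlyFeasible A b, DifferentiableAt ℝ (gradient f) x) ∧
  ∀ x ∈ strictlyFeasible A b, ∀ d d' : EuclideanSpace ℝ (Fin n),
    ‖d‖ ≤ γ → A.mulVec (scale x d).ofLp = 0 →
    ‖d'‖ ≤ γ → A.mulVec (scale x d').ofLp = 0 →
    ‖scale x (gradient f (x + scale x d) - gradient f (x + scale x d'))‖ ≤ l * ‖d - d'‖

/-- The potential function `φ x = f x - ε ∑ ln x_i`. -/
noncomputable def potential (f : EuclideanSpace ℝ (Fin n) → ℝ) (ε : ℝ)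
    (x : EuclideanSpace ℝ (Fin n)) : ℝ :=
  f x - ε * ∑ i, Real.log (x i)

/-- `‖X ∇φ(x)‖ ≤ L` on `Ω°`. -/
def ScaledPotentialGradBound (A : Matrix (Fin m) (Fin n) ℝ) (b : Fin m → ℝ)
    (f : EuclideanSpace ℝ (Fin n) → ℝ) (ε L : ℝ) : Prop :=
  ∀ x ∈ strictlyFeasible A b, ‖scale x (gradient (potential f ε) x)‖ ≤ L

/-- `x₀` is an approximate analytic center of the feasible set, with additive error `C₀`. -/
def IsApproxAnalyticCenter (A : Matrix (Fin m) (Fin n) ℝ) (b : Fin m → ℝ) (C₀ : ℝ)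
    (x₀ : EuclideanSpace ℝ (Fin n)) : Prop :=
  x₀ ∈ strictlyFeasible A b ∧ ∀ x ∈ strictlyFeasible A b,
    -∑ i, Real.log (x i) ≥ -∑ i, Real.log (x₀ i) - C₀

end Problem

/-! ## The approximate first-order interior point trust region algorithm -/

section Algorithm

variable {n m : ℕ}

/-- `R = I - X⁻¹ X̄² Aᵀ (A X̄² Aᵀ)⁻¹ A X`. -/
noncomputable def approxProj (A : Matrix (Fin m) (Fin n) ℝ) (x xbar : EuclideanSpace ℝ (Fin n)) :
    Matrix (Fin n) (Fin n) ℝ :=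
  1 - Matrix.diagonal (fun i => (x i)⁻¹) * Matrix.diagonal (fun i => xbar i ^ 2) * A.transpose *
    (A * Matrix.diagonal (fun i => xbar i ^ 2) * A.transpose)⁻¹ * A *
    Matrix.diagonal (fun i => x i)

/-- The projected scaled gradient `R X ∇φ(x)`. -/
noncomputable def projGrad (A : Matrix (Fin m) (Fin n) ℝ) (f : EuclideanSpace ℝ (Fin n) → ℝ)
    (ε : ℝ) (x xbar : EuclideanSpace ℝ (Fin n)) : EuclideanSpace ℝ (Fin n) :=
  WithLp.toLp 2 ((approxProj A x xbar).mulVec (scale x (gradient (potential f ε) x)).ofLp)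

open Classical in
/-- The search direction: `0` if `R X ∇φ(x) = 0`, and `-β R X ∇φ(x) / ‖R X ∇φ(x)‖` otherwise. -/
noncomputable def direction (A : Matrix (Fin m) (Fin n) ℝ) (f : EuclideanSpace ℝ (Fin n) → ℝ)
    (ε β : ℝ) (x xbar : EuclideanSpace ℝ (Fin n)) : EuclideanSpace ℝ (Fin n) :=
  if projGrad A f ε x xbar = 0 then 0
  else -(β / ‖projGrad A f ε x xbar‖) • projGrad A f ε x xbar

open Classical in
/-- One call, at time `t ≥ 1`, of the lazy update of an approximation `ybar` of the stream
`y 0, y 1, …, y t`. On every level `k ≤ ⌈log₂ n⌉` with `2 ^ k ∣ t`, the coordinates that changed by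
at least `δ / (2 ⌈log₂ n⌉)` between the times `t - 2 ^ k` and `t` are refreshed; all coordinates
are refreshed when `2 ^ ⌈log₂ n⌉ ∣ t`; the other coordinates keep their values. -/
noncomputable def selectVector (ybar : EuclideanSpace ℝ (Fin n))
    (y : ℕ → EuclideanSpace ℝ (Fin n)) (t : ℕ) (δ : ℝ) : EuclideanSpace ℝ (Fin n) :=
  WithLp.toLp 2 fun i =>
    if 2 ^ Nat.clog 2 n ∣ t ∨
        ∃ k ≤ Nat.clog 2 n, 2 ^ k ∣ t ∧ δ / (2 * Nat.clog 2 n) ≤ |y t i - y (t - 2 ^ k) i|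
    then y t i else ybar i

/-- The coordinatewise logarithm. -/
noncomputable def lnVec (x : EuclideanSpace ℝ (Fin n)) : EuclideanSpace ℝ (Fin n) :=
  WithLp.toLp 2 fun i => Real.log (x i)

/-- The coordinatewise exponential. -/
noncomputable def expVec (y : EuclideanSpace ℝ (Fin n)) : EuclideanSpace ℝ (Fin n) :=
  WithLp.toLp 2 fun i => Real.exp (y i)

/-- The trust-region radius `β = ε / (l + 2 ε + 2)`. -/
noncomputable def radius (ε l : ℝ) : ℝ := ε / (l + 2 * ε + 2)

/-- The update tolerance `δ = min (ε / (15 L)) (β / (92 L))`. -/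
noncomputable def tolerance (ε l L : ℝ) : ℝ := min (ε / (15 * L)) (radius ε l / (92 * L))

/-- The state before iteration `t` when the stopping test is ignored: the first component holds the
iterates `x 0, …, x t` (its values beyond `t` are irrelevant), the second one is `ln x̄_t`. -/
noncomputable def state (A : Matrix (Fin m) (Fin n) ℝ) (f : EuclideanSpace ℝ (Fin n) → ℝ)
    (ε l L : ℝ) (x₀ : EuclideanSpace ℝ (Fin n)) :
    ℕ → (ℕ → EuclideanSpace ℝ (Fin n)) × EuclideanSpace ℝ (Fin n)
  | 0 => (fun _ => x₀, lnVec x₀)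
  | t + 1 =>
    let s := state A f ε l L x₀ t
    let x := s.1 t
    let xs := Function.update s.1 (t + 1)
      (x + scale x (direction A f ε (radius ε l) x (expVec s.2)))
    (xs, selectVector s.2 (fun k => lnVec (xs k)) (t + 1) (tolerance ε l L))

/-- The iterate `x_t`. -/
noncomputable def iterate (A : Matrix (Fin m) (Fin n) ℝ) (f : EuclideanSpace ℝ (Fin n) → ℝ)
    (ε l L : ℝ) (x₀ : EuclideanSpace ℝ (Fin n)) (t : ℕ) : EuclideanSpace ℝ (Fin n) :=
  (state A f ε l L x₀ t).1 t

/-- The stopping test of iteration `t`: `φ(x_{t+1}) - φ(x_t) > -ε² / (2 l + 4 ε + 4)`. -/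
def Stops (A : Matrix (Fin m) (Fin n) ℝ) (f : EuclideanSpace ℝ (Fin n) → ℝ)
    (ε l L : ℝ) (x₀ : EuclideanSpace ℝ (Fin n)) (t : ℕ) : Prop :=
  potential f ε (iterate A f ε l L x₀ (t + 1)) - potential f ε (iterate A f ε l L x₀ t)
    > -(ε ^ 2 / (2 * l + 4 * ε + 4))

open Classical in
/-- The outcome of the algorithm with loop `t = 0, …, T - 1`: `(true, x_t)` if the stopping test
first succeeds in iteration `t`, and `(false, x_T)` if it never does. -/
noncomputable def outcome (A : Matrix (Fin m) (Fin n) ℝ) (f : EuclideanSpace ℝ (Fin n) → ℝ)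
    (ε l L : ℝ) (x₀ : EuclideanSpace ℝ (Fin n)) (T : ℕ) : Bool × EuclideanSpace ℝ (Fin n) :=
  if h : ∃ t, t < T ∧ Stops A f ε l L x₀ t then (true, iterate A f ε l L x₀ (Nat.find h))
  else (false, iterate A f ε l L x₀ T)

/-- The number of loop iterations, `⌈(Δ + (C₀ - 1) ε) (2 l + 4 ε + 4) / ε²⌉` (`0` if negative),
for the initial gap `Δ = f x₀ - f x*`. -/
noncomputable def maxIter (Δ C₀ ε l : ℝ) : ℕ :=
  ⌈(Δ + (C₀ - 1) * ε) * (2 * l + 4 * ε + 4) / ε ^ 2⌉₊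

end Algorithm

/-! ## Computation trees over the reals, with a step count -/

section Machine

/-- Scalar instructions; the arguments are addresses of memory cells. -/
inductive Op : Type
  | const (c : ℕ)
  | add (i j : ℕ)
  | sub (i j : ℕ)
  | mul (i j : ℕ)
  | div (i j : ℕ)
  | sqrt (i : ℕ)
  | log (i : ℕ)

/-- The value of a memory cell. -/
noncomputable def cell (mem : List ℝ) (i : ℕ) : ℝ := mem.getD i 0

/-- The number computed by a scalar instruction. -/
noncomputable def Op.eval (mem : List ℝ) : Op → ℝ
  | .const c => c
  | .add i j => cell mem i + cell mem j
  | .sub i j => cell mem i - cell mem j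
  | .mul i j => cell mem i * cell mem j
  | .div i j => cell mem i / cell mem j
  | .sqrt i => Real.sqrt (cell mem i)
  | .log i => Real.log (cell mem i)

/-- Computation trees with oracles of type `Q` and a discrete result of type `α`. Programs handle
real numbers only through the addresses of memory cells: the continuation of an instruction is
told the address at which the result was stored, and control depends on real numbers only through
comparisons. -/
inductive Prog (Q α : Type) : Type
  | ret (a : α) : Prog Q α
  | op (o : Op) (next : ℕ → Prog Q α) : Prog Q α
  | test (i j : ℕ) (next : Bool → Prog Q α) : Prog Q α
  | call (q : Q) (args : List ℕ) (next : ℕ → Prog Q α) : Prog Q α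

/-- The result of a run: the returned value, the final memory, the number of steps, and the list
of all oracle calls. -/
structure Result (Q α : Type) where
  out : α
  mem : List ℝ
  steps : ℕ
  calls : List Q

open Classical in
/-- Running a program. The memory is append-only: results are stored in new cells at its end.
A scalar instruction or a comparison (`cell i ≤ cell j`) is one step; an oracle call costs one step
plus one for each argument read and each number written. -/
noncomputable def Prog.run {Q α : Type} (oracle : Q → List ℝ → List ℝ) :
    Prog Q α → List ℝ → Result Q α
  | .ret a, mem => ⟨a, mem, 0, []⟩
  | .op o next, mem =>
    let r := (next mem.length).run oracle (mem ++ [o.eval mem])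
    { r with steps := r.steps + 1 }
  | .test i j next, mem =>
    let r := (next (decide (cell mem i ≤ cell mem j))).run oracle mem
    { r with steps := r.steps + 1 }
  | .call q args next, mem =>
    let ans := oracle q (args.map (cell mem))
    let r := (next mem.length).run oracle (mem ++ ans)
    { r with steps := r.steps + (1 + args.length + ans.length), calls := q :: r.calls }

/-- The cells with the addresses `a i j` exist and hold the entries of the matrix `M`. -/
def Holds {p q : ℕ} (mem : List ℝ) (a : Fin p → Fin q → ℕ) (M : Matrix (Fin p) (Fin q) ℝ) : Prop :=
  ∀ i j, mem[a i j]? = some (M i j)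

/-- `ω` is an exponent of matrix multiplication: two `k × k` matrices can be multiplied in
`O(k ^ ω)` steps, by programs that are given the addresses of the entries of the factors and return
the addresses of the entries of the product. -/
def IsMatMulExponent (ω : ℝ) : Prop :=
  ∃ C : ℝ, ∀ k : ℕ,
    ∃ mul : (Fin k → Fin k → ℕ) → (Fin k → Fin k → ℕ) → Prog Empty (Fin k → Fin k → ℕ),
      ∀ (mem : List ℝ) (a b : Fin k → Fin k → ℕ) (M N : Matrix (Fin k) (Fin k) ℝ),
        Holds mem a M → Holds mem b N →
        let r := (mul a b).run (fun q => q.elim) mem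
        Holds r.mem r.out (M * N) ∧ (r.steps : ℝ) ≤ C * (k : ℝ) ^ ω

/-- The two oracles for the objective function. -/
inductive FirstOrder : Type
  | value
  | grad

/-- Indicator of the gradient oracle, used to count gradient evaluations. -/
def FirstOrder.isGrad : FirstOrder → Bool
  | .value => false
  | .grad => true

/-- The first-order oracle of `f`: `value` answers with `f x`, `grad` with the `n` coordinates of
`∇f(x)`, where `x` is the vector of the arguments. -/
noncomputable def firstOrderOracle {n : ℕ} (f : EuclideanSpace ℝ (Fin n) → ℝ) :
    FirstOrder → List ℝ → List ℝ
  | .value, args => [f (WithLp.toLp 2 fun i => args.getD i 0)]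
  | .grad, args => List.ofFn fun i => gradient f (WithLp.toLp 2 fun i => args.getD i 0) i

/-- The input: `ε`, `l`, `L`, the starting point, and the matrix `A` row by row. -/
noncomputable def inputMem {n m : ℕ} (A : Matrix (Fin m) (Fin n) ℝ) (ε l L : ℝ)
    (x₀ : EuclideanSpace ℝ (Fin n)) : List ℝ :=
  [ε, l, L] ++ (List.ofFn fun j => x₀ j) ++
    (List.ofFn fun i => List.ofFn fun j => A i j).flatten

end Machine

end IPTR

open IPTR

/-!
The algorithm is a projected gradient descent, with steps of the fixed length `β`, on the
potential `φ = f - ε ∑ ln x_i`, in coordinates rescaled by the current iterate.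

*Certificates.* By the Lipschitz condition, `φ` has a quadratic upper bound along scaled feasible
displacements (`potential_step_le`). Let `u = (A X̄² Aᵀ)⁻¹ A X (X ∇φ(x))`. The projected gradient
`g` is a feasible displacement that differs from `X (∇φ(x) - Aᵀ u)` by at most `β / 2` if `x̄` is
close to `x` (`norm_projGrad_sub_le`). If a step decreases `φ` by less than `ε² / (2 l + 4 ε + 4)
= β ε / 2`, then `g` must be short, so that all coordinates of `X (∇f(x) - Aᵀ u)` lie between `0`
and `2 ε`. Hence `x` is a `2 ε`-KKT point, with the multipliers `-u` and `s = ∇f(x) - Aᵀ u`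
(`isApproxKKT_of_small_decrease`). If every step achieves the decrease, then the choice of the
number of steps and of the starting point makes the final gap at most `ε` (`objective_gap_le`).

*Accuracy of `x̄`.* Between the last refresh of a coordinate and the present, the time interval
splits into at most `2 ⌈log₂ n⌉` dyadic intervals, over each of which the logarithm of the
coordinate changed by less than `δ / (2 ⌈log₂ n⌉)` (`abs_lazy_sub_le`), so that `x̄` is within the
factor `exp δ` of `x`. For this to suffice, `δ` must be small in absolute terms, i.e. `ε` must not
exceed a multiple of the bound `L` for `‖X ∇φ(x)‖`. Indeed `ε ≤ L`: otherwise `f` would tend to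
`-∞` at the boundary of the feasible set, unless this set is a single point, where the algorithm
never moves (`le_gradBound`, `exists_accuracy`).

*Running time.* The costly part of an iteration is the inverse of `A X̄² Aᵀ`. When the coordinates
in `S` are refreshed, it is updated by the binomial inverse theorem, or recomputed if `|S| > m`;
both cost `O(n m √|S|)` because `ω ≤ 5 / 2` (`computes_updateInv`). The logarithms of the iterates
move by at most `2 β` in a step, so that level `k` of the lazy update refreshes `O(4 ^ k log² n)`
coordinates, and it is active in one out of `2 ^ k` iterations. The sum of `√|S|` over all
iterations is therefore `O(T log² n)` (`sqrt_card_refreshSet_le`, `sum_dyadic_le`). Matrix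
inversion is reduced to multiplication by recursion through Schur complements
(`computes_invPosDef`), and rectangular products are computed in blocks (`computes_mulRect`). The
correctness of programs is expressed by the predicates `Computes` and `Runs`, which bound the
steps and describe the final memory; they are composed along the structure of the program
(`runs_loopProg`, `runs_mainProg`).
-/

namespace IPTR

/-! ### Descent of the potential along scaled displacements -/

section Optimization

variable {n m : ℕ}

lemma scale_apply (x d : EuclideanSpace ℝ (Fin n)) (i : Fin n) : scale x d i = x i * d i := rfl

lemma gradient_apply (F : EuclideanSpace ℝ (Fin n) → ℝ) (x : EuclideanSpace ℝ (Fin n))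
    (i : Fin n) : gradient F x i = fderiv ℝ F x (EuclideanSpace.single i 1) := by
  have h : inner ℝ (gradient F x) (EuclideanSpace.single i 1)
      = fderiv ℝ F x (EuclideanSpace.single i 1) := by
    rw [gradient, InnerProductSpace.toDual_symm_apply]
  rw [← h, EuclideanSpace.inner_single_right]
  simp

lemma inner_gradient (F : EuclideanSpace ℝ (Fin n) → ℝ) (x v : EuclideanSpace ℝ (Fin n)) :
    inner ℝ (gradient F x) v = fderiv ℝ F x v := by
  rw [gradient, InnerProductSpace.toDual_symm_apply]

lemma inner_scale_left (x g d : EuclideanSpace ℝ (Fin n)) :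
    inner ℝ (scale x g) d = inner ℝ g (scale x d) := by
  simp only [PiLp.inner_apply, scale_apply]
  refine Finset.sum_congr rfl fun i _ => ?_
  simp
  ring

lemma gradient_coord (x : EuclideanSpace ℝ (Fin n)) (i j : Fin n) :
    gradient (fun x : EuclideanSpace ℝ (Fin n) => x i) x j = if j = i then 1 else 0 := by
  rw [gradient_apply]
  have : HasFDerivAt (fun x : EuclideanSpace ℝ (Fin n) => x i)
      (EuclideanSpace.proj i : EuclideanSpace ℝ (Fin n) →L[ℝ] ℝ) x :=
    (EuclideanSpace.proj i : EuclideanSpace ℝ (Fin n) →L[ℝ] ℝ).hasFDerivAt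
  rw [this.fderiv]
  simp [eq_comm]

lemma gradient_affine (A : Matrix (Fin m) (Fin n) ℝ) (b : Fin m → ℝ)
    (x : EuclideanSpace ℝ (Fin n)) (i : Fin m) (j : Fin n) :
    gradient (fun x : EuclideanSpace ℝ (Fin n) => A.mulVec x.ofLp i - b i) x j = A i j := by
  rw [gradient_apply]
  have : HasFDerivAt (fun x : EuclideanSpace ℝ (Fin n) => A.mulVec x.ofLp i - b i)
      (∑ k, A i k • (EuclideanSpace.proj k : EuclideanSpace ℝ (Fin n) →L[ℝ] ℝ)) x := by
    have h := (∑ k, A i k • (EuclideanSpace.proj k : EuclideanSpace ℝ (Fin n) →L[ℝ] ℝ)).hasFDerivAt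
      (x := x)
    refine (h.sub_const (b i)).congr_of_eventuallyEq (Filter.Eventually.of_forall fun y => ?_)
    simp [Matrix.mulVec, dotProduct]
  rw [this.fderiv]
  simp

lemma gradient_potential {f : EuclideanSpace ℝ (Fin n) → ℝ} {x : EuclideanSpace ℝ (Fin n)}
    (hf : DifferentiableAt ℝ f x) (hx : ∀ i, 0 < x i) (ε : ℝ) (i : Fin n) :
    gradient (potential f ε) x i = gradient f x i - ε / x i := by
  rw [gradient_apply, gradient_apply]
  have hl : ∀ k : Fin n, HasFDerivAt (fun x : EuclideanSpace ℝ (Fin n) => Real.log (x k))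
      ((x k)⁻¹ • (EuclideanSpace.proj k : EuclideanSpace ℝ (Fin n) →L[ℝ] ℝ)) x := fun k =>
    HasFDerivAt.log (f := fun x : EuclideanSpace ℝ (Fin n) => x k)
      (EuclideanSpace.proj k : EuclideanSpace ℝ (Fin n) →L[ℝ] ℝ).hasFDerivAt (hx k).ne'
  have h := hf.hasFDerivAt.sub ((HasFDerivAt.fun_sum
    fun k (_ : k ∈ Finset.univ) => hl k).const_mul ε)
  have h2 : HasFDerivAt (potential f ε) _ x := h
  rw [h2.fderiv]
  simp [div_eq_mul_inv]

lemma isOpen_pos : IsOpen {x : EuclideanSpace ℝ (Fin n) | ∀ i, 0 < x i} := by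
  simp only [Set.ofPred_forall]
  exact isOpen_iInter_of_finite fun i =>
    isOpen_lt continuous_const (EuclideanSpace.proj i : EuclideanSpace ℝ (Fin n) →L[ℝ] ℝ).continuous

lemma differentiableAt_of_pos {f : EuclideanSpace ℝ (Fin n) → ℝ}
    (hf : DifferentiableOn ℝ f {x | ∀ i, 0 < x i}) {x : EuclideanSpace ℝ (Fin n)}
    (hx : ∀ i, 0 < x i) : DifferentiableAt ℝ f x :=
  hf.differentiableAt (isOpen_pos.mem_nhds hx)

/-- A quadratic lower bound for the logarithmic terms of the potential in the trust region. -/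
lemma log_one_add_ge {d : ℝ} (hd : |d| ≤ 1 / 3) : d - d ^ 2 ≤ Real.log (1 + d) := by
  have h := Real.abs_log_sub_add_sum_range_le (x := -d) (by rw [abs_neg]; linarith) 2
  simp [Finset.sum_range_succ] at h
  have h1 := (abs_le.1 h).1
  have h2 : |d| ^ 3 / (1 - |d|) ≤ d ^ 2 / 2 := by
    rw [div_le_iff₀ (by linarith), ← sq_abs d]
    nlinarith [sq_nonneg |d|, abs_nonneg d]
  norm_num at h1 h2
  nlinarith

lemma abs_log_one_add_le {d : ℝ} (hd : |d| ≤ 1 / 3) : |Real.log (1 + d)| ≤ 2 * |d| := by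
  have h1 := log_one_add_ge hd
  have hd' := abs_le.1 hd
  have h2 := Real.log_le_sub_one_of_pos (x := 1 + d) (by linarith)
  have h3 : d ^ 2 ≤ |d| := by rw [← sq_abs]; nlinarith [abs_nonneg d]
  rw [abs_le]
  constructor
  · linarith [neg_abs_le d]
  · linarith [le_abs_self d, abs_nonneg d]

lemma abs_coord_le (d : EuclideanSpace ℝ (Fin n)) (i : Fin n) : |d i| ≤ ‖d‖ := by
  simpa using PiLp.norm_apply_le d i

lemma add_scale_pos {x d : EuclideanSpace ℝ (Fin n)} (hx : ∀ i, 0 < x i) (hd : ‖d‖ < 1)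
    (i : Fin n) : 0 < (x + scale x d) i := by
  have h := abs_le.1 (abs_coord_le d i)
  have : (x + scale x d) i = x i * (1 + d i) := by simp [scale_apply]; ring
  rw [this]
  exact mul_pos (hx i) (by linarith)

lemma add_scale_mem {A : Matrix (Fin m) (Fin n) ℝ} {b : Fin m → ℝ}
    {x d : EuclideanSpace ℝ (Fin n)} (hx : x ∈ strictlyFeasible A b) (hd : ‖d‖ < 1)
    (hA : A.mulVec (scale x d).ofLp = 0) : x + scale x d ∈ strictlyFeasible A b := by
  refine ⟨?_, add_scale_pos hx.2 hd⟩
  rw [WithLp.ofLp_add, Matrix.mulVec_add, hA, hx.1, add_zero]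

lemma scale_smul (x d : EuclideanSpace ℝ (Fin n)) (s : ℝ) : scale x (s • d) = s • scale x d := by
  ext i; simp [scale_apply]; ring

lemma scale_zero (x : EuclideanSpace ℝ (Fin n)) : scale x 0 = 0 := by
  ext i; simp [scale_apply]

/-- The quadratic upper bound for `f` along a feasible scaled displacement. -/
lemma objective_step_le {A : Matrix (Fin m) (Fin n) ℝ} {b : Fin m → ℝ}
    {f : EuclideanSpace ℝ (Fin n) → ℝ} {γ l : ℝ}
    (hf : DifferentiableOn ℝ f {x | ∀ i, 0 < x i}) (hlip : ScaledGradLipschitz A b f γ l)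
    {x d : EuclideanSpace ℝ (Fin n)} (hx : x ∈ strictlyFeasible A b) (hd : ‖d‖ ≤ γ)
    (hd1 : ‖d‖ < 1) (hA : A.mulVec (scale x d).ofLp = 0) :
    f (x + scale x d) - f x ≤ inner ℝ (scale x (gradient f x)) d + l / 2 * ‖d‖ ^ 2 := by
  set c := inner ℝ (scale x (gradient f x)) d with hc
  -- the excess of `f` over its quadratic model does not increase along the segment
  let h : ℝ → ℝ := fun s => f (x + s • scale x d) - s * c - l / 2 * ‖d‖ ^ 2 * s ^ 2
  have hγ : 0 ≤ γ := (norm_nonneg d).trans hd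
  have hder : ∀ s ∈ Set.Icc (0 : ℝ) 1, HasDerivAt h
      (inner ℝ (gradient f (x + s • scale x d)) (scale x d) - c - l * ‖d‖ ^ 2 * s) s := by
    intro s hs
    have hsd : ‖s • d‖ < 1 := by
      rw [norm_smul, Real.norm_of_nonneg hs.1]
      nlinarith [norm_nonneg d, hs.2]
    have hpos : ∀ i, 0 < (x + s • scale x d) i := by
      rw [← scale_smul]; exact add_scale_pos hx.2 hsd
    have h1 : HasDerivAt (fun s : ℝ => x + s • scale x d) (scale x d) s := by
      simpa using ((hasDerivAt_id s).smul_const (scale x d)).const_add x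
    have h2 := (differentiableAt_of_pos hf hpos).hasFDerivAt.comp_hasDerivAt s h1
    rw [inner_gradient]
    have h3 := (h2.sub ((hasDerivAt_id s).mul_const c)).sub
      (((hasDerivAt_id s).pow 2).const_mul (l / 2 * ‖d‖ ^ 2))
    refine h3.congr_deriv ?_
    simp
    ring
  have hanti : AntitoneOn h (Set.Icc 0 1) := by
    refine antitoneOn_of_deriv_nonpos (convex_Icc 0 1)
      (fun s hs => (hder s hs).continuousAt.continuousWithinAt)
      (fun s hs => (hder s (interior_subset hs)).differentiableAt.differentiableWithinAt) ?_
    intro s hs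
    have hs := interior_subset hs
    rw [(hder s hs).deriv]
    have hsd : ‖s • d‖ ≤ γ := by
      rw [norm_smul, Real.norm_of_nonneg hs.1]
      nlinarith [norm_nonneg d, hs.2]
    have h4 := hlip.2 x hx (s • d) 0 hsd
      (by rw [scale_smul, WithLp.ofLp_smul, Matrix.mulVec_smul, hA, smul_zero]) (by simpa using hγ)
      (by rw [scale_zero]; simp)
    rw [scale_zero, add_zero, sub_zero, scale_smul, norm_smul, Real.norm_of_nonneg hs.1] at h4
    have h5 : inner ℝ (gradient f (x + s • scale x d)) (scale x d) - c
        = inner ℝ (scale x (gradient f (x + s • scale x d) - gradient f x)) d := by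
      rw [inner_scale_left, inner_sub_left, hc, inner_scale_left]
    rw [h5]
    have h6 := real_inner_le_norm (scale x (gradient f (x + s • scale x d) - gradient f x)) d
    have h7 := mul_le_mul_of_nonneg_right h4 (norm_nonneg d)
    nlinarith
  have h01 := hanti (Set.left_mem_Icc.2 zero_le_one) (Set.right_mem_Icc.2 zero_le_one) zero_le_one
  simp only [h, one_smul, zero_smul, add_zero] at h01
  linarith

/-- The quadratic upper bound for the potential along a feasible scaled displacement. -/
lemma potential_step_le {A : Matrix (Fin m) (Fin n) ℝ} {b : Fin m → ℝ}
    {f : EuclideanSpace ℝ (Fin n) → ℝ} {γ l ε : ℝ} (hε : 0 ≤ ε)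
    (hf : DifferentiableOn ℝ f {x | ∀ i, 0 < x i}) (hlip : ScaledGradLipschitz A b f γ l)
    {x d : EuclideanSpace ℝ (Fin n)} (hx : x ∈ strictlyFeasible A b) (hd : ‖d‖ ≤ γ)
    (hd1 : ‖d‖ ≤ 1 / 3) (hA : A.mulVec (scale x d).ofLp = 0) :
    potential f ε (x + scale x d) - potential f ε x
      ≤ inner ℝ (scale x (gradient (potential f ε) x)) d + (l / 2 + ε) * ‖d‖ ^ 2 := by
  have h1 := objective_step_le hf hlip hx hd (by linarith) hA
  have h2 : ∀ i, Real.log ((x + scale x d) i) = Real.log (x i) + Real.log (1 + d i) := by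
    intro i
    have h := abs_le.1 ((abs_coord_le d i).trans hd1)
    rw [← Real.log_mul (hx.2 i).ne' (by linarith)]
    congr 1
    simp [scale_apply]; ring
  have h3 : inner ℝ (scale x (gradient (potential f ε) x)) d
      = inner ℝ (scale x (gradient f x)) d - ε * ∑ i, d i := by
    simp only [PiLp.inner_apply, scale_apply, Finset.mul_sum]
    rw [← Finset.sum_sub_distrib]
    refine Finset.sum_congr rfl fun i _ => ?_
    rw [gradient_potential (differentiableAt_of_pos hf hx.2) hx.2]
    have := (hx.2 i).ne'
    simp
    field_simp
  have h4 : ∑ i, d i - ‖d‖ ^ 2 ≤ ∑ i, Real.log (1 + d i) := by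
    rw [EuclideanSpace.real_norm_sq_eq, ← Finset.sum_sub_distrib]
    exact Finset.sum_le_sum fun i _ => log_one_add_ge ((abs_coord_le d i).trans hd1)
  have h5 := mul_le_mul_of_nonneg_left h4 hε
  simp only [potential, h2, Finset.sum_add_distrib, h3]
  linarith

end Optimization

/-! ### The projected gradient and its optimality certificate -/

open Matrix in
/-- The Gram matrix `A X̄² Aᵀ`. -/
noncomputable def gram {n m : ℕ} (A : Matrix (Fin m) (Fin n) ℝ) (xbar : EuclideanSpace ℝ (Fin n)) :
    Matrix (Fin m) (Fin m) ℝ :=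
  A * Matrix.diagonal (fun i => xbar i ^ 2) * A.transpose

section Projection

open Matrix

variable {n m : ℕ}

lemma vecMul_injective_of_rank {A : Matrix (Fin m) (Fin n) ℝ} (hA : A.rank = m) :
    Function.Injective fun v => v ᵥ* A := by
  rw [vecMul_injective_iff, linearIndependent_iff_card_eq_finrank_span]
  rw [rank_eq_finrank_span_row] at hA
  simpa [Set.finrank] using hA.symm

lemma gram_posDef {A : Matrix (Fin m) (Fin n) ℝ} (hA : A.rank = m)
    {xbar : EuclideanSpace ℝ (Fin n)} (hx : ∀ i, 0 < xbar i) : (gram A xbar).PosDef := by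
  have h := (PosDef.diagonal (d := fun i => xbar i ^ 2) fun i => pow_pos (hx i) 2)
    |>.mul_mul_conjTranspose_same (vecMul_injective_of_rank hA)
  rwa [conjTranspose_eq_transpose_of_trivial] at h

/-- The multiplier estimate `(A X̄² Aᵀ)⁻¹ A X v` that belongs to a scaled gradient `v`. -/
noncomputable def multiplier (A : Matrix (Fin m) (Fin n) ℝ) (x xbar v : EuclideanSpace ℝ (Fin n)) :
    Fin m → ℝ :=
  (gram A xbar)⁻¹ *ᵥ (A *ᵥ (scale x v).ofLp)

lemma projGrad_apply (A : Matrix (Fin m) (Fin n) ℝ) (f : EuclideanSpace ℝ (Fin n) → ℝ) (ε : ℝ)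
    (x xbar : EuclideanSpace ℝ (Fin n)) (i : Fin n) :
    projGrad A f ε x xbar i = scale x (gradient (potential f ε) x) i - (x i)⁻¹ * (xbar i ^ 2 *
      (A.transpose *ᵥ multiplier A x xbar (scale x (gradient (potential f ε) x))) i) := by
  set v := scale x (gradient (potential f ε) x)
  have h : (diagonal (fun i => x i)) *ᵥ v.ofLp = (scale x v).ofLp := by
    ext j; rw [mulVec_diagonal]; rfl
  change (approxProj A x xbar *ᵥ v.ofLp) i = _
  rw [approxProj, sub_mulVec, one_mulVec, ← mulVec_mulVec, h, Pi.sub_apply, ← mulVec_mulVec,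
    ← mulVec_mulVec, ← mulVec_mulVec, ← mulVec_mulVec, mulVec_diagonal, mulVec_diagonal]
  rfl

lemma gram_mulVec_multiplier {A : Matrix (Fin m) (Fin n) ℝ} (hA : A.rank = m)
    {x xbar : EuclideanSpace ℝ (Fin n)} (hx : ∀ i, 0 < xbar i) (v : EuclideanSpace ℝ (Fin n)) :
    gram A xbar *ᵥ multiplier A x xbar v = A *ᵥ (scale x v).ofLp := by
  rw [multiplier, mulVec_mulVec, mul_nonsing_inv _ ((isUnit_iff_isUnit_det _).1
    (gram_posDef hA hx).isUnit), one_mulVec]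

/-- The projected scaled gradient is a feasible scaled displacement. -/
lemma mulVec_scale_projGrad {A : Matrix (Fin m) (Fin n) ℝ} (hA : A.rank = m)
    (f : EuclideanSpace ℝ (Fin n) → ℝ) (ε : ℝ)
    {x xbar : EuclideanSpace ℝ (Fin n)} (hx : ∀ i, 0 < x i) (hxb : ∀ i, 0 < xbar i) :
    A *ᵥ (scale x (projGrad A f ε x xbar)).ofLp = 0 := by
  set v := scale x (gradient (potential f ε) x) with hv
  have h : (scale x (projGrad A f ε x xbar)).ofLp = (scale x v).ofLp -
      diagonal (fun i => xbar i ^ 2) *ᵥ (A.transpose *ᵥ multiplier A x xbar v) := by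
    ext i
    rw [Pi.sub_apply, mulVec_diagonal, scale_apply, projGrad_apply, scale_apply, ← hv, mul_sub,
      mul_inv_cancel_left₀ (hx i).ne']
    rfl
  rw [h, mulVec_sub, mulVec_mulVec, mulVec_mulVec, ← gram, gram_mulVec_multiplier hA hxb, sub_self]

lemma norm_le_of_abs_le {a b : EuclideanSpace ℝ (Fin n)} {c : ℝ} (hc : 0 ≤ c)
    (h : ∀ i, |a i| ≤ c * |b i|) : ‖a‖ ≤ c * ‖b‖ := by
  rw [← abs_of_nonneg hc, ← Real.norm_eq_abs, ← norm_smul, EuclideanSpace.norm_eq,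
    EuclideanSpace.norm_eq]
  refine Real.sqrt_le_sqrt (Finset.sum_le_sum fun i _ => ?_)
  refine pow_le_pow_left₀ (norm_nonneg _) ?_ 2
  simpa [abs_mul, abs_of_nonneg hc] using h i

lemma inner_scale_transpose {A : Matrix (Fin m) (Fin n) ℝ} (x v : EuclideanSpace ℝ (Fin n))
    (u : Fin m → ℝ) : inner ℝ v (scale x (WithLp.toLp 2 (A.transpose *ᵥ u)))
      = u ⬝ᵥ A *ᵥ (scale x v).ofLp := by
  rw [dotProduct_mulVec, ← mulVec_transpose, dotProduct, PiLp.inner_apply]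
  refine Finset.sum_congr rfl fun i _ => ?_
  simp [scale_apply]; ring

/-- If `x̄` approximates `x` up to the factor `exp η`, then the projected scaled gradient differs
from `X (∇φ(x) - Aᵀ u)`, with `u` the multiplier estimate, by at most `(exp (2 η) - 1) ‖X ∇φ(x)‖`.
The product `X̄ Aᵀ u` is an orthogonal projection of `X̄⁻¹ X (X ∇φ(x))`, which bounds its norm. -/
lemma norm_projGrad_sub_le {A : Matrix (Fin m) (Fin n) ℝ} (hA : A.rank = m)
    (f : EuclideanSpace ℝ (Fin n) → ℝ) (ε : ℝ) {x xbar : EuclideanSpace ℝ (Fin n)}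
    (hx : ∀ i, 0 < x i) (hxb : ∀ i, 0 < xbar i) {η : ℝ}
    (hη : ∀ i, |Real.log (xbar i) - Real.log (x i)| ≤ η) (h0 : 0 ≤ η) :
    ‖projGrad A f ε x xbar - (scale x (gradient (potential f ε) x) - scale x (WithLp.toLp 2
      (A.transpose *ᵥ multiplier A x xbar (scale x (gradient (potential f ε) x)))))‖
      ≤ (Real.exp (2 * η) - 1) * ‖scale x (gradient (potential f ε) x)‖ := by
  set v := scale x (gradient (potential f ε) x) with hv
  set u := multiplier A x xbar v with hu
  set z := A.transpose *ᵥ u with hz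
  have hr1 : ∀ i, x i / xbar i ≤ Real.exp η := fun i => by
    have := (abs_le.1 (hη i)).1
    rw [← Real.exp_log (div_pos (hx i) (hxb i)), Real.exp_le_exp,
      Real.log_div (hx i).ne' (hxb i).ne']
    linarith
  have hr2 : ∀ i, xbar i / x i ≤ Real.exp η := fun i => by
    have := (abs_le.1 (hη i)).2
    rw [← Real.exp_log (div_pos (hxb i) (hx i)), Real.exp_le_exp,
      Real.log_div (hxb i).ne' (hx i).ne']
    linarith
  -- `p` is the orthogonal projection of `w` to the row space of `A X̄`
  set p : EuclideanSpace ℝ (Fin n) := scale xbar (WithLp.toLp 2 z) with hp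
  set w : EuclideanSpace ℝ (Fin n) := WithLp.toLp 2 fun i => x i / xbar i * v i with hw
  have hpw : ‖p‖ ^ 2 = inner ℝ p w := by
    have h1 : ‖p‖ ^ 2 = u ⬝ᵥ gram A xbar *ᵥ u := by
      rw [← real_inner_self_eq_norm_sq, hp, inner_scale_transpose, gram, ← mulVec_mulVec,
        ← mulVec_mulVec]
      congr 2
      ext i
      rw [mulVec_diagonal, scale_apply, scale_apply]
      ring
    rw [h1, gram_mulVec_multiplier hA hxb, ← inner_scale_transpose, PiLp.inner_apply,
      PiLp.inner_apply]
    refine Finset.sum_congr rfl fun i _ => ?_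
    have := (hxb i).ne'
    simp [hp, hw, scale_apply, hz]
    field_simp
  have hwn : ‖w‖ ≤ Real.exp η * ‖v‖ := by
    refine norm_le_of_abs_le (Real.exp_pos η).le fun i => ?_
    change |x i / xbar i * v i| ≤ _
    rw [abs_mul, abs_of_pos (div_pos (hx i) (hxb i))]
    exact mul_le_mul_of_nonneg_right (hr1 i) (abs_nonneg _)
  have hpn : ‖p‖ ≤ Real.exp η * ‖v‖ := by
    refine le_trans ?_ hwn
    have := real_inner_le_norm p w
    rw [← hpw, sq] at this
    by_contra! hlt
    have hp0 : 0 < ‖p‖ := (norm_nonneg w).trans_lt hlt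
    nlinarith
  have hexp : 0 ≤ Real.exp η - Real.exp (-η) := by
    rw [sub_nonneg, Real.exp_le_exp]; linarith
  -- coordinatewise, the difference is `(x / x̄ - x̄ / x) p`
  have hq : ‖projGrad A f ε x xbar - (v - scale x (WithLp.toLp 2 z))‖
      ≤ (Real.exp η - Real.exp (-η)) * ‖p‖ := by
    refine norm_le_of_abs_le hexp fun i => ?_
    have e : (projGrad A f ε x xbar - (v - scale x (WithLp.toLp 2 z))) i
        = (x i / xbar i - xbar i / x i) * p i := by
      have h1 := (hx i).ne'
      have h2 := (hxb i).ne'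
      change projGrad A f ε x xbar i - (v i - x i * z i) = _ * (xbar i * z i)
      rw [projGrad_apply, ← hv, ← hu, ← hz]
      field_simp
      ring
    rw [e, abs_mul]
    refine mul_le_mul_of_nonneg_right ?_ (abs_nonneg _)
    have l1 : Real.exp (-η) ≤ xbar i / x i := by
      rw [Real.exp_neg, ← inv_div]
      exact inv_anti₀ (div_pos (hx i) (hxb i)) (hr1 i)
    have l2 : Real.exp (-η) ≤ x i / xbar i := by
      rw [Real.exp_neg, ← inv_div]
      exact inv_anti₀ (div_pos (hxb i) (hx i)) (hr2 i)
    rw [abs_le]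
    constructor <;> linarith [hr1 i, hr2 i]
  calc _ ≤ _ := hq
    _ ≤ (Real.exp η - Real.exp (-η)) * (Real.exp η * ‖v‖) := mul_le_mul_of_nonneg_left hpn hexp
    _ = (Real.exp (2 * η) - 1) * ‖v‖ := by
      have h1 : Real.exp (-η) * Real.exp η = 1 := by rw [← Real.exp_add]; simp
      have h2 : Real.exp (2 * η) = Real.exp η * Real.exp η := by rw [← Real.exp_add]; ring_nf
      rw [h2, ← mul_assoc, sub_mul, h1]

lemma direction_norm_le (A : Matrix (Fin m) (Fin n) ℝ) (f : EuclideanSpace ℝ (Fin n) → ℝ)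
    (ε : ℝ) {β : ℝ} (hβ : 0 ≤ β) (x xbar : EuclideanSpace ℝ (Fin n)) :
    ‖direction A f ε β x xbar‖ ≤ β := by
  unfold direction
  split_ifs with h
  · simpa using hβ
  · rw [norm_smul, norm_neg, Real.norm_of_nonneg (by positivity),
      div_mul_cancel₀ _ (norm_ne_zero_iff.2 h)]

lemma mulVec_scale_direction {A : Matrix (Fin m) (Fin n) ℝ} (hA : A.rank = m)
    (f : EuclideanSpace ℝ (Fin n) → ℝ) (ε β : ℝ)
    {x xbar : EuclideanSpace ℝ (Fin n)} (hx : ∀ i, 0 < x i) (hxb : ∀ i, 0 < xbar i) :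
    A *ᵥ (scale x (direction A f ε β x xbar)).ofLp = 0 := by
  unfold direction
  split_ifs with h
  · rw [scale_zero]; simp
  · rw [scale_smul, WithLp.ofLp_smul, mulVec_smul, mulVec_scale_projGrad hA f ε hx hxb, smul_zero]

lemma radius_pos {ε l : ℝ} (hε : 0 < ε) (hl : 0 ≤ l) : 0 < radius ε l := by
  unfold radius; positivity

lemma radius_le {ε l : ℝ} (hε : 0 < ε) (hl : 0 ≤ l) : radius ε l ≤ ε / 2 := by
  unfold radius
  gcongr
  linarith

lemma radius_le_third {ε l : ℝ} (hε : 0 < ε) (hl : 0 ≤ l) (h2 : ε ≤ 1 / 2) :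
    radius ε l ≤ 1 / 3 := (radius_le hε hl).trans (by linarith)

/-- A step that decreases the potential by less than `ε² / (2 l + 4 ε + 4)` certifies that its
starting point is a `2 ε`-KKT point, with multipliers `-u` and `∇f(x) - Aᵀ u`: the gradient of the
Lagrangian then vanishes exactly. -/
lemma isApproxKKT_of_small_decrease {A : Matrix (Fin m) (Fin n) ℝ} {b : Fin m → ℝ}
    {f : EuclideanSpace ℝ (Fin n) → ℝ} {γ l ε L η : ℝ} (hA : A.rank = m)
    (hf : DifferentiableOn ℝ f {x | ∀ i, 0 < x i}) (hε : 0 < ε) (hεγ : ε ≤ γ) (hε2 : ε ≤ 1 / 2)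
    (hl : 0 ≤ l) (hlip : ScaledGradLipschitz A b f γ l)
    (hL : ScaledPotentialGradBound A b f ε L)
    {x xbar : EuclideanSpace ℝ (Fin n)} (hx : x ∈ strictlyFeasible A b) (hxb : ∀ i, 0 < xbar i)
    (hη : ∀ i, |Real.log (xbar i) - Real.log (x i)| ≤ η) (h0 : 0 ≤ η)
    (hE : (Real.exp (2 * η) - 1) * L ≤ radius ε l / 2)
    (hsmall : potential f ε (x + scale x (direction A f ε (radius ε l) x xbar)) - potential f ε x
      > -(ε ^ 2 / (2 * l + 4 * ε + 4))) :
    IsApproxKKT f (fun i x => A.mulVec x.ofLp i - b i) (fun i x => x i) (2 * ε) x := by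
  set v := scale x (gradient (potential f ε) x) with hv
  set u := multiplier A x xbar v with hu
  set z := A.transpose *ᵥ u with hz
  set g := projGrad A f ε x xbar with hg
  set β := radius ε l with hβ
  set q := g - (v - scale x (WithLp.toLp 2 z)) with hq
  have hβ0 : 0 < β := radius_pos hε hl
  have hβ1 : β ≤ ε / 2 := radius_le hε hl
  have hqE : ‖q‖ ≤ β / 2 := by
    refine (norm_projGrad_sub_le hA f ε hx.2 hxb hη h0).trans (le_trans ?_ hE)
    refine mul_le_mul_of_nonneg_left (hL x hx) ?_
    rw [sub_nonneg, Real.one_le_exp_iff]; linarith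
  -- by the quadratic upper bound, a large projected gradient would force a large decrease
  have hgE : ‖g‖ + ‖q‖ ≤ ε := by
    by_cases hg0 : g = 0
    · rw [hg0, norm_zero]; linarith
    have hgp : 0 < ‖g‖ := norm_pos_iff.2 hg0
    have hdir : direction A f ε β x xbar = -(β / ‖g‖) • g := by
      rw [direction, if_neg hg0]
    have hstep := potential_step_le hε.le hf hlip hx
      ((direction_norm_le A f ε hβ0.le x xbar).trans (by linarith))
      ((direction_norm_le A f ε hβ0.le x xbar).trans (radius_le_third hε hl hε2))
      (mulVec_scale_direction hA f ε β hx.2 hxb)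
    -- `v = g - q + X Aᵀ u`, where `X Aᵀ u` is orthogonal to `g` because `A X g = 0`
    have hgv : ‖g‖ ^ 2 - ‖g‖ * ‖q‖ ≤ inner ℝ v g := by
      have e : v = g - q + scale x (WithLp.toLp 2 z) := by rw [hq]; abel
      have h1 : inner ℝ g (scale x (WithLp.toLp 2 z)) = 0 := by
        rw [hz, inner_scale_transpose, hg, mulVec_scale_projGrad hA f ε hx.2 hxb, dotProduct_zero]
      have h2 := real_inner_le_norm g q
      rw [e, inner_add_left, inner_sub_left, real_inner_self_eq_norm_sq,
        real_inner_comm g (scale x _), h1, real_inner_comm g q]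
      linarith
    have hdn : ‖direction A f ε β x xbar‖ = β := by
      rw [hdir, norm_smul, norm_neg, Real.norm_of_nonneg (by positivity),
        div_mul_cancel₀ _ hgp.ne']
    rw [hdn, ← hv, hdir, inner_smul_right] at hstep
    rw [hdir] at hsmall
    have h3 : β * (‖g‖ - ‖q‖) ≤ β / ‖g‖ * inner ℝ v g := by
      calc β * (‖g‖ - ‖q‖) = β / ‖g‖ * (‖g‖ ^ 2 - ‖g‖ * ‖q‖) := by field_simp
        _ ≤ _ := mul_le_mul_of_nonneg_left hgv (by positivity)
    have h4 : ε ^ 2 / (2 * l + 4 * ε + 4) = β * ε / 2 := by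
      rw [hβ, radius]; field_simp; ring
    have h5 : β * (l + 2 * ε + 2) = ε := by
      rw [hβ, radius]; field_simp
    have h6 : β * (‖g‖ - ‖q‖) < β * (ε - β) := by
      have : (l / 2 + ε) * β ^ 2 = β * (ε / 2) - β ^ 2 := by
        linear_combination (β / 2) * h5
      nlinarith
    have h7 := lt_of_mul_lt_mul_left h6 hβ0.le
    linarith
  -- `X (∇f(x) - Aᵀ u) = ε e + (g - q)` gives nonnegativity and approximate complementarity
  have hs : ∀ i, x i * (gradient f x i - z i) = ε + (g - q) i := by
    intro i
    have e : (g - q) i = v i - x i * z i := by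
      rw [hq, sub_sub_cancel]; rfl
    have := (hx.2 i).ne'
    rw [e, hv, scale_apply, gradient_potential (differentiableAt_of_pos hf hx.2) hx.2]
    field_simp
    ring
  have hb : ∀ i, |(g - q) i| ≤ ε := fun i =>
    (abs_coord_le _ i).trans ((norm_sub_le _ _).trans hgE)
  refine ⟨fun i => -u i, fun i => gradient f x i - z i, fun i => ?_, fun i => ?_, hx.2,
    fun j => ?_, fun i => ?_⟩
  · have h1 := (abs_le.1 (hb i)).1
    have h2 : 0 ≤ x i * (gradient f x i - z i) := by rw [hs]; linarith
    exact (mul_nonneg_iff_of_pos_left (hx.2 i)).1 h2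
  · simp [hx.1]
  · have e : (gradient f x + ∑ i, -u i • gradient (fun x : EuclideanSpace ℝ (Fin n) =>
        A.mulVec x.ofLp i - b i) x - ∑ i, (gradient f x i - z i) •
        gradient (fun x : EuclideanSpace ℝ (Fin n) => x i) x) j = 0 := by
      simp only [PiLp.sub_apply, PiLp.add_apply, WithLp.ofLp_sum, Finset.sum_apply,
        PiLp.smul_apply, gradient_affine, gradient_coord, smul_eq_mul]
      have : z j = ∑ i, A i j * u i := rfl
      simp [this, mul_comm]
    rw [e, abs_zero]
    linarith
  · have h1 := abs_le.1 (hb i)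
    change |x i * (gradient f x i - z i)| ≤ _
    rw [hs, abs_le]
    constructor <;> linarith

end Projection

/-! ### Accuracy of the lazily updated approximations -/

section Boundary

variable {n m : ℕ}

/-- A feasible direction can be rescaled so that its smallest coordinate is `-1`; then `x + s X e`
reaches the boundary of the positive orthant at `s = 1`. -/
lemma exists_normalized_descent {A : Matrix (Fin m) (Fin n) ℝ} {x d : EuclideanSpace ℝ (Fin n)}
    (hd : d ≠ 0) (hA : A.mulVec (scale x d).ofLp = 0) :
    ∃ e : EuclideanSpace ℝ (Fin n), A.mulVec (scale x e).ofLp = 0 ∧ (∃ j, e j = -1) ∧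
      ∀ i, -1 ≤ e i := by
  have key : ∀ d : EuclideanSpace ℝ (Fin n), A.mulVec (scale x d).ofLp = 0 → (∃ i, d i < 0) →
      ∃ e : EuclideanSpace ℝ (Fin n), A.mulVec (scale x e).ofLp = 0 ∧ (∃ j, e j = -1) ∧
      ∀ i, -1 ≤ e i := by
    rintro d hA ⟨i0, hi0⟩
    obtain ⟨j, -, hj⟩ := Finset.exists_min_image Finset.univ (fun i => d i) ⟨i0, Finset.mem_univ _⟩
    have hj0 : d j < 0 := (hj i0 (Finset.mem_univ _)).trans_lt hi0
    refine ⟨(-d j)⁻¹ • d, ?_, ⟨j, ?_⟩, fun i => ?_⟩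
    · rw [scale_smul, WithLp.ofLp_smul, Matrix.mulVec_smul, hA, smul_zero]
    · have := hj0.ne
      simp only [PiLp.smul_apply, smul_eq_mul]
      field_simp
    · have := hj i (Finset.mem_univ _)
      simp only [PiLp.smul_apply, smul_eq_mul]
      rw [inv_mul_eq_div, le_div_iff₀ (by linarith)]
      linarith
  by_cases h : ∃ i, d i < 0
  · exact key d hA h
  · push Not at h
    obtain ⟨i, hi⟩ : ∃ i, d i ≠ 0 := by
      by_contra! h'
      exact hd (PiLp.ext h')
    refine key (-d) ?_ ⟨i, ?_⟩
    · have : scale x (-d) = -scale x d := by ext i; simp [scale_apply]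
      rw [this, WithLp.ofLp_neg, Matrix.mulVec_neg, hA, neg_zero]
    · have := lt_of_le_of_ne (h i) hi.symm
      simpa using this

/-- Unless the feasible set is a single point, the bound `L` on the scaled gradient of the
potential is at least `ε`. Otherwise every product `x_i ∂_i f(x)` would be at least `ε - L > 0`,
so that `f` would tend to `-∞` logarithmically on a segment that ends on the boundary of the
feasible set. -/
lemma le_gradBound {A : Matrix (Fin m) (Fin n) ℝ} {b : Fin m → ℝ}
    {f : EuclideanSpace ℝ (Fin n) → ℝ} {ε L B : ℝ}
    (hf : DifferentiableOn ℝ f {x | ∀ i, 0 < x i}) (hL : ScaledPotentialGradBound A b f ε L)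
    (hB : ∀ x ∈ strictlyFeasible A b, B ≤ f x)
    {x d : EuclideanSpace ℝ (Fin n)} (hx : x ∈ strictlyFeasible A b)
    (hd : d ≠ 0) (hA : A.mulVec (scale x d).ofLp = 0) : ε ≤ L := by
  by_contra! hlt
  obtain ⟨e, heA, ⟨j, hj⟩, he⟩ := exists_normalized_descent hd hA
  set c := ε - L with hc
  have hL0 : 0 ≤ L := (norm_nonneg _).trans (hL x hx)
  have hpos : ∀ s : ℝ, 0 ≤ s → s < 1 → ∀ i, 0 < 1 + s * e i := fun s h0 h1 i => by
    nlinarith [he i]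
  have hcoord : ∀ (s : ℝ) (i), (x + s • scale x e) i = x i * (1 + s * e i) := fun s i => by
    simp [scale_apply]; ring
  have hmem : ∀ s : ℝ, 0 ≤ s → s < 1 → x + s • scale x e ∈ strictlyFeasible A b := by
    refine fun s h0 h1 => ⟨?_, fun i => ?_⟩
    · rw [WithLp.ofLp_add, Matrix.mulVec_add, WithLp.ofLp_smul, Matrix.mulVec_smul, heA, smul_zero,
        add_zero, hx.1]
    · rw [hcoord]; exact mul_pos (hx.2 i) (hpos s h0 h1 i)
  have hgrad : ∀ y ∈ strictlyFeasible A b, ∀ i,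
      c ≤ y i * gradient f y i ∧ y i * gradient f y i ≤ 2 * ε := by
    intro y hy i
    have h1 := abs_le.1 ((abs_coord_le _ i).trans (hL y hy))
    rw [scale_apply, gradient_potential (differentiableAt_of_pos hf hy.2) hy.2] at h1
    have h2 : y i * (gradient f y i - ε / y i) = y i * gradient f y i - ε := by
      have := (hy.2 i).ne'
      field_simp
    rw [h2] at h1
    constructor <;> linarith [h1.1, h1.2]
  -- `2 ε` bounds the products from above, so that only coordinate `j` contributes a singular term
  set M := ∑ i, |e i| * (2 * ε) with hM
  -- along the segment, `f` is at most `c log (1 - s)` plus a linear function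
  let h : ℝ → ℝ := fun s => f (x + s • scale x e) - c * Real.log (1 - s) - s * M
  have hder : ∀ s ∈ Set.Ico (0 : ℝ) 1, HasDerivAt h
      (inner ℝ (gradient f (x + s • scale x e)) (scale x e) - c * (-1 / (1 - s)) - M) s := by
    intro s hs
    have h1 : HasDerivAt (fun s : ℝ => x + s • scale x e) (scale x e) s := by
      simpa using ((hasDerivAt_id s).smul_const (scale x e)).const_add x
    have h2 := (differentiableAt_of_pos hf (hmem s hs.1 hs.2).2).hasFDerivAt.comp_hasDerivAt s h1
    rw [inner_gradient]
    have h3 : HasDerivAt (fun s : ℝ => Real.log (1 - s)) (-1 / (1 - s)) s :=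
      ((hasDerivAt_id s).const_sub 1).log (by have := hs.2; simp only [id]; linarith)
    exact ((h2.sub (h3.const_mul c)).sub ((hasDerivAt_id s).mul_const M)).congr_deriv (by simp)
  have hanti : AntitoneOn h (Set.Ico 0 1) := by
    refine antitoneOn_of_deriv_nonpos (convex_Ico 0 1)
      (fun s hs => (hder s hs).continuousAt.continuousWithinAt)
      (fun s hs => (hder s (interior_subset hs)).differentiableAt.differentiableWithinAt) ?_
    intro s hs
    have hs := interior_subset hs
    rw [(hder s hs).deriv]
    set y := x + s • scale x e with hy
    have hym := hmem s hs.1 hs.2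
    have hterm : ∀ i, gradient f y i * (x i * e i)
        ≤ |e i| * (2 * ε) + if i = j then -(c / (1 - s)) else 0 := by
      intro i
      have hp := hpos s hs.1 hs.2 i
      obtain ⟨g1, g2⟩ := hgrad y hym i
      have hw : gradient f y i * (x i * e i) = e i / (1 + s * e i) * (y i * gradient f y i) := by
        have hyi : y i = x i * (1 + s * e i) := hcoord s i
        have hp' := hp.ne'
        rw [hyi, div_mul_eq_mul_div, eq_div_iff hp']
        ring
      have he0 := abs_nonneg (e i)
      have hε0 : 0 < ε := by linarith
      rw [hw]
      split_ifs with hij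
      · have h1s : 0 < 1 - s := by linarith [hs.2]
        subst hij
        rw [hj] at *
        have : -1 / (1 + s * -1) * (y i * gradient f y i) ≤ -(c / (1 - s)) := by
          rw [show (1 + s * -1) = 1 - s by ring, neg_div, neg_mul, neg_le_neg_iff, one_div,
            inv_mul_eq_div]
          gcongr
        have : 0 ≤ |(-1 : ℝ)| * (2 * ε) := by positivity
        linarith
      · rw [add_zero]
        rcases le_or_gt 0 (e i) with hei | hei
        · rw [abs_of_nonneg hei]
          have h1 : e i / (1 + s * e i) ≤ e i := div_le_self hei (by nlinarith [hs.1])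
          have h2 : 0 ≤ e i / (1 + s * e i) := by positivity
          exact mul_le_mul h1 g2 (by linarith) hei
        · have h1 : e i / (1 + s * e i) ≤ 0 := div_nonpos_of_nonpos_of_nonneg hei.le hp.le
          have h2 := mul_nonpos_of_nonpos_of_nonneg h1 (by linarith : 0 ≤ y i * gradient f y i)
          have : 0 ≤ |e i| * (2 * ε) := by positivity
          linarith
    have hsum : inner ℝ (gradient f y) (scale x e) ≤ M + -(c / (1 - s)) := by
      have h1 := Finset.sum_le_sum fun i (_ : i ∈ Finset.univ) => hterm i
      rw [Finset.sum_add_distrib, Finset.sum_ite_eq' Finset.univ j, if_pos (Finset.mem_univ _)] at h1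
      refine le_trans (le_of_eq ?_) h1
      rw [PiLp.inner_apply]
      refine Finset.sum_congr rfl fun i _ => ?_
      simp [scale_apply, mul_comm]
    have : c * (-1 / (1 - s)) = -(c / (1 - s)) := by ring
    rw [this]
    linarith
  have hcp : 0 < c := by linarith
  have hM0 : 0 ≤ M := Finset.sum_nonneg fun i _ => by
    have := abs_nonneg (e i); nlinarith
  have hfx := hB x hx
  -- at the parameter `1 - exp (-N)` the bound on `f` drops below `B` once `c N > f x - B + M`
  set N := (f x - B + M + 1) / c with hN
  have hN0 : 0 ≤ N := div_nonneg (by linarith) hcp.le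
  set s := 1 - Real.exp (-N) with hs
  have hs1 : s < 1 := by have := Real.exp_pos (-N); linarith
  have hs0 : 0 ≤ s := by
    have : Real.exp (-N) ≤ 1 := Real.exp_le_one_iff.2 (by linarith)
    linarith
  have h01 := hanti ⟨le_rfl, zero_lt_one⟩ ⟨hs0, hs1⟩ hs0
  have hBs := hB _ (hmem s hs0 hs1)
  have hlog : Real.log (1 - s) = -N := by rw [hs, sub_sub_cancel, Real.log_exp]
  have hcN : c * N = f x - B + M + 1 := by rw [hN]; field_simp
  simp only [h, hlog, zero_smul, add_zero, sub_zero, Real.log_one, mul_zero, zero_mul] at h01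
  nlinarith

end Boundary

section Lazy

/-- The dyadic estimate behind the lazy update: if no multiple of `2 ^ K` lies in `(a, b]`, and
`f` changes by at most `c` on each dyadic interval of level below `K` that ends in `(a, b]`, then
`(a, b]` splits into at most `2 K` such intervals. -/
lemma abs_sub_le_of_dyadic {c : ℝ} (hc : 0 ≤ c) (K : ℕ) :
    ∀ (f : ℕ → ℝ) (a b : ℕ), a ≤ b →
      (∀ s, a < s → s ≤ b → ∀ k < K, 2 ^ k ∣ s → |f s - f (s - 2 ^ k)| ≤ c) →
      (∀ s, a < s → s ≤ b → ¬ 2 ^ K ∣ s) → |f b - f a| ≤ 2 * K * c := by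
  induction K with
  | zero =>
    intro f a b hab _ h2
    rcases hab.eq_or_lt with rfl | hlt
    · simp
    · exact absurd (by simp) (h2 b hlt le_rfl)
  | succ K ih =>
    intro f a b hab h1 h2
    rcases lt_or_ge (b / 2) ((a + 1) / 2) with hlt | hge
    · have : a = b := by omega
      subst this
      rw [sub_self, abs_zero]
      positivity
    -- halving the even part `[2 ⌈a / 2⌉, 2 ⌊b / 2⌋]` lowers every level by one
    have hmid := ih (fun s => f (2 * s)) ((a + 1) / 2) (b / 2) hge
      (fun s hs1 hs2 k hk hdvd => by
        have := h1 (2 * s) (by omega) (by omega) (k + 1) (by omega)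
          (by rw [pow_succ']; exact Nat.mul_dvd_mul_left 2 hdvd)
        rwa [pow_succ', ← Nat.mul_sub] at this)
      (fun s hs1 hs2 hdvd => h2 (2 * s) (by omega) (by omega)
        (by rw [pow_succ']; exact Nat.mul_dvd_mul_left 2 hdvd))
    have hb : |f b - f (2 * (b / 2))| ≤ c := by
      rcases Nat.even_or_odd' b with ⟨q, hq | hq⟩
      · rw [show 2 * (b / 2) = b by omega, sub_self, abs_zero]; exact hc
      · have := h1 b (by omega) le_rfl 0 (by omega) (by simp)
        rwa [show b - 2 ^ 0 = 2 * (b / 2) by simp; omega] at this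
    have ha : |f (2 * ((a + 1) / 2)) - f a| ≤ c := by
      rcases Nat.even_or_odd' a with ⟨q, hq | hq⟩
      · rw [show 2 * ((a + 1) / 2) = a by omega, sub_self, abs_zero]; exact hc
      · have := h1 (a + 1) (by omega) (by omega) 0 (by omega) (by simp)
        rwa [show a + 1 - 2 ^ 0 = a by simp, show a + 1 = 2 * ((a + 1) / 2) by omega] at this
    have e : f b - f a = (f b - f (2 * (b / 2))) + (f (2 * (b / 2)) - f (2 * ((a + 1) / 2)))
      + (f (2 * ((a + 1) / 2)) - f a) := by ring
    rw [e]
    refine (abs_add_three _ _ _).trans ?_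
    push_cast
    linarith

variable {n : ℕ}

/-- The lazy update keeps every coordinate within the tolerance. -/
lemma abs_lazy_sub_le {y ybar : ℕ → EuclideanSpace ℝ (Fin n)} {δ : ℝ} (hδ : 0 ≤ δ)
    (h0 : ybar 0 = y 0) (hs : ∀ t, ybar (t + 1) = selectVector (ybar t) y (t + 1) δ)
    (t : ℕ) (i : Fin n) : |ybar t i - y t i| ≤ δ := by
  set K := Nat.clog 2 n with hK
  set c := δ / (2 * (K : ℝ)) with hc
  -- the time `a` of the last refresh of coordinate `i`
  have key : ∃ a ≤ t, ybar t i = y a i ∧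
      (∀ s, a < s → s ≤ t → ∀ k < K, 2 ^ k ∣ s → |y s i - y (s - 2 ^ k) i| ≤ c) ∧
      (∀ s, a < s → s ≤ t → ¬ 2 ^ K ∣ s) := by
    induction t with
    | zero => exact ⟨0, le_rfl, by rw [h0], fun s h1 h2 => by omega, fun s h1 h2 => by omega⟩
    | succ t ih =>
      have e : ybar (t + 1) i = if 2 ^ K ∣ t + 1 ∨
          ∃ k ≤ K, 2 ^ k ∣ t + 1 ∧ c ≤ |y (t + 1) i - y (t + 1 - 2 ^ k) i|
          then y (t + 1) i else ybar t i := by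
        rw [hs, selectVector]
      by_cases h : 2 ^ K ∣ t + 1 ∨
          ∃ k ≤ K, 2 ^ k ∣ t + 1 ∧ c ≤ |y (t + 1) i - y (t + 1 - 2 ^ k) i|
      · rw [if_pos h] at e
        exact ⟨t + 1, le_rfl, e, fun s h1 h2 => by omega, fun s h1 h2 => by omega⟩
      · rw [if_neg h] at e
        push Not at h
        obtain ⟨a, ha, hy, h1, h2⟩ := ih
        refine ⟨a, by omega, by rw [e, hy], fun s hs1 hs2 k hk hd => ?_, fun s hs1 hs2 => ?_⟩
        · rcases Nat.lt_or_ge s (t + 1) with hlt | hge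
          · exact h1 s hs1 (by omega) k hk hd
          · obtain rfl : s = t + 1 := by omega
            exact (h.2 k hk.le hd).le
        · rcases Nat.lt_or_ge s (t + 1) with hlt | hge
          · exact h2 s hs1 (by omega)
          · obtain rfl : s = t + 1 := by omega
            exact h.1
  obtain ⟨a, ha, hy, h1, h2⟩ := key
  have hc0 : 0 ≤ c := by positivity
  have := abs_sub_le_of_dyadic hc0 K (fun s => y s i) a t ha h1 h2
  rw [hy, abs_sub_comm]
  refine this.trans ?_
  -- for `K = 0` the division in `c` is by zero, but then every coordinate is always refreshed
  rcases Nat.eq_zero_or_pos K with hz | hp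
  · rw [hz]; simpa using hδ
  · rw [hc]
    have : (0 : ℝ) < K := by exact_mod_cast hp
    apply le_of_eq
    field_simp

end Lazy

section Iterates

variable {n m : ℕ} (A : Matrix (Fin m) (Fin n) ℝ) (f : EuclideanSpace ℝ (Fin n) → ℝ)
  (ε l L : ℝ) (x₀ : EuclideanSpace ℝ (Fin n))

/-- The approximation `x̄_t` of the iterate `x_t`. -/
noncomputable def approxIterate (t : ℕ) : EuclideanSpace ℝ (Fin n) :=
  expVec (state A f ε l L x₀ t).2

lemma state_fst {s t : ℕ} (h : s ≤ t) :
    (state A f ε l L x₀ t).1 s = iterate A f ε l L x₀ s := by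
  induction t with
  | zero => obtain rfl : s = 0 := by omega
            rfl
  | succ t ih =>
    rcases Nat.lt_or_ge s (t + 1) with hlt | hge
    · rw [← ih (by omega)]
      simp only [state]
      rw [Function.update_of_ne (by omega)]
    · obtain rfl : s = t + 1 := by omega
      rfl

lemma iterate_zero : iterate A f ε l L x₀ 0 = x₀ := rfl

lemma iterate_succ (t : ℕ) : iterate A f ε l L x₀ (t + 1) = iterate A f ε l L x₀ t +
    scale (iterate A f ε l L x₀ t) (direction A f ε (radius ε l) (iterate A f ε l L x₀ t)
      (approxIterate A f ε l L x₀ t)) := by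
  simp only [iterate, state, Function.update_self]
  rfl

lemma selectVector_congr {ybar : EuclideanSpace ℝ (Fin n)} {y z : ℕ → EuclideanSpace ℝ (Fin n)}
    {t : ℕ} (h : ∀ s ≤ t, y s = z s) (δ : ℝ) :
    selectVector ybar y t δ = selectVector ybar z t δ := by
  unfold selectVector
  simp only [h t le_rfl, h _ (Nat.sub_le t _)]

lemma state_snd_succ (t : ℕ) : (state A f ε l L x₀ (t + 1)).2 =
    selectVector (state A f ε l L x₀ t).2 (fun k => lnVec (iterate A f ε l L x₀ k)) (t + 1)
      (tolerance ε l L) := by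
  have h : (state A f ε l L x₀ (t + 1)).2 = selectVector (state A f ε l L x₀ t).2
      (fun k => lnVec ((state A f ε l L x₀ (t + 1)).1 k)) (t + 1) (tolerance ε l L) := rfl
  rw [h]
  exact selectVector_congr (fun s hs => by rw [state_fst A f ε l L x₀ hs]) _

lemma approxIterate_pos (t : ℕ) (i : Fin n) : 0 < approxIterate A f ε l L x₀ t i :=
  Real.exp_pos _

lemma log_approxIterate (t : ℕ) (i : Fin n) :
    Real.log (approxIterate A f ε l L x₀ t i) = (state A f ε l L x₀ t).2 i :=
  Real.log_exp _

variable {A f ε l L x₀}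

lemma iterate_mem {b : Fin m → ℝ} (hA : A.rank = m) (hε : 0 < ε) (hε2 : ε ≤ 1 / 2) (hl : 0 ≤ l)
    (hx₀ : x₀ ∈ strictlyFeasible A b) (t : ℕ) : iterate A f ε l L x₀ t ∈ strictlyFeasible A b := by
  induction t with
  | zero => exact hx₀
  | succ t ih =>
    rw [iterate_succ]
    have h := direction_norm_le A f ε (radius_pos hε hl).le (iterate A f ε l L x₀ t)
      (approxIterate A f ε l L x₀ t)
    exact add_scale_mem ih (h.trans_lt (by linarith [radius_le_third hε hl hε2]))
      (mulVec_scale_direction hA f ε _ ih.2 (approxIterate_pos A f ε l L x₀ t))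

lemma tolerance_pos (hε : 0 < ε) (hl : 0 ≤ l) (hL : 0 < L) : 0 < tolerance ε l L := by
  have := radius_pos hε hl
  unfold tolerance
  positivity

lemma abs_log_approxIterate_sub_le (hε : 0 < ε) (hl : 0 ≤ l) (hL : 0 < L) (t : ℕ) (i : Fin n) :
    |Real.log (approxIterate A f ε l L x₀ t i) - Real.log (iterate A f ε l L x₀ t i)|
      ≤ tolerance ε l L := by
  rw [log_approxIterate]
  exact abs_lazy_sub_le (y := fun k => lnVec (iterate A f ε l L x₀ k))
    (ybar := fun t => (state A f ε l L x₀ t).2) (tolerance_pos hε hl hL).le rfl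
    (state_snd_succ A f ε l L x₀) t i

/-- If the feasible set is a single point, the algorithm stays there, and `x̄_t` does too. -/
lemma state_eq_of_kernel_trivial {b : Fin m → ℝ} (hA : A.rank = m)
    (hx₀ : x₀ ∈ strictlyFeasible A b)
    (h : ∀ d : EuclideanSpace ℝ (Fin n), A.mulVec (scale x₀ d).ofLp = 0 → d = 0) (t : ℕ) :
    state A f ε l L x₀ t = (fun _ => x₀, lnVec x₀) := by
  induction t with
  | zero => rfl
  | succ t ih =>
    have hd : direction A f ε (radius ε l) x₀ (expVec (lnVec x₀)) = 0 :=
      h _ (mulVec_scale_direction hA f ε _ hx₀.2 fun i => Real.exp_pos _)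
    simp only [state, ih]
    rw [hd, scale_zero, add_zero]
    have hu : Function.update (fun _ : ℕ => x₀) (t + 1) x₀ = fun _ => x₀ := by simp
    rw [hu]
    congr 1
    ext i
    simp [selectVector]

/-- The approximations `x̄_t` are accurate enough for the optimality certificate. When the feasible
set is a single point, the tolerance may be large, but then `x̄_t = x_t`. -/
lemma exists_accuracy {b : Fin m → ℝ} {B : ℝ} (hA : A.rank = m)
    (hf : DifferentiableOn ℝ f {x | ∀ i, 0 < x i}) (hε : 0 < ε)
    (hl : 0 ≤ l) (hL0 : 0 < L) (hL : ScaledPotentialGradBound A b f ε L)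
    (hB : ∀ x ∈ strictlyFeasible A b, B ≤ f x) (hx₀ : x₀ ∈ strictlyFeasible A b) :
    ∃ η, 0 ≤ η ∧ (Real.exp (2 * η) - 1) * L ≤ radius ε l / 2 ∧ ∀ t i,
      |Real.log (approxIterate A f ε l L x₀ t i) - Real.log (iterate A f ε l L x₀ t i)| ≤ η := by
  by_cases h : ∀ d : EuclideanSpace ℝ (Fin n), A.mulVec (scale x₀ d).ofLp = 0 → d = 0
  · refine ⟨0, le_rfl, by
      simpa using (half_pos (radius_pos hε hl)).le, fun t i => ?_⟩
    rw [log_approxIterate, iterate, state_eq_of_kernel_trivial hA hx₀ h]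
    simp [lnVec]
  · push Not at h
    obtain ⟨d, hd, hd0⟩ := h
    have hεL := le_gradBound hf hL hB hx₀ hd0 hd
    have hδ := tolerance_pos hε hl hL0
    -- `ε ≤ L` makes the tolerance small in absolute terms, so that `exp` can be linearized
    have h1 : tolerance ε l L ≤ 1 / 15 := by
      refine (min_le_left _ _).trans ?_
      rw [div_le_div_iff₀ (by positivity) (by norm_num)]
      linarith
    have h2 : tolerance ε l L * L ≤ radius ε l / 92 := by
      have h3 : tolerance ε l L ≤ radius ε l / (92 * L) := min_le_right _ _
      calc tolerance ε l L * L ≤ radius ε l / (92 * L) * L := by gcongr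
        _ = _ := by field_simp
    refine ⟨tolerance ε l L, hδ.le, ?_, abs_log_approxIterate_sub_le hε hl hL0⟩
    have h4 := Real.abs_exp_sub_one_le (x := 2 * tolerance ε l L)
      (by rw [abs_of_pos (by linarith)]; linarith)
    rw [abs_of_pos (by linarith : 0 < 2 * tolerance ε l L)] at h4
    have h5 := mul_le_mul_of_nonneg_right ((le_abs_self _).trans h4) hL0.le
    have := radius_pos hε hl
    linarith

/-- If no stopping test succeeds, the decreases of the potential add up to the full gap; the
analytic center bounds what the logarithmic terms can contribute to them. -/
lemma objective_gap_le {b : Fin m → ℝ} {C₀ v : ℝ} (hA : A.rank = m) (hε : 0 < ε)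
    (hε2 : ε ≤ 1 / 2) (hl : 0 ≤ l) (hx₀ : IsApproxAnalyticCenter A b C₀ x₀)
    (hT : ∀ t < maxIter (f x₀ - v) C₀ ε l, ¬ Stops A f ε l L x₀ t) :
    f (iterate A f ε l L x₀ (maxIter (f x₀ - v) C₀ ε l)) - v ≤ ε := by
  set T := maxIter (f x₀ - v) C₀ ε l with hTdef
  set θ := ε ^ 2 / (2 * l + 4 * ε + 4) with hθ
  have hdec : ∀ t ≤ T, potential f ε (iterate A f ε l L x₀ t) ≤ potential f ε x₀ - t * θ := by
    intro t
    induction t with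
    | zero => intro _; simp [iterate_zero]
    | succ t ih =>
      intro ht
      have h1 := ih (by omega)
      have h2 := hT t (by omega)
      simp only [Stops, gt_iff_lt, not_lt] at h2
      push_cast
      linarith
  have h1 := hdec T le_rfl
  have h2 := hx₀.2 _ (iterate_mem (f := f) (L := L) hA hε hε2 hl hx₀.1 T)
  have h3 : f x₀ - v + (C₀ - 1) * ε ≤ T * θ := by
    have h4 : (f x₀ - v + (C₀ - 1) * ε) * (2 * l + 4 * ε + 4) / ε ^ 2 ≤ T := Nat.le_ceil _
    have hθ0 : 0 < θ := by positivity
    have h5 := mul_le_mul_of_nonneg_right h4 hθ0.le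
    refine le_trans (le_of_eq ?_) h5
    rw [hθ]
    field_simp
  simp only [potential] at h1
  have h4 := mul_le_mul_of_nonneg_left h2 hε.le
  linarith

end Iterates

/-! ### Counting the refreshed coordinates -/

section Counting

variable {n m : ℕ}

open Classical in
/-- The coordinates that the lazy update refreshes at time `t`. -/
noncomputable def refreshSet (y : ℕ → EuclideanSpace ℝ (Fin n)) (t : ℕ) (δ : ℝ) : Finset (Fin n) :=
  {i | 2 ^ Nat.clog 2 n ∣ t ∨
    ∃ k ≤ Nat.clog 2 n, 2 ^ k ∣ t ∧ δ / (2 * Nat.clog 2 n) ≤ |y t i - y (t - 2 ^ k) i|}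

open Classical in
lemma selectVector_apply (ybar : EuclideanSpace ℝ (Fin n)) (y : ℕ → EuclideanSpace ℝ (Fin n))
    (t : ℕ) (δ : ℝ) (i : Fin n) :
    selectVector ybar y t δ i = if i ∈ refreshSet y t δ then y t i else ybar i := by
  simp only [refreshSet, Finset.mem_filter, Finset.mem_univ, true_and]
  rfl

lemma card_mul_sq_le (S : Finset (Fin n)) (z : EuclideanSpace ℝ (Fin n)) {c : ℝ} (hc : 0 ≤ c)
    (h : ∀ i ∈ S, c ≤ |z i|) : (S.card : ℝ) * c ^ 2 ≤ ‖z‖ ^ 2 := by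
  rw [EuclideanSpace.real_norm_sq_eq, ← nsmul_eq_mul, ← Finset.sum_const]
  calc ∑ i ∈ S, c ^ 2 ≤ ∑ i ∈ S, z i ^ 2 := Finset.sum_le_sum fun i hi => by
        rw [← sq_abs (z i)]; exact pow_le_pow_left₀ hc (h i hi) 2
    _ ≤ ∑ i, z i ^ 2 := Finset.sum_le_sum_of_subset_of_nonneg (Finset.subset_univ S)
        fun i _ _ => sq_nonneg _

lemma norm_sub_le_of_steps {y : ℕ → EuclideanSpace ℝ (Fin n)} {ρ : ℝ}
    (h : ∀ s, ‖y (s + 1) - y s‖ ≤ ρ) (s d : ℕ) : ‖y (s + d) - y s‖ ≤ d * ρ := by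
  induction d with
  | zero => simp
  | succ d ih =>
    have e : y (s + (d + 1)) - y s = (y (s + d + 1) - y (s + d)) + (y (s + d) - y s) := by
      rw [← add_assoc]; abel
    rw [e]
    refine (norm_add_le _ _).trans ?_
    push_cast
    linarith [h (s + d)]

/-- In a stream with steps of length at most `ρ`, the squared changes over `2 ^ k` steps add up to
at most `(2 ^ k ρ)²`, so that level `k` refreshes at most `(2 ^ k c)²` coordinates, with `c = 2
⌈log₂ n⌉ ρ / δ`. A full refresh concerns `n ≤ 2 ^ ⌈log₂ n⌉` coordinates. -/
lemma sqrt_card_refreshSet_le {y : ℕ → EuclideanSpace ℝ (Fin n)} {ρ δ : ℝ} (hδ : 0 < δ)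
    (hρ : 0 ≤ ρ) (h : ∀ s, ‖y (s + 1) - y s‖ ≤ ρ) {t : ℕ} (ht : 0 < t) :
    √((refreshSet y t δ).card : ℝ) ≤ max 1 (2 * Nat.clog 2 n * ρ / δ) *
      ∑ k ∈ (Finset.range (Nat.clog 2 n + 1)).filter (fun k => 2 ^ k ∣ t), (2 : ℝ) ^ k := by
  classical
  set K := Nat.clog 2 n with hK
  set c := 2 * K * ρ / δ with hc
  set I := (Finset.range (K + 1)).filter (fun k => 2 ^ k ∣ t) with hI
  have hsum0 : 0 ≤ ∑ k ∈ I, (2 : ℝ) ^ k := Finset.sum_nonneg fun _ _ => by positivity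
  by_cases hfull : 2 ^ K ∣ t
  · have h1 : ((refreshSet y t δ).card : ℝ) ≤ (2 : ℝ) ^ K := by
      have h2 : (refreshSet y t δ).card ≤ n := by simpa using Finset.card_le_univ (refreshSet y t δ)
      exact_mod_cast h2.trans (Nat.le_pow_clog one_lt_two n)
    have h2 : (2 : ℝ) ^ K ≤ ∑ k ∈ I, (2 : ℝ) ^ k :=
      Finset.single_le_sum (f := fun k => (2 : ℝ) ^ k) (fun _ _ => by positivity) (by simp [hI, hfull])
    calc √((refreshSet y t δ).card : ℝ) ≤ (2 : ℝ) ^ K := by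
          rw [Real.sqrt_le_left (by positivity)]
          have : (1 : ℝ) ≤ 2 ^ K := one_le_pow₀ (by norm_num)
          nlinarith
      _ ≤ 1 * ∑ k ∈ I, (2 : ℝ) ^ k := by rw [one_mul]; exact h2
      _ ≤ _ := mul_le_mul_of_nonneg_right (le_max_left _ _) hsum0
  · have hKp : 0 < K := Nat.pos_of_ne_zero fun h0 => hfull (by rw [h0]; simp)
    have hKr : (0 : ℝ) < K := by exact_mod_cast hKp
    have hc0 : 0 ≤ c := by positivity
    set S : ℕ → Finset (Fin n) := fun k => {i | δ / (2 * K) ≤ |y t i - y (t - 2 ^ k) i|} with hS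
    have hsub : refreshSet y t δ ⊆ I.biUnion S := by
      intro i hi
      simp only [refreshSet, Finset.mem_filter, Finset.mem_univ, true_and] at hi
      rcases hi with hi | ⟨k, hk, hd, hi⟩
      · exact absurd hi hfull
      · simp only [Finset.mem_biUnion]
        exact ⟨k, by simp [hI, hd]; omega, by simpa [hS] using hi⟩
    have hcard : ∀ k ∈ I, ((S k).card : ℝ) ≤ ((2 : ℝ) ^ k * c) ^ 2 := by
      intro k hk
      have hk2 : 2 ^ k ∣ t := (Finset.mem_filter.1 hk).2
      have hle : 2 ^ k ≤ t := Nat.le_of_dvd ht hk2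
      have h1 := card_mul_sq_le (S k) (y t - y (t - 2 ^ k)) (c := δ / (2 * K)) (by positivity)
        (fun i hi => by simpa [hS] using hi)
      have h2 := norm_sub_le_of_steps h (t - 2 ^ k) (2 ^ k)
      rw [Nat.sub_add_cancel hle] at h2
      push_cast at h2
      have h3 := h1.trans (pow_le_pow_left₀ (norm_nonneg _) h2 2)
      have e : ((2 : ℝ) ^ k * c) ^ 2 * (δ / (2 * K)) ^ 2 = (2 ^ k * ρ) ^ 2 := by
        rw [hc]; field_simp
      rw [← e] at h3
      exact le_of_mul_le_mul_right h3 (by positivity)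
    have hle : ((refreshSet y t δ).card : ℝ) ≤ (∑ k ∈ I, (2 : ℝ) ^ k * c) ^ 2 := by
      calc ((refreshSet y t δ).card : ℝ) ≤ ∑ k ∈ I, ((S k).card : ℝ) := by
            exact_mod_cast (Finset.card_le_card hsub).trans Finset.card_biUnion_le
        _ ≤ ∑ k ∈ I, ((2 : ℝ) ^ k * c) ^ 2 := Finset.sum_le_sum hcard
        _ ≤ _ := Finset.sum_sq_le_sq_sum_of_nonneg fun _ _ => by positivity
    rw [← Finset.sum_mul] at hle
    calc √((refreshSet y t δ).card : ℝ) ≤ (∑ k ∈ I, (2 : ℝ) ^ k) * c := by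
          rw [Real.sqrt_le_left (by positivity)]; exact hle
      _ ≤ (∑ k ∈ I, (2 : ℝ) ^ k) * max 1 c := mul_le_mul_of_nonneg_left (le_max_right _ _) hsum0
      _ = _ := mul_comm _ _

/-- Level `k` is active at one out of `2 ^ k` times, which cancels its weight `2 ^ k`. -/
lemma sum_dyadic_le (K T : ℕ) : ∑ t ∈ Finset.range T,
    ∑ k ∈ (Finset.range (K + 1)).filter (fun k => 2 ^ k ∣ t + 1), (2 : ℝ) ^ k ≤ (K + 1) * T := by
  simp_rw [Finset.sum_filter]
  rw [Finset.sum_comm]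
  have h : ∀ k ∈ Finset.range (K + 1),
      ∑ t ∈ Finset.range T, (if 2 ^ k ∣ t + 1 then (2 : ℝ) ^ k else 0) ≤ T := by
    intro k _
    rw [← Finset.sum_filter, Finset.sum_const, Nat.card_multiples, nsmul_eq_mul]
    exact_mod_cast Nat.div_mul_le_self T (2 ^ k)
  calc _ ≤ ∑ k ∈ Finset.range (K + 1), (T : ℝ) := Finset.sum_le_sum h
    _ = _ := by simp

variable {A : Matrix (Fin m) (Fin n) ℝ} {f : EuclideanSpace ℝ (Fin n) → ℝ}
  {ε l L : ℝ} {x₀ : EuclideanSpace ℝ (Fin n)}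

lemma norm_lnVec_iterate_sub_le {b : Fin m → ℝ} (hA : A.rank = m) (hε : 0 < ε) (hε2 : ε ≤ 1 / 2)
    (hl : 0 ≤ l) (hx₀ : x₀ ∈ strictlyFeasible A b) (t : ℕ) :
    ‖lnVec (iterate A f ε l L x₀ (t + 1)) - lnVec (iterate A f ε l L x₀ t)‖ ≤ 2 * radius ε l := by
  set d := direction A f ε (radius ε l) (iterate A f ε l L x₀ t) (approxIterate A f ε l L x₀ t)
    with hd
  have hn := direction_norm_le A f ε (radius_pos hε hl).le (iterate A f ε l L x₀ t)
      (approxIterate A f ε l L x₀ t)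
  rw [← hd] at hn
  refine le_trans (norm_le_of_abs_le (b := d) (by norm_num : (0 : ℝ) ≤ 2) fun i => ?_)
    (mul_le_mul_of_nonneg_left hn (by norm_num))
  have hx := (iterate_mem (f := f) (L := L) hA hε hε2 hl hx₀ t).2 i
  have hdi := (abs_coord_le d i).trans (hn.trans (radius_le_third hε hl hε2))
  have hdi' := abs_le.1 hdi
  have e : (lnVec (iterate A f ε l L x₀ (t + 1)) - lnVec (iterate A f ε l L x₀ t)) i
      = Real.log (1 + d i) := by
    change Real.log (iterate A f ε l L x₀ (t + 1) i) - Real.log (iterate A f ε l L x₀ t i) = _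
    have e2 : iterate A f ε l L x₀ (t + 1) i = iterate A f ε l L x₀ t i * (1 + d i) := by
      rw [iterate_succ, ← hd, PiLp.add_apply, scale_apply]; ring
    rw [e2, Real.log_mul hx.ne' (by linarith)]
    ring
  rw [e]
  exact abs_log_one_add_le hdi

lemma radius_div_tolerance_le (hε : 0 < ε) (hl : 0 ≤ l) (hL : 0 < L) :
    radius ε l / tolerance ε l L ≤ 92 * L := by
  rw [div_le_iff₀ (tolerance_pos hε hl hL), tolerance, mul_min_of_nonneg _ _ (by positivity),
    le_min_iff]
  have h := radius_le hε hl
  constructor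
  · have : 92 * L * (ε / (15 * L)) = 92 / 15 * ε := by field_simp
    rw [this]; linarith
  · apply le_of_eq
    field_simp

open Classical in
lemma approxIterate_succ {b : Fin m → ℝ} (hA : A.rank = m) (hε : 0 < ε) (hε2 : ε ≤ 1 / 2)
    (hl : 0 ≤ l) (hx₀ : x₀ ∈ strictlyFeasible A b) (t : ℕ) (i : Fin n) :
    approxIterate A f ε l L x₀ (t + 1) i =
      if i ∈ refreshSet (fun k => lnVec (iterate A f ε l L x₀ k)) (t + 1) (tolerance ε l L)
      then iterate A f ε l L x₀ (t + 1) i else approxIterate A f ε l L x₀ t i := by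
  change Real.exp _ = _
  rw [state_snd_succ, selectVector_apply]
  split_ifs with h
  · exact Real.exp_log ((iterate_mem hA hε hε2 hl hx₀ (t + 1)).2 i)
  · rfl

lemma approxIterate_zero (hx₀ : ∀ i, 0 < x₀ i) (i : Fin n) :
    approxIterate A f ε l L x₀ 0 i = x₀ i := Real.exp_log (hx₀ i)

end Counting

/-! ### Programs and their step counts -/

section Programs

variable {Q α β : Type}

/-- Running one program after another. -/
def Prog.bind : Prog Q α → (α → Prog Q β) → Prog Q β
  | .ret a, f => f a
  | .op o next, f => .op o fun k => (next k).bind f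
  | .test i j next, f => .test i j fun b => (next b).bind f
  | .call q args next, f => .call q args fun k => (next k).bind f

/-- A program without oracle calls, as a program with access to oracles. -/
def Prog.lift : Prog Empty α → Prog Q α
  | .ret a => .ret a
  | .op o next => .op o fun k => (next k).lift
  | .test i j next => .test i j fun b => (next b).lift
  | .call q _ _ => q.elim

lemma Prog.run_bind (oracle : Q → List ℝ → List ℝ) (p : Prog Q α) (f : α → Prog Q β)
    (mem : List ℝ) :
    (p.bind f).run oracle mem =
      { out := ((f (p.run oracle mem).out).run oracle (p.run oracle mem).mem).out
        mem := ((f (p.run oracle mem).out).run oracle (p.run oracle mem).mem).mem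
        steps := (p.run oracle mem).steps +
          ((f (p.run oracle mem).out).run oracle (p.run oracle mem).mem).steps
        calls := (p.run oracle mem).calls ++
          ((f (p.run oracle mem).out).run oracle (p.run oracle mem).mem).calls } := by
  induction p generalizing mem with
  | ret a => simp [Prog.bind, Prog.run]
  | op o next ih => simp only [Prog.bind, Prog.run, ih]; simp; omega
  | test i j next ih => simp only [Prog.bind, Prog.run, ih]; simp; omega
  | call q args next ih => simp only [Prog.bind, Prog.run, ih]; simp; omega

lemma Prog.run_lift (oracle : Q → List ℝ → List ℝ) (p : Prog Empty α) (mem : List ℝ) :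
    (p.lift : Prog Q α).run oracle mem =
      { out := (p.run (fun q => q.elim) mem).out
        mem := (p.run (fun q => q.elim) mem).mem
        steps := (p.run (fun q => q.elim) mem).steps
        calls := [] } := by
  induction p generalizing mem with
  | ret a => simp [Prog.lift, Prog.run]
  | op o next ih => simp only [Prog.lift, Prog.run, ih]
  | test i j next ih => simp only [Prog.lift, Prog.run, ih]
  | call q args next ih => exact q.elim

/-- The memory is append-only, so that whatever a cell holds stays there. -/
lemma Prog.prefix_run (oracle : Q → List ℝ → List ℝ) (p : Prog Q α) (mem : List ℝ) :
    mem <+: (p.run oracle mem).mem := by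
  induction p generalizing mem with
  | ret a => exact List.prefix_rfl
  | op o next ih => exact (List.prefix_append _ _).trans (ih _ _)
  | test i j next ih => exact ih _ _
  | call q args next ih => exact (List.prefix_append _ _).trans (ih _ _)

/-- The cell with address `a` exists and holds `v`. -/
def At (mem : List ℝ) (a : ℕ) (v : ℝ) : Prop := mem[a]? = some v

lemma At.mono {mem mem' : List ℝ} {a : ℕ} {v : ℝ} (h : At mem a v) (hm : mem <+: mem') :
    At mem' a v := by
  obtain ⟨t, rfl⟩ := hm
  unfold At at *
  rw [List.getElem?_append_left (List.getElem?_eq_some_iff.1 h).1, h]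

lemma At.cell {mem : List ℝ} {a : ℕ} {v : ℝ} (h : At mem a v) : cell mem a = v := by
  unfold At at h
  rw [IPTR.cell, List.getD_eq_getElem?_getD, h, Option.getD_some]

lemma at_append (mem mem' : List ℝ) (v : ℝ) : At (mem ++ v :: mem') mem.length v := by
  simp [At]

/-- The cells with the addresses `a i` hold the coordinates of `v`. -/
def HoldsVec {ι : Type} (mem : List ℝ) (a : ι → ℕ) (v : ι → ℝ) : Prop := ∀ i, At mem (a i) (v i)

/-- The cells with the addresses `a i j` hold the entries of `M`, for arbitrary index types. -/
def HoldsMat {ι κ : Type} (mem : List ℝ) (a : ι → κ → ℕ) (M : Matrix ι κ ℝ) : Prop :=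
  ∀ i j, At mem (a i j) (M i j)

lemma HoldsVec.mono {ι : Type} {mem mem' : List ℝ} {a : ι → ℕ} {v : ι → ℝ}
    (h : HoldsVec mem a v) (hm : mem <+: mem') : HoldsVec mem' a v := fun i => (h i).mono hm

lemma HoldsMat.mono {ι κ : Type} {mem mem' : List ℝ} {a : ι → κ → ℕ} {M : Matrix ι κ ℝ}
    (h : HoldsMat mem a M) (hm : mem <+: mem') : HoldsMat mem' a M := fun i j => (h i j).mono hm

/-- From every memory that extends `mem`, the program `p` takes at most `c` steps, and its result
and the final memory satisfy `R`. -/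
def Computes (mem : List ℝ) (p : Prog Empty α) (c : ℝ) (R : α → List ℝ → Prop) : Prop :=
  ∀ mem', mem <+: mem' → R (p.run (fun q => q.elim) mem').out (p.run (fun q => q.elim) mem').mem ∧
    ((p.run (fun q => q.elim) mem').steps : ℝ) ≤ c

lemma Computes.mono_mem {mem mem' : List ℝ} {p : Prog Empty α} {c : ℝ} {R : α → List ℝ → Prop}
    (h : Computes mem p c R) (hm : mem <+: mem') : Computes mem' p c R :=
  fun mem'' h' => h mem'' (hm.trans h')

lemma Computes.mono_cost {mem : List ℝ} {p : Prog Empty α} {c c' : ℝ} {R : α → List ℝ → Prop}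
    (h : Computes mem p c R) (hc : c ≤ c') : Computes mem p c' R :=
  fun mem'' h' => ⟨(h mem'' h').1, (h mem'' h').2.trans hc⟩

lemma computes_ret {mem : List ℝ} {a : α} {R : α → List ℝ → Prop}
    (h : ∀ mem', mem <+: mem' → R a mem') : Computes mem (.ret a) 0 R :=
  fun mem' hm => ⟨h mem' hm, by simp [Prog.run]⟩

lemma Computes.bind {mem : List ℝ} {p : Prog Empty α} {f : α → Prog Empty β} {c c' : ℝ}
    {R : α → List ℝ → Prop} {R' : β → List ℝ → Prop} (h : Computes mem p c R)
    (hf : ∀ a mem', mem <+: mem' → R a mem' → Computes mem' (f a) c' R') :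
    Computes mem (p.bind f) (c + c') R' := by
  intro mem' hm
  obtain ⟨h1, h2⟩ := h mem' hm
  obtain ⟨h3, h4⟩ := hf _ _ (hm.trans (Prog.prefix_run _ p mem')) h1 _ List.prefix_rfl
  rw [Prog.run_bind]
  refine ⟨h3, ?_⟩
  push_cast
  linarith

/-- `bind` followed by the return of a function of the result. -/
lemma Computes.bind_ret {mem : List ℝ} {p : Prog Empty α} {f : α → β} {c : ℝ}
    {R : α → List ℝ → Prop} {R' : β → List ℝ → Prop} (h : Computes mem p c R)
    (hf : ∀ a mem', mem <+: mem' → R a mem' → R' (f a) mem') :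
    Computes mem (p.bind fun a => .ret (f a)) c R' := by
  intro mem' hm
  obtain ⟨h1, h2⟩ := h mem' hm
  rw [Prog.run_bind]
  refine ⟨hf _ _ (hm.trans (Prog.prefix_run _ p mem')) h1, ?_⟩
  simpa [Prog.run] using h2

/-! ### Scalar expressions -/

/-- Evaluating two subexpressions, and then one binary instruction. -/
def Prog.binary (o : ℕ → ℕ → Op) (p q : Prog Empty ℕ) : Prog Empty ℕ :=
  p.bind fun i => q.bind fun j => .op (o i j) .ret

/-- Evaluating a subexpression, and then one unary instruction. -/
def Prog.unary (o : ℕ → Op) (p : Prog Empty ℕ) : Prog Empty ℕ := p.bind fun i => .op (o i) .ret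

/-! An arithmetic operation on programs evaluates both operands and then applies the instruction. -/

instance : Add (Prog Empty ℕ) := ⟨Prog.binary .add⟩
instance : Sub (Prog Empty ℕ) := ⟨Prog.binary .sub⟩
instance : Mul (Prog Empty ℕ) := ⟨Prog.binary .mul⟩
instance : Div (Prog Empty ℕ) := ⟨Prog.binary .div⟩

/-- The expression for a natural number. -/
def natE (k : ℕ) : Prog Empty ℕ := .op (.const k) .ret

/-- The expression that refers to a memory cell. -/
def cellE (a : ℕ) : Prog Empty ℕ := .ret a

/-- The expression `p` has the value `v` and takes at most `c` steps. -/
def Evals (mem : List ℝ) (p : Prog Empty ℕ) (c : ℝ) (v : ℝ) : Prop :=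
  Computes mem p c fun a m => At m a v

lemma Evals.mono_mem {mem mem' : List ℝ} {p : Prog Empty ℕ} {c v : ℝ} (h : Evals mem p c v)
    (hm : mem <+: mem') : Evals mem' p c v := Computes.mono_mem h hm

lemma evals_op {mem : List ℝ} {o : Op} {v : ℝ} (h : ∀ mem', mem <+: mem' → o.eval mem' = v) :
    Evals mem (.op o .ret) 1 v := by
  intro mem' hm
  simp only [Prog.run]
  rw [h mem' hm]
  exact ⟨at_append _ _ _, by simp⟩

lemma evals_binary {mem : List ℝ} {o : ℕ → ℕ → Op} {p q : Prog Empty ℕ} {c c' u v w : ℝ}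
    (hp : Evals mem p c u) (hq : Evals mem q c' v)
    (ho : ∀ i j m, At m i u → At m j v → (o i j).eval m = w) :
    Evals mem (Prog.binary o p q) (c + (c' + 1)) w := by
  refine Computes.bind hp fun i m1 h1 hi => Computes.bind (hq.mono_mem h1) fun j m2 h2 hj => ?_
  exact evals_op fun m3 h3 => ho i j m3 (hi.mono (h2.trans h3)) (hj.mono h3)

lemma evals_unary {mem : List ℝ} {o : ℕ → Op} {p : Prog Empty ℕ} {c u w : ℝ}
    (hp : Evals mem p c u) (ho : ∀ i m, At m i u → (o i).eval m = w) :
    Evals mem (Prog.unary o p) (c + 1) w :=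
  Computes.bind hp fun i _ _ hi => evals_op fun m3 h3 => ho i m3 (hi.mono h3)

variable {mem : List ℝ} {p q : Prog Empty ℕ} {c c' u v : ℝ}

lemma Evals.add (hp : Evals mem p c u) (hq : Evals mem q c' v) :
    Evals mem (p + q) (c + (c' + 1)) (u + v) :=
  evals_binary hp hq fun i j m hi hj => by rw [Op.eval, hi.cell, hj.cell]

lemma Evals.sub (hp : Evals mem p c u) (hq : Evals mem q c' v) :
    Evals mem (p - q) (c + (c' + 1)) (u - v) :=
  evals_binary hp hq fun i j m hi hj => by rw [Op.eval, hi.cell, hj.cell]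

lemma Evals.mul (hp : Evals mem p c u) (hq : Evals mem q c' v) :
    Evals mem (p * q) (c + (c' + 1)) (u * v) :=
  evals_binary hp hq fun i j m hi hj => by rw [Op.eval, hi.cell, hj.cell]

lemma Evals.div (hp : Evals mem p c u) (hq : Evals mem q c' v) :
    Evals mem (p / q) (c + (c' + 1)) (u / v) :=
  evals_binary hp hq fun i j m hi hj => by rw [Op.eval, hi.cell, hj.cell]

lemma Evals.sqrt (hp : Evals mem p c u) : Evals mem (Prog.unary .sqrt p) (c + 1) (√u) :=
  evals_unary hp fun i m hi => by rw [Op.eval, hi.cell]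

lemma Evals.log (hp : Evals mem p c u) : Evals mem (Prog.unary .log p) (c + 1) (Real.log u) :=
  evals_unary hp fun i m hi => by rw [Op.eval, hi.cell]

lemma evals_nat (k : ℕ) : Evals mem (natE k) 1 k := evals_op fun _ _ => rfl

lemma evals_cell {a : ℕ} (h : At mem a v) : Evals mem (cellE a) 0 v :=
  computes_ret fun _ hm => h.mono hm

lemma Evals.of_eq (hp : Evals mem p c u) (hc : c ≤ c') (hu : u = v) : Evals mem p c' v :=
  hu ▸ Computes.mono_cost hp hc

/-- The sum of `k` expressions. -/
def sumE : (k : ℕ) → (Fin k → Prog Empty ℕ) → Prog Empty ℕ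
  | 0, _ => natE 0
  | k + 1, f => sumE k (fun i => f i.castSucc) + f (Fin.last k)

lemma evals_sum (k : ℕ) {f : Fin k → Prog Empty ℕ} {v : Fin k → ℝ}
    (h : ∀ i, Evals mem (f i) c (v i)) : Evals mem (sumE k f) (k * (c + 1) + 1) (∑ i, v i) := by
  induction k with
  | zero => exact (evals_nat 0).of_eq (by simp) (by simp)
  | succ k ih =>
    rw [Fin.sum_univ_castSucc]
    refine ((ih fun i => h i.castSucc).add (h (Fin.last k))).of_eq ?_ rfl
    push_cast
    linarith

/-! ### Loops -/

/-- Running a family of programs over `Fin k`, collecting the results. -/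
def collectFin : (k : ℕ) → (Fin k → Prog Empty α) → Prog Empty (Fin k → α)
  | 0, _ => .ret Fin.elim0
  | k + 1, f => (collectFin k fun i => f i.castSucc).bind fun g =>
      (f (Fin.last k)).bind fun a => .ret (Fin.snoc (α := fun _ => α) g a)

lemma computes_collectFin (k : ℕ) {f : Fin k → Prog Empty α} {R : Fin k → α → List ℝ → Prop}
    (hR : ∀ i a m m', m <+: m' → R i a m → R i a m') (h : ∀ i, Computes mem (f i) c (R i)) :
    Computes mem (collectFin k f) (k * c) fun a m => ∀ i, R i (a i) m := by
  induction k with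
  | zero => exact (computes_ret fun _ _ i => i.elim0).mono_cost (by simp)
  | succ k ih =>
    refine Computes.mono_cost (c := k * c + c)
      (Computes.bind (ih (fun i => hR i.castSucc) fun i => h i.castSucc)
        fun g m1 h1 hg => Computes.bind_ret ((h (Fin.last k)).mono_mem h1)
        fun a m2 h2 ha i => ?_) (by push_cast; linarith)
    refine Fin.lastCases ?_ (fun i => ?_) i
    · simpa using ha
    · simpa using hR _ _ _ _ h2 (hg i)

variable {ι κ : Type} [Fintype ι] [Fintype κ]

/-- Running a family of programs over a finite type, collecting the results. -/
noncomputable def collect (f : ι → Prog Empty α) : Prog Empty (ι → α) :=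
  (collectFin (Fintype.card ι) fun i => f ((Fintype.equivFin ι).symm i)).bind fun g =>
    .ret fun i => g (Fintype.equivFin ι i)

lemma computes_collect {f : ι → Prog Empty α} {R : ι → α → List ℝ → Prop}
    (hR : ∀ i a m m', m <+: m' → R i a m → R i a m') (h : ∀ i, Computes mem (f i) c (R i)) :
    Computes mem (collect f) (Fintype.card ι * c) fun a m => ∀ i, R i (a i) m := by
  refine Computes.bind_ret (computes_collectFin _ (fun i => hR _) fun i => h _)
    fun a m _ ha i => ?_
  simpa using ha (Fintype.equivFin ι i)

lemma computes_vec {f : ι → Prog Empty ℕ} {v : ι → ℝ} (h : ∀ i, Evals mem (f i) c (v i)) :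
    Computes mem (collect f) (Fintype.card ι * c) fun a m => HoldsVec m a v :=
  computes_collect (R := fun i a m => At m a (v i)) (fun _ _ _ _ hm ha => At.mono ha hm) h

lemma computes_mat {f : ι → κ → Prog Empty ℕ} {M : Matrix ι κ ℝ}
    (h : ∀ i j, Evals mem (f i j) c (M i j)) :
    Computes mem (collect fun i => collect (f i)) (Fintype.card ι * (Fintype.card κ * c))
      fun a m => HoldsMat m a M :=
  computes_collect (R := fun i a m => HoldsVec m a (M i))
    (fun _ _ _ _ hm ha => HoldsVec.mono ha hm) fun i => computes_vec (h i)

/-! ### Tests -/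

/-- The comparison `p ≤ q` of two expressions. -/
def leE (p q : Prog Empty ℕ) : Prog Empty Bool :=
  p.bind fun i => q.bind fun j => .test i j .ret

lemma computes_le (hp : Evals mem p c u) (hq : Evals mem q c' v) :
    Computes mem (leE p q) (c + (c' + 1)) fun a _ => a = true ↔ u ≤ v := by
  refine Computes.bind hp fun i m1 h1 hi => Computes.bind (hq.mono_mem h1) fun j m2 h2 hj => ?_
  intro m3 h3
  simp only [Prog.run]
  rw [(hi.mono (h2.trans h3)).cell, (hj.mono h3).cell]
  simp

/-- Whether one of the tests `f 0, …, f (k - 1)` succeeds. -/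
def anyE : (k : ℕ) → (ℕ → Prog Empty Bool) → Prog Empty Bool
  | 0, _ => .ret false
  | k + 1, f => (anyE k f).bind fun a => (f k).bind fun b => .ret (a || b)

lemma computes_any {f : ℕ → Prog Empty Bool} {P : ℕ → Prop} (k : ℕ)
    (h : ∀ i < k, Computes mem (f i) c fun a _ => a = true ↔ P i) :
    Computes mem (anyE k f) (k * c) fun a _ => a = true ↔ ∃ i < k, P i := by
  induction k with
  | zero => exact (computes_ret fun _ _ => by simp).mono_cost (by simp)
  | succ k ih =>
    refine Computes.mono_cost (c := k * c + c)
      (Computes.bind (ih fun i hi => h i (by omega)) fun a m1 h1 ha =>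
        Computes.bind_ret ((h k (by omega)).mono_mem h1) fun b m2 _ hb => ?_)
      (by push_cast; linarith)
    rw [Bool.or_eq_true, ha, hb]
    simp only [Nat.lt_succ_iff_lt_or_eq, or_and_right, exists_or, exists_eq_left]

end Programs

/-! ### Fast matrix multiplication -/

open Matrix

/-- Programs that multiply `k × k` matrices in `C k ^ ω` steps. -/
structure FastMul (ω : ℝ) where
  /-- The constant of the step bound. -/
  C : ℝ
  one_le_C : 1 ≤ C
  /-- The programs. -/
  mul : ∀ k : ℕ, (Fin k → Fin k → ℕ) → (Fin k → Fin k → ℕ) → Prog Empty (Fin k → Fin k → ℕ)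
  spec : ∀ (k : ℕ) (mem : List ℝ) (a b : Fin k → Fin k → ℕ) (M N : Matrix (Fin k) (Fin k) ℝ),
    HoldsMat mem a M → HoldsMat mem b N →
    Computes mem (mul k a b) (C * (k : ℝ) ^ ω) fun c m => HoldsMat m c (M * N)

lemma IsMatMulExponent.nonempty_fastMul {ω : ℝ} (h : IsMatMulExponent ω) :
    Nonempty (FastMul ω) := by
  obtain ⟨C, hC⟩ := h
  choose mul hmul using hC
  refine ⟨⟨max C 1, le_max_right _ _, mul, fun k mem a b M N ha hb mem' hm => ?_⟩⟩
  obtain ⟨h1, h2⟩ := hmul k mem' a b M N (ha.mono hm) (hb.mono hm)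
  exact ⟨h1, h2.trans (mul_le_mul_of_nonneg_right (le_max_left _ _) (by positivity))⟩

namespace FastMul

variable {ω : ℝ} (F : FastMul ω) {mem : List ℝ}

/-- Multiplication of square matrices with an arbitrary index type. -/
noncomputable def mulSq {ι : Type} [Fintype ι] (a b : ι → ι → ℕ) : Prog Empty (ι → ι → ℕ) :=
  (F.mul (Fintype.card ι) (fun i j => a ((Fintype.equivFin ι).symm i) ((Fintype.equivFin ι).symm j))
    (fun i j => b ((Fintype.equivFin ι).symm i) ((Fintype.equivFin ι).symm j))).bind fun c =>
    .ret fun i j => c (Fintype.equivFin ι i) (Fintype.equivFin ι j)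

lemma computes_mulSq {ι : Type} [Fintype ι] {a b : ι → ι → ℕ} {M N : Matrix ι ι ℝ}
    (ha : HoldsMat mem a M) (hb : HoldsMat mem b N) :
    Computes mem (F.mulSq a b) (F.C * (Fintype.card ι : ℝ) ^ ω) fun c m => HoldsMat m c (M * N) := by
  refine Computes.bind_ret (F.spec _ mem _ _
    (M.submatrix (Fintype.equivFin ι).symm (Fintype.equivFin ι).symm)
    (N.submatrix (Fintype.equivFin ι).symm (Fintype.equivFin ι).symm)
    (fun i j => ha _ _) (fun i j => hb _ _)) fun c m _ hc i j => ?_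
  have := hc (Fintype.equivFin ι i) (Fintype.equivFin ι j)
  rw [submatrix_mul_equiv] at this
  simpa using this

/-! ### Rectangular multiplication by blocks -/

/-- The addresses of the `k × k` block in position `(I, J)`; beyond the borders of the matrix, the
address `z` (of a cell that holds `0`) is used. -/
def blockAddr {p q : ℕ} (z k : ℕ) (a : Fin p → Fin q → ℕ) (I J : ℕ) : Fin k → Fin k → ℕ :=
  fun i j => if h : I * k + i < p ∧ J * k + j < q then a ⟨I * k + i, h.1⟩ ⟨J * k + j, h.2⟩ else z

/-- The `k × k` block in position `(I, J)`, padded with zeros. -/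
def block {p q : ℕ} (k : ℕ) (M : Matrix (Fin p) (Fin q) ℝ) (I J : ℕ) : Matrix (Fin k) (Fin k) ℝ :=
  fun i j => if h : I * k + i < p ∧ J * k + j < q then M ⟨I * k + i, h.1⟩ ⟨J * k + j, h.2⟩ else 0

lemma holdsMat_block {p q : ℕ} {z : ℕ} (k : ℕ) {a : Fin p → Fin q → ℕ}
    {M : Matrix (Fin p) (Fin q) ℝ} (ha : HoldsMat mem a M) (hz : At mem z 0) (I J : ℕ) :
    HoldsMat mem (blockAddr z k a I J) (block k M I J) := by
  intro i j
  unfold blockAddr block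
  split_ifs with h
  · exact ha _ _
  · exact hz

/-- An entry of a product is computed in its block, as a sum of products of zero-padded blocks. -/
lemma mul_apply_eq_sum_block {p q s k : ℕ} (hk : 0 < k) (M : Matrix (Fin p) (Fin q) ℝ)
    (N : Matrix (Fin q) (Fin s) ℝ) (i : Fin p) (l : Fin s) :
    (M * N) i l = ∑ J : Fin (q / k + 1), (block k M (i / k) J * block k N J (l / k))
      ⟨i % k, Nat.mod_lt _ hk⟩ ⟨l % k, Nat.mod_lt _ hk⟩ := by
  set G : ℕ → ℝ := fun x => if h : x < q then M i ⟨x, h⟩ * N ⟨x, h⟩ l else 0 with hG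
  have h1 : ∀ (J : Fin (q / k + 1)) (j : Fin k),
      block k M (i / k) J ⟨i % k, Nat.mod_lt _ hk⟩ j * block k N J (l / k) j ⟨l % k, Nat.mod_lt _ hk⟩
        = G (j + k * J) := by
    intro J j
    have hi : (i : ℕ) / k * k + i % k = i := Nat.div_add_mod' _ _
    have hl : (l : ℕ) / k * k + l % k = l := Nat.div_add_mod' _ _
    have hj : (J : ℕ) * k + j = j + k * J := by ring
    simp only [block, hG, hi, hl, hj, i.2, l.2, true_and, and_true, Fin.eta]
    split_ifs <;> simp
  simp_rw [mul_apply, h1]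
  have hq : q ≤ (q / k + 1) * k := by
    have := Nat.div_add_mod' q k
    have := Nat.mod_lt q hk
    nlinarith
  calc ∑ j, M i j * N j l = ∑ x : Fin q, G x := by
        refine Finset.sum_congr rfl fun x _ => ?_
        simp [hG]
    _ = ∑ x ∈ Finset.range q, G x := Fin.sum_univ_eq_sum_range G q
    _ = ∑ x ∈ Finset.range ((q / k + 1) * k), G x := by
        refine Finset.sum_subset (by simpa using hq) fun x _ hx => ?_
        simp only [Finset.mem_range, not_lt] at hx
        simp [hG, hx]
    _ = ∑ x : Fin ((q / k + 1) * k), G x := (Fin.sum_univ_eq_sum_range G _).symm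
    _ = ∑ y : Fin (q / k + 1) × Fin k, G (y.2 + k * y.1) := by
        rw [← finProdFinEquiv.sum_comp]
        rfl
    _ = _ := Fintype.sum_prod_type _

/-- Multiplication of rectangular matrices, through products of `k × k` blocks. -/
noncomputable def mulBlocks {p q s : ℕ} (k : ℕ) (hk : 0 < k) (a : Fin p → Fin q → ℕ)
    (b : Fin q → Fin s → ℕ) : Prog Empty (Fin p → Fin s → ℕ) :=
  (natE 0).bind fun z =>
  (collect fun I : Fin (p / k + 1) => collect fun K : Fin (s / k + 1) =>
    (collect fun J : Fin (q / k + 1) =>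
      F.mul k (blockAddr z k a I J) (blockAddr z k b J K)).bind fun c =>
    collect fun i => collect fun j => sumE (q / k + 1) fun J => cellE (c J i j)).bind fun g =>
  .ret fun i l => g ⟨i / k, Nat.lt_succ_of_le (Nat.div_le_div_right i.2.le)⟩
    ⟨l / k, Nat.lt_succ_of_le (Nat.div_le_div_right l.2.le)⟩
    ⟨i % k, Nat.mod_lt _ hk⟩ ⟨l % k, Nat.mod_lt _ hk⟩

/-- Each of the block products costs `C k ^ ω`; the `k ^ 2` additions per block product are
dominated by it, because `ω ≥ 2`. -/
lemma computes_mulBlocks (hω : 2 ≤ ω) {p q s k : ℕ} (hk : 0 < k) {a : Fin p → Fin q → ℕ}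
    {b : Fin q → Fin s → ℕ} {M : Matrix (Fin p) (Fin q) ℝ} {N : Matrix (Fin q) (Fin s) ℝ}
    (ha : HoldsMat mem a M) (hb : HoldsMat mem b N) :
    Computes mem (F.mulBlocks k hk a b) ((F.C + 3) *
        (((p / k + 1 : ℕ) : ℝ) * ((q / k + 1 : ℕ) : ℝ) * ((s / k + 1 : ℕ) : ℝ) * (k : ℝ) ^ ω))
      fun c m => HoldsMat m c (M * N) := by
  set P := p / k + 1
  set S := s / k + 1
  set R := q / k + 1
  have h : Computes mem (F.mulBlocks k hk a b) (1 + (P : ℕ) * ((S : ℕ) * ((R : ℕ) *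
      (F.C * (k : ℝ) ^ ω) + k * (k * (R * (0 + 1) + 1))))) fun c m => HoldsMat m c (M * N) := by
    refine Computes.bind (evals_nat 0) fun z m1 h1 hz => ?_
    rw [Nat.cast_zero] at hz
    refine Computes.bind_ret (R := fun g m => ∀ (I : Fin P) (K : Fin S),
      HoldsMat m (g I K) (∑ J : Fin R, block k M I J * block k N J K)) ?_
      fun g m2 _ hg i l => ?_
    · have := computes_collect (mem := m1) (ι := Fin P)
        (f := fun I : Fin P => collect fun K : Fin S =>
          (collect fun J : Fin R => F.mul k (blockAddr z k a I J) (blockAddr z k b J K)).bind fun c =>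
          collect fun i => collect fun j => sumE R fun J => cellE (c J i j))
        (R := fun I g m => ∀ K : Fin S,
          HoldsMat m (g K) (∑ J : Fin R, block k M I J * block k N J K))
        (c := (S : ℕ) * ((R : ℕ) * (F.C * (k : ℝ) ^ ω) + k * (k * (R * (0 + 1) + 1))))
        (fun _ _ _ _ hm h K => (h K).mono hm) (fun I => ?_)
      · simpa using this
      have := computes_collect (mem := m1) (ι := Fin S)
        (f := fun K : Fin S =>
          (collect fun J : Fin R => F.mul k (blockAddr z k a I J) (blockAddr z k b J K)).bind fun c =>
          collect fun i => collect fun j => sumE R fun J => cellE (c J i j))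
        (R := fun K g m => HoldsMat m g (∑ J : Fin R, block k M I J * block k N J K))
        (c := (R : ℕ) * (F.C * (k : ℝ) ^ ω) + k * (k * (R * (0 + 1) + 1)))
        (fun _ _ _ _ hm h => h.mono hm) (fun K => ?_)
      · simpa using this
      refine Computes.bind (R := fun c m => ∀ J : Fin R,
        HoldsMat m (c J) (block k M I J * block k N J K)) ?_ fun c m3 h3 hc => ?_
      · have := computes_collect (mem := m1) (ι := Fin R)
          (f := fun J : Fin R => F.mul k (blockAddr z k a I J) (blockAddr z k b J K))
          (R := fun J c m => HoldsMat m c (block k M I J * block k N J K))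
          (c := F.C * (k : ℝ) ^ ω) (fun _ _ _ _ hm h => h.mono hm)
          (fun J => F.spec k m1 _ _ _ _ (holdsMat_block k (ha.mono h1) hz _ _)
            (holdsMat_block k (hb.mono h1) hz _ _))
        simpa using this
      · have := computes_mat (mem := m3) (ι := Fin k) (κ := Fin k)
          (f := fun i j => sumE R fun J => cellE (c J i j)) (c := R * (0 + 1) + 1)
          (M := ∑ J : Fin R, block k M I J * block k N J K)
          (fun i j => by
            rw [Matrix.sum_apply]
            exact evals_sum R fun J => evals_cell (hc J i j))
        simpa using this
    · have := hg ⟨i / k, Nat.lt_succ_of_le (Nat.div_le_div_right i.2.le)⟩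
        ⟨l / k, Nat.lt_succ_of_le (Nat.div_le_div_right l.2.le)⟩
        ⟨i % k, Nat.mod_lt _ hk⟩ ⟨l % k, Nat.mod_lt _ hk⟩
      rw [Matrix.sum_apply] at this
      rw [mul_apply_eq_sum_block hk]
      exact this
  refine h.mono_cost ?_
  have hk1 : (1 : ℝ) ≤ k := by exact_mod_cast hk
  have hkω : (k : ℝ) * k ≤ (k : ℝ) ^ ω := by
    rw [← sq, ← Real.rpow_two]
    exact Real.rpow_le_rpow_of_exponent_le hk1 hω
  have hP : (1 : ℝ) ≤ P := by exact_mod_cast Nat.succ_le_succ (Nat.zero_le _)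
  have hS : (1 : ℝ) ≤ S := by exact_mod_cast Nat.succ_le_succ (Nat.zero_le _)
  have hR : (1 : ℝ) ≤ R := by exact_mod_cast Nat.succ_le_succ (Nat.zero_le _)
  have hPS : (1 : ℝ) ≤ P * S := one_le_mul_of_one_le_of_one_le hP hS
  have hw : 1 ≤ (k : ℝ) ^ ω := le_trans (by nlinarith) hkω
  have hRw : 1 ≤ R * (k : ℝ) ^ ω := one_le_mul_of_one_le_of_one_le hR hw
  have h2 : (k : ℝ) * (k * (R * (0 + 1) + 1)) ≤ 2 * (R * (k : ℝ) ^ ω) := by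
    calc (k : ℝ) * (k * (R * (0 + 1) + 1)) = (k * k) * (R + 1) := by ring
      _ ≤ (k : ℝ) ^ ω * (2 * R) := mul_le_mul hkω (by linarith) (by linarith) (by linarith)
      _ = _ := by ring
  calc 1 + (P : ℝ) * (S * (R * (F.C * (k : ℝ) ^ ω) + k * (k * (R * (0 + 1) + 1))))
      ≤ P * S * (R * (k : ℝ) ^ ω) + P * (S * (R * (F.C * (k : ℝ) ^ ω) + 2 * (R * (k : ℝ) ^ ω))) := by
        gcongr
        exact one_le_mul_of_one_le_of_one_le hPS hRw
    _ = _ := by ring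

/-- Multiplication of rectangular matrices with arbitrary index types. -/
noncomputable def mulRect {ι κ τ : Type} [Fintype ι] [Fintype κ] [Fintype τ] (k : ℕ) (hk : 0 < k)
    (a : ι → κ → ℕ) (b : κ → τ → ℕ) : Prog Empty (ι → τ → ℕ) :=
  (F.mulBlocks k hk (fun i j => a ((Fintype.equivFin ι).symm i) ((Fintype.equivFin κ).symm j))
    (fun i j => b ((Fintype.equivFin κ).symm i) ((Fintype.equivFin τ).symm j))).bind fun c =>
    .ret fun i j => c (Fintype.equivFin ι i) (Fintype.equivFin τ j)

lemma div_add_one_le {p k : ℕ} (hk : 0 < k) (h : k ≤ p) :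
    ((p / k + 1 : ℕ) : ℝ) ≤ 2 * p / k := by
  have hk' : (0 : ℝ) < k := by exact_mod_cast hk
  rw [le_div_iff₀ hk']
  have h1 : (p / k + 1) * k ≤ 2 * p := by
    have := Nat.div_mul_le_self p k
    nlinarith
  exact_mod_cast h1

/-- With blocks no larger than any of the three dimensions, rounding up the numbers of blocks costs
only the factor `8`. -/
lemma computes_mulRect (hω : 2 ≤ ω) {ι κ τ : Type} [Fintype ι] [Fintype κ] [Fintype τ] {k : ℕ}
    (hk : 0 < k) (hι : k ≤ Fintype.card ι) (hκ : k ≤ Fintype.card κ) (hτ : k ≤ Fintype.card τ)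
    {a : ι → κ → ℕ} {b : κ → τ → ℕ} {M : Matrix ι κ ℝ} {N : Matrix κ τ ℝ}
    (ha : HoldsMat mem a M) (hb : HoldsMat mem b N) :
    Computes mem (F.mulRect k hk a b) (8 * (F.C + 3) *
        ((Fintype.card ι : ℝ) * Fintype.card κ * Fintype.card τ * (k : ℝ) ^ (ω - 3)))
      fun c m => HoldsMat m c (M * N) := by
  have h := F.computes_mulBlocks hω hk (mem := mem)
    (M := M.submatrix (Fintype.equivFin ι).symm (Fintype.equivFin κ).symm)
    (N := N.submatrix (Fintype.equivFin κ).symm (Fintype.equivFin τ).symm)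
    (a := fun i j => a ((Fintype.equivFin ι).symm i) ((Fintype.equivFin κ).symm j))
    (b := fun i j => b ((Fintype.equivFin κ).symm i) ((Fintype.equivFin τ).symm j))
    (fun i j => ha _ _) (fun i j => hb _ _)
  refine (Computes.bind_ret h fun c m _ hc i j => ?_).mono_cost ?_
  · have := hc (Fintype.equivFin ι i) (Fintype.equivFin τ j)
    rw [submatrix_mul_equiv] at this
    simpa using this
  · have hk' : (0 : ℝ) < k := by exact_mod_cast hk
    have hC := F.one_le_C
    have e : (k : ℝ) ^ ω = (k : ℝ) ^ (ω - 3) * (k * k * k) := by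
      rw [Real.rpow_sub hk', show (3 : ℝ) = ((3 : ℕ) : ℝ) by norm_num, Real.rpow_natCast]
      field_simp
    calc (F.C + 3) * (((Fintype.card ι / k + 1 : ℕ) : ℝ) * ((Fintype.card κ / k + 1 : ℕ) : ℝ) *
          ((Fintype.card τ / k + 1 : ℕ) : ℝ) * (k : ℝ) ^ ω)
        ≤ (F.C + 3) * ((2 * Fintype.card ι / k) * (2 * Fintype.card κ / k) *
          (2 * Fintype.card τ / k) * (k : ℝ) ^ ω) := by
          have := div_add_one_le hk hι
          have := div_add_one_le hk hκ
          have := div_add_one_le hk hτ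
          gcongr
      _ = _ := by rw [e]; field_simp; ring

end FastMul

/-! ### Matrix inversion from multiplication -/

/-- The index type of the recursive block structure: two copies of itself, `j` times. -/
def BlockIndex : ℕ → Type
  | 0 => Unit
  | j + 1 => BlockIndex j ⊕ BlockIndex j

instance BlockIndex.fintype : (j : ℕ) → Fintype (BlockIndex j)
  | 0 => inferInstanceAs (Fintype Unit)
  | j + 1 => @instFintypeSum _ _ (BlockIndex.fintype j) (BlockIndex.fintype j)

instance BlockIndex.decidableEq : (j : ℕ) → DecidableEq (BlockIndex j)
  | 0 => inferInstanceAs (DecidableEq Unit)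
  | j + 1 => @instDecidableEqSum _ _ (BlockIndex.decidableEq j) (BlockIndex.decidableEq j)

instance : Unique (BlockIndex 0) := inferInstanceAs (Unique Unit)

lemma BlockIndex.card (j : ℕ) : Fintype.card (BlockIndex j) = 2 ^ j := by
  induction j with
  | zero => rfl
  | succ j ih =>
    have : Fintype.card (BlockIndex (j + 1)) = Fintype.card (BlockIndex j ⊕ BlockIndex j) := rfl
    rw [this, Fintype.card_sum, ih]
    ring

section Schur

variable {ι : Type} [Fintype ι] [DecidableEq ι]

/-- The Schur complement of a positive definite block matrix is positive definite: its quadratic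
form is that of the block matrix on the vectors `(-E⁻¹ B x, x)`. -/
lemma schur_posDef {E B D : Matrix ι ι ℝ} (h : (fromBlocks E B Bᵀ D).PosDef) :
    E.PosDef ∧ (D - Bᵀ * (E⁻¹ * B)).PosDef := by
  have hE : E.PosDef := by
    have := h.submatrix (e := Sum.inl) Sum.inl_injective
    convert this using 1
    ext i j
    rfl
  refine ⟨hE, ?_⟩
  have hEu : IsUnit E.det := (isUnit_iff_isUnit_det _).1 hE.isUnit
  have hinj : Function.Injective (fromRows (-(E⁻¹ * B)) (1 : Matrix ι ι ℝ)).mulVec := by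
    intro x y hxy
    simp only [fromRows_mulVec, one_mulVec] at hxy
    ext i
    exact congrFun hxy (Sum.inr i)
  have h2 := h.conjTranspose_mul_mul_same hinj
  have hEt : (E⁻¹)ᵀ = E⁻¹ := by
    rw [transpose_nonsing_inv]
    congr 1
    simpa [conjTranspose_eq_transpose_of_trivial] using hE.1.eq
  convert h2 using 1
  rw [conjTranspose_eq_transpose_of_trivial, transpose_fromRows, fromCols_mul_fromBlocks,
    fromCols_mul_fromRows]
  simp only [transpose_neg, transpose_mul, transpose_one, Matrix.mul_one, Matrix.one_mul,
    Matrix.mul_neg, hEt]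
  rw [Matrix.neg_mul, Matrix.neg_mul, Matrix.mul_assoc Bᵀ E⁻¹ E, nonsing_inv_mul _ hEu,
    Matrix.mul_one, Matrix.mul_assoc]
  simp [sub_eq_neg_add]

/-- The inverse of a positive definite block matrix through the Schur complement. -/
lemma inv_fromBlocks_of_posDef {E B D : Matrix ι ι ℝ} (h : (fromBlocks E B Bᵀ D).PosDef) :
    (fromBlocks E B Bᵀ D)⁻¹ =
      fromBlocks (E⁻¹ + E⁻¹ * B * (D - Bᵀ * (E⁻¹ * B))⁻¹ * (E⁻¹ * B)ᵀ)
        (0 - E⁻¹ * B * (D - Bᵀ * (E⁻¹ * B))⁻¹) (0 - E⁻¹ * B * (D - Bᵀ * (E⁻¹ * B))⁻¹)ᵀ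
        (D - Bᵀ * (E⁻¹ * B))⁻¹ := by
  obtain ⟨hE, hS⟩ := schur_posDef h
  set Z := E⁻¹ * B with hZ
  set S := D - Bᵀ * Z with hSdef
  have hEu : IsUnit E.det := (isUnit_iff_isUnit_det _).1 hE.isUnit
  have hSu : IsUnit S.det := (isUnit_iff_isUnit_det _).1 hS.isUnit
  have hSt : (S⁻¹)ᵀ = S⁻¹ := by
    rw [transpose_nonsing_inv]
    congr 1
    simpa [conjTranspose_eq_transpose_of_trivial] using hS.1.eq
  have hEt : (E⁻¹)ᵀ = E⁻¹ := by
    rw [transpose_nonsing_inv]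
    congr 1
    simpa [conjTranspose_eq_transpose_of_trivial] using hE.1.eq
  have hEZ : E * Z = B := by rw [hZ, ← Matrix.mul_assoc, mul_nonsing_inv _ hEu, Matrix.one_mul]
  have hZt : Zᵀ = Bᵀ * E⁻¹ := by rw [hZ, transpose_mul, hEt]
  have hSS : S * S⁻¹ = 1 := mul_nonsing_inv _ hSu
  have hD : D = S + Bᵀ * Z := by rw [hSdef]; abel
  apply inv_eq_right_inv
  rw [fromBlocks_multiply, ← fromBlocks_one]
  simp only [zero_sub, transpose_neg, transpose_mul, hSt]
  congr 1
  · simp only [Matrix.mul_add, mul_nonsing_inv _ hEu, ← Matrix.mul_assoc, hEZ, Matrix.mul_neg]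
    abel
  · simp only [Matrix.mul_neg, ← Matrix.mul_assoc, hEZ]
    abel
  · rw [hD]
    simp only [Matrix.mul_add, Matrix.add_mul, Matrix.mul_neg, ← Matrix.mul_assoc, hSS,
      Matrix.one_mul]
    rw [hZt]
    abel
  · rw [hD]
    simp only [Matrix.mul_neg, Matrix.add_mul, ← Matrix.mul_assoc, hSS]
    abel

end Schur

namespace FastMul

variable {ω : ℝ} (F : FastMul ω) {mem : List ℝ}

/-- The entries of a block matrix. -/
def blockEntries {ι : Type} (a b c d : ι → ι → ℕ) : ι ⊕ ι → ι ⊕ ι → ℕ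
  | .inl i, .inl j => a i j
  | .inl i, .inr j => b i j
  | .inr i, .inl j => c i j
  | .inr i, .inr j => d i j

lemma holdsMat_blockEntries {ι : Type} {a b c d : ι → ι → ℕ} {M₁ M₂ M₃ M₄ : Matrix ι ι ℝ}
    (ha : HoldsMat mem a M₁) (hb : HoldsMat mem b M₂) (hc : HoldsMat mem c M₃)
    (hd : HoldsMat mem d M₄) :
    HoldsMat mem (blockEntries a b c d) (fromBlocks M₁ M₂ M₃ M₄) := by
  rintro (i | i) (j | j)
  exacts [ha i j, hb i j, hc i j, hd i j]

/-- Recursive inversion of a positive definite matrix through the Schur complement. -/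
noncomputable def invPosDef : (j : ℕ) → (BlockIndex j → BlockIndex j → ℕ) →
    Prog Empty (BlockIndex j → BlockIndex j → ℕ)
  | 0, a => collect fun i => collect fun k => natE 1 / cellE (a i k)
  | j + 1, a =>
    (invPosDef j fun i k => a (.inl i) (.inl k)).bind fun e =>
    (F.mulSq e fun i k => a (.inl i) (.inr k)).bind fun z =>
    (F.mulSq (fun i k => a (.inr i) (.inl k)) z).bind fun w =>
    (collect fun i => collect fun k => cellE (a (.inr i) (.inr k)) - cellE (w i k)).bind fun s =>
    (invPosDef j s).bind fun t =>
    (F.mulSq z t).bind fun y =>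
    (F.mulSq y fun i k => z k i).bind fun v =>
    (collect fun i => collect fun k => cellE (e i k) + cellE (v i k)).bind fun u =>
    (collect fun i => collect fun k => natE 0 - cellE (y i k)).bind fun x =>
    .ret (blockEntries u x (fun i k => x k i) t)

/-- The recursion makes two calls and four multiplications on half the size; since `2 ^ ω ≥ 4`, the
costs of its levels decrease geometrically. -/
lemma computes_invPosDef (hω : 2 ≤ ω) (j : ℕ) :
    ∀ (mem : List ℝ) (a : BlockIndex j → BlockIndex j → ℕ)
      (M : Matrix (BlockIndex j) (BlockIndex j) ℝ), M.PosDef → HoldsMat mem a M →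
      Computes mem (F.invPosDef j a) ((2 * F.C + 3) * ((2 : ℝ) ^ j) ^ ω)
        fun c m => HoldsMat m c M⁻¹ := by
  have hC := F.one_le_C
  induction j with
  | zero =>
    intro mem a M hM ha
    have h := computes_mat (mem := mem) (ι := BlockIndex 0) (κ := BlockIndex 0)
      (f := fun i k => natE 1 / cellE (a i k)) (M := M⁻¹) (c := 1 + (0 + 1)) fun i k => by
        refine ((evals_nat 1).div (evals_cell (ha i k))).of_eq le_rfl ?_
        obtain rfl : i = default := Subsingleton.elim _ _
        obtain rfl : k = default := Subsingleton.elim _ _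
        rw [inv_def, adjugate_subsingleton, det_unique]
        simp
    refine h.mono_cost ?_
    rw [BlockIndex.card]
    norm_num
    linarith
  | succ j ih =>
    intro mem a M hM ha
    have hcard : (Fintype.card (BlockIndex j) : ℝ) = (2 : ℝ) ^ j := by rw [BlockIndex.card]; simp
    let M' : Matrix (BlockIndex j ⊕ BlockIndex j) (BlockIndex j ⊕ BlockIndex j) ℝ := M
    have hM' : M'.PosDef := hM
    set E := M'.toBlocks₁₁ with hE
    set B := M'.toBlocks₁₂ with hB
    set D := M'.toBlocks₂₂ with hD
    have hBt : M'.toBlocks₂₁ = Bᵀ := by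
      ext i k
      have := congrFun (congrFun hM'.1.eq (Sum.inr i)) (Sum.inl k)
      simpa [toBlocks₂₁, toBlocks₁₂, hB] using this.symm
    have hblk : M' = fromBlocks E B Bᵀ D := by
      rw [← hBt]; exact (fromBlocks_toBlocks M').symm
    have hpd : (fromBlocks E B Bᵀ D).PosDef := hblk ▸ hM'
    obtain ⟨hEp, hSp⟩ := schur_posDef hpd
    have ha11 : HoldsMat mem (fun i k => a (.inl i) (.inl k)) E := fun i k => ha _ _
    have ha12 : HoldsMat mem (fun i k => a (.inl i) (.inr k)) B := fun i k => ha _ _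
    have ha21 : HoldsMat mem (fun i k => a (.inr i) (.inl k)) Bᵀ := by
      rw [← hBt]; exact fun i k => ha _ _
    have ha22 : HoldsMat mem (fun i k => a (.inr i) (.inr k)) D := fun i k => ha _ _
    set μ := ((2 : ℝ) ^ j) ^ ω with hμ
    have key : Computes mem (F.invPosDef (j + 1) a)
        ((2 * F.C + 3) * μ + (F.C * μ + (F.C * μ + (2 ^ j * (2 ^ j * (0 + (0 + 1))) +
          ((2 * F.C + 3) * μ + (F.C * μ + (F.C * μ + (2 ^ j * (2 ^ j * (0 + (0 + 1))) +
          2 ^ j * (2 ^ j * (1 + (0 + 1))))))))))) fun c m => HoldsMat m c M⁻¹ := by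
      refine Computes.bind (ih mem _ E hEp ha11) fun e m1 h1 he => ?_
      refine Computes.bind (R := fun c m => HoldsMat m c (E⁻¹ * B))
        (hμ ▸ hcard ▸ F.computes_mulSq he (ha12.mono h1)) fun z m2 h2 hz => ?_
      have h02 := h1.trans h2
      refine Computes.bind (R := fun c m => HoldsMat m c (Bᵀ * (E⁻¹ * B)))
        (hμ ▸ hcard ▸ F.computes_mulSq (ha21.mono h02) hz) fun w m3 h3 hw => ?_
      have h03 := h02.trans h3
      refine Computes.bind (R := fun c m => HoldsMat m c (D - Bᵀ * (E⁻¹ * B)))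
        (hcard ▸ computes_mat fun i k => (evals_cell ((ha22.mono h03) i k)).sub (evals_cell (hw i k)))
        fun s m4 h4 hs => ?_
      refine Computes.bind (ih m4 s _ hSp hs) fun t m5 h5 ht => ?_
      have h25 := h3.trans (h4.trans h5)
      refine Computes.bind (R := fun c m => HoldsMat m c (E⁻¹ * B * (D - Bᵀ * (E⁻¹ * B))⁻¹))
        (hμ ▸ hcard ▸ F.computes_mulSq (hz.mono h25) ht) fun y m6 h6 hy => ?_
      refine Computes.bind
        (R := fun c m => HoldsMat m c (E⁻¹ * B * (D - Bᵀ * (E⁻¹ * B))⁻¹ * (E⁻¹ * B)ᵀ))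
        (hμ ▸ hcard ▸ F.computes_mulSq hy
          (fun i k => (hz.mono (h25.trans h6)) k i)) fun v m7 h7 hv => ?_
      refine Computes.bind
        (R := fun c m => HoldsMat m c (E⁻¹ + E⁻¹ * B * (D - Bᵀ * (E⁻¹ * B))⁻¹ * (E⁻¹ * B)ᵀ))
        (hcard ▸ computes_mat fun i k =>
          (evals_cell ((he.mono (h2.trans (h25.trans (h6.trans h7)))) i k)).add
            (evals_cell (hv i k))) fun u m8 h8 hu => ?_
      refine Computes.bind_ret
        (R := fun c m => HoldsMat m c (0 - E⁻¹ * B * (D - Bᵀ * (E⁻¹ * B))⁻¹))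
        (hcard ▸ computes_mat fun i k => ((evals_nat 0).sub
          (evals_cell ((hy.mono (h7.trans h8)) i k))).of_eq le_rfl (by simp))
        fun x m9 h9 hx => ?_
      have hinv : M'⁻¹ = _ := (congrArg (·⁻¹) hblk).trans (inv_fromBlocks_of_posDef hpd)
      change HoldsMat m9 _ M'⁻¹
      rw [hinv]
      exact holdsMat_blockEntries (hu.mono h9) hx (fun i k => hx k i)
        (ht.mono (h6.trans (h7.trans (h8.trans h9))))
    refine key.mono_cost ?_
    have h2j : (1 : ℝ) ≤ 2 ^ j := one_le_pow₀ (by norm_num)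
    have hμ2 : (2 : ℝ) ^ j * 2 ^ j ≤ μ := by
      rw [← sq, ← Real.rpow_two]
      exact Real.rpow_le_rpow_of_exponent_le h2j hω
    have h4 : (4 : ℝ) ≤ 2 ^ ω := by
      calc (4 : ℝ) = 2 ^ (2 : ℝ) := by norm_num
        _ ≤ _ := Real.rpow_le_rpow_of_exponent_le (by norm_num) hω
    have hμs : ((2 : ℝ) ^ (j + 1)) ^ ω = 2 ^ ω * μ := by
      rw [pow_succ, Real.mul_rpow (by positivity) (by norm_num), mul_comm]
    rw [hμs]
    have hμ0 : 0 ≤ μ := by positivity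
    calc _ = (8 * F.C + 6) * μ + 4 * (2 ^ j * 2 ^ j) := by ring
      _ ≤ (8 * F.C + 6) * μ + 4 * μ := by gcongr
      _ ≤ (2 * F.C + 3) * (4 * μ) := by nlinarith
      _ ≤ _ := by gcongr

/-! ### Inversion of an arbitrary nonsingular matrix -/

/-- The logarithm of the power of two to which the size of a matrix is padded. -/
noncomputable def padLog (ι : Type) [Fintype ι] : ℕ := Nat.clog 2 (Fintype.card ι)

/-- The indices of the padded matrix: those of the given one, and those of an identity block. -/
noncomputable def padEquiv (ι : Type) [Fintype ι] :
    BlockIndex (padLog ι) ≃ ι ⊕ Fin (2 ^ padLog ι - Fintype.card ι) :=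
  Fintype.equivOfCardEq (by
    rw [BlockIndex.card, Fintype.card_sum, Fintype.card_fin,
      Nat.add_sub_cancel' (show Fintype.card ι ≤ 2 ^ padLog ι from Nat.le_pow_clog one_lt_two _)])

/-- The addresses of the entries of the padded matrix. -/
def padAddr {ι κ : Type} [DecidableEq κ] (z o : ℕ) (a : ι → ι → ℕ) : ι ⊕ κ → ι ⊕ κ → ℕ
  | .inl i, .inl j => a i j
  | .inr i, .inr j => if i = j then o else z
  | _, _ => z

lemma holdsMat_padAddr {ι κ : Type} [DecidableEq κ] {z o : ℕ} {a : ι → ι → ℕ} {M : Matrix ι ι ℝ}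
    (ha : HoldsMat mem a M) (hz : At mem z 0) (ho : At mem o 1) :
    HoldsMat mem (padAddr (κ := κ) z o a) (fromBlocks M 0 0 1) := by
  rintro (i | i) (j | j)
  · exact ha i j
  · exact hz
  · exact hz
  · simp only [padAddr, fromBlocks_apply₂₂, one_apply]
    split_ifs
    · exact ho
    · exact hz

/-- Inversion of a nonsingular matrix `B`, padded by an identity block, as `(Bᵀ B)⁻¹ Bᵀ`. The detour
via `Bᵀ B` makes the recursive inversion applicable, which needs nonsingular leading blocks. -/
noncomputable def inv {ι : Type} [Fintype ι] (a : ι → ι → ℕ) :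
    Prog Empty (ι → ι → ℕ) :=
  (natE 0).bind fun z => (natE 1).bind fun o =>
  (F.mulSq (fun i k => padAddr z o a (padEquiv ι k) (padEquiv ι i))
    (fun i k => padAddr z o a (padEquiv ι i) (padEquiv ι k))).bind fun c =>
  (F.invPosDef (padLog ι) c).bind fun d =>
  (F.mulSq d (fun i k => padAddr z o a (padEquiv ι k) (padEquiv ι i))).bind fun e =>
  .ret fun i k => e ((padEquiv ι).symm (.inl i)) ((padEquiv ι).symm (.inl k))

lemma computes_inv (hω : 2 ≤ ω) (hω' : ω ≤ 5 / 2) {ι : Type} [Fintype ι] [DecidableEq ι]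
    (hι : 0 < Fintype.card ι) {a : ι → ι → ℕ} {M : Matrix ι ι ℝ} (hM : IsUnit M)
    (ha : HoldsMat mem a M) :
    Computes mem (F.inv a) ((32 * F.C + 26) * (Fintype.card ι : ℝ) ^ ω)
      fun c m => HoldsMat m c M⁻¹ := by
  have hC := F.one_le_C
  set e := padEquiv ι
  set P : Matrix _ _ ℝ :=
    (fromBlocks M 0 0 (1 : Matrix (Fin (2 ^ padLog ι - Fintype.card ι)) _ ℝ)).submatrix e e
    with hP
  have hMu : IsUnit M.det := (isUnit_iff_isUnit_det _).1 hM
  have hPinv : P⁻¹ = (fromBlocks M⁻¹ 0 0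
      (1 : Matrix (Fin (2 ^ padLog ι - Fintype.card ι)) _ ℝ)).submatrix e e := by
    rw [hP, inv_submatrix_equiv]
    congr 1
    apply inv_eq_right_inv
    rw [fromBlocks_multiply, ← fromBlocks_one]
    simp [mul_nonsing_inv _ hMu]
  have hPu : IsUnit P.det := by
    rw [hP, det_submatrix_equiv_self, det_fromBlocks_zero₂₁, det_one, mul_one]
    exact hMu
  have hPP : (Pᵀ * P).PosDef := by
    rw [← conjTranspose_eq_transpose_of_trivial]
    exact PosDef.conjTranspose_mul_self P
      (mulVec_injective_iff_isUnit.2 ((isUnit_iff_isUnit_det _).2 hPu))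
  have hfin : (Pᵀ * P)⁻¹ * Pᵀ = P⁻¹ := by
    rw [Matrix.mul_inv_rev, Matrix.mul_assoc, nonsing_inv_mul _ (by rwa [det_transpose]),
      Matrix.mul_one]
  set μ := ((2 : ℝ) ^ padLog ι) ^ ω with hμ
  have hcard : (Fintype.card (BlockIndex (padLog ι)) : ℝ) = (2 : ℝ) ^ padLog ι := by
    rw [BlockIndex.card]; simp
  have key : Computes mem (F.inv a)
      (1 + (1 + (F.C * μ + ((2 * F.C + 3) * μ + F.C * μ)))) fun c m => HoldsMat m c M⁻¹ := by
    refine Computes.bind (evals_nat 0) fun z m1 h1 hz => ?_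
    refine Computes.bind (evals_nat 1) fun o m2 h2 ho => ?_
    rw [Nat.cast_zero] at hz
    rw [Nat.cast_one] at ho
    have hpad : HoldsMat m2 (fun i k => padAddr z o a (e i) (e k)) P := fun i k =>
      holdsMat_padAddr (ha.mono (h1.trans h2)) (hz.mono h2) ho (e i) (e k)
    have hpadt : HoldsMat m2 (fun i k => padAddr z o a (e k) (e i)) Pᵀ := fun i k => hpad k i
    refine Computes.bind (R := fun c m => HoldsMat m c (Pᵀ * P))
      (hμ ▸ hcard ▸ F.computes_mulSq hpadt hpad) fun c m3 h3 hc => ?_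
    refine Computes.bind (F.computes_invPosDef hω _ m3 c _ hPP hc) fun d m4 h4 hd => ?_
    refine Computes.bind_ret (R := fun c m => HoldsMat m c P⁻¹)
      (hμ ▸ hcard ▸ hfin ▸ F.computes_mulSq hd (hpadt.mono (h3.trans h4))) fun b m5 h5 hb => ?_
    intro i k
    have := hb (e.symm (.inl i)) (e.symm (.inl k))
    rw [hPinv] at this
    simpa using this
  refine key.mono_cost ?_
  set r := Fintype.card ι with hr
  have hr1 : (1 : ℝ) ≤ r := by exact_mod_cast hι
  have hpow : (2 : ℝ) ^ padLog ι ≤ 2 * r := by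
    rcases Nat.eq_or_lt_of_le hι with h1 | h1
    · have : padLog ι = 0 := by rw [padLog, ← hr, ← h1]; simp
      rw [this, ← h1]; norm_num
    · have h2 : 2 ^ (padLog ι - 1) < r := Nat.pow_pred_clog_lt_self one_lt_two h1
      have h3 : 0 < padLog ι := Nat.clog_pos one_lt_two h1
      have h4 : 2 ^ padLog ι ≤ 2 * r := by
        rw [← Nat.succ_pred_eq_of_pos h3, pow_succ]
        have : (padLog ι).pred = padLog ι - 1 := rfl
        rw [this]; omega
      exact_mod_cast h4
  have h8 : (2 : ℝ) ^ ω ≤ 8 := by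
    calc (2 : ℝ) ^ ω ≤ 2 ^ (3 : ℝ) := Real.rpow_le_rpow_of_exponent_le (by norm_num) (by linarith)
      _ = 8 := by norm_num
  have hrω : 1 ≤ (r : ℝ) ^ ω := Real.one_le_rpow hr1 (by linarith)
  have hμr : μ ≤ 8 * (r : ℝ) ^ ω := by
    calc μ ≤ (2 * r : ℝ) ^ ω := Real.rpow_le_rpow (by positivity) hpow (by linarith)
      _ = 2 ^ ω * (r : ℝ) ^ ω := Real.mul_rpow (by norm_num) (by positivity)
      _ ≤ _ := by gcongr
  calc _ = 2 + (4 * F.C + 3) * μ := by ring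
    _ ≤ 2 * (r : ℝ) ^ ω + (4 * F.C + 3) * (8 * (r : ℝ) ^ ω) := by gcongr; linarith
    _ = _ := by ring

end FastMul

/-! ### Maintaining the inverse of the Gram matrix -/

section Woodbury

variable {n m : ℕ}

/-- The change of the Gram matrix when the coordinates in `S` are refreshed. -/
lemma gram_eq_add {A : Matrix (Fin m) (Fin n) ℝ} {u u' : EuclideanSpace ℝ (Fin n)}
    {S : Finset (Fin n)} (h : ∀ i ∉ S, u' i = u i) :
    gram A u' = gram A u + (A.submatrix id (Subtype.val : S → Fin n)) *
      (diagonal (fun i : S => u' i ^ 2 - u i ^ 2) * (A.submatrix id (Subtype.val : S → Fin n))ᵀ) := by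
  ext i j
  have hg : ∀ w : EuclideanSpace ℝ (Fin n), gram A w i j = ∑ k, A i k * w k ^ 2 * A j k := by
    intro w
    rw [gram, mul_apply]
    simp [mul_diagonal]
  rw [Matrix.add_apply, hg, hg, ← Matrix.mul_assoc, mul_apply]
  simp only [mul_diagonal, submatrix_apply, id, transpose_apply]
  rw [Finset.sum_coe_sort S (fun k => A i k * (u' k ^ 2 - u k ^ 2) * A j k), ← sub_eq_iff_eq_add',
    ← Finset.sum_sub_distrib]
  rw [← Finset.sum_subset (Finset.subset_univ S)]
  · exact Finset.sum_congr rfl fun k _ => by ring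
  · intro k _ hk
    rw [h k hk]; ring

/-- The binomial inverse theorem for the Gram matrix. The small matrix `1 + D Uᵀ W` is nonsingular,
since its determinant is the quotient of those of the two Gram matrices. -/
lemma inv_gram_update {A : Matrix (Fin m) (Fin n) ℝ} (hA : A.rank = m)
    {u u' : EuclideanSpace ℝ (Fin n)} (hu : ∀ i, 0 < u i) (hu' : ∀ i, 0 < u' i)
    {S : Finset (Fin n)} (h : ∀ i ∉ S, u' i = u i) {U W : Matrix (Fin m) S ℝ}
    {D : Matrix S S ℝ} (hU : U = A.submatrix id Subtype.val) (hW : W = (gram A u)⁻¹ * U)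
    (hD : D = diagonal (fun i : S => u' i ^ 2 - u i ^ 2)) :
    IsUnit (1 + D * (Uᵀ * W)) ∧
      (gram A u')⁻¹ = (gram A u)⁻¹ - W * ((1 + D * (Uᵀ * W))⁻¹ * (D * Wᵀ)) := by
  have hG := (gram_posDef hA hu)
  have hGu := hG.isUnit
  have hGd : IsUnit (gram A u).det := (isUnit_iff_isUnit_det _).1 hGu
  have hGt : (gram A u)⁻¹ᵀ = (gram A u)⁻¹ := by
    rw [transpose_nonsing_inv]
    congr 1
    simpa [conjTranspose_eq_transpose_of_trivial] using hG.1.eq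
  have hadd : gram A u' = gram A u + U * (1 : Matrix S S ℝ) * (D * Uᵀ) := by
    rw [Matrix.mul_one, hU, hD]; exact gram_eq_add h
  have hB : IsUnit (1 + D * (Uᵀ * W)) := by
    rw [isUnit_iff_isUnit_det]
    have h1 : (1 + D * (Uᵀ * W)).det = ((gram A u)⁻¹ * gram A u').det := by
      rw [hadd, Matrix.mul_add, nonsing_inv_mul _ hGd, Matrix.mul_one,
        ← Matrix.mul_assoc (gram A u)⁻¹, ← hW, ← Matrix.mul_assoc D, det_one_add_mul_comm]
    rw [h1, det_mul]
    exact (isUnit_nonsing_inv_det _ hGd).mul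
      ((isUnit_iff_isUnit_det _).1 (gram_posDef hA hu').isUnit)
  refine ⟨hB, ?_⟩
  have hB' : (1 : Matrix S S ℝ)⁻¹ + D * Uᵀ * (gram A u)⁻¹ * U = 1 + D * (Uᵀ * W) := by
    rw [inv_one, hW, Matrix.mul_assoc, Matrix.mul_assoc]
  rw [hadd, add_mul_mul_inv_eq_sub _ _ _ _ hGu isUnit_one (by rw [hB']; exact hB), hB', ← hW]
  congr 1
  have hWt : Wᵀ = Uᵀ * (gram A u)⁻¹ := by rw [hW, transpose_mul, hGt]
  rw [hWt]
  simp only [Matrix.mul_assoc]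

end Woodbury

namespace FastMul

variable {ω : ℝ} (F : FastMul ω) {mem : List ℝ} {n m : ℕ}

/-- Computing `(A X̄² Aᵀ)⁻¹` from scratch. -/
noncomputable def gramInv (hm : 0 < m) (a : Fin m → Fin n → ℕ) (x : Fin n → ℕ) :
    Prog Empty (Fin m → Fin m → ℕ) :=
  (collect fun i => collect fun j => cellE (a i j) * (cellE (x j) * cellE (x j))).bind fun s =>
  (F.mulRect m hm s fun j i => a i j).bind fun g => F.inv g

lemma computes_gramInv (hω : 2 ≤ ω) (hω' : ω ≤ 5 / 2) (hm : 0 < m) (hmn : m ≤ n)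
    {A : Matrix (Fin m) (Fin n) ℝ} (hA : A.rank = m) {u : EuclideanSpace ℝ (Fin n)}
    (hu : ∀ i, 0 < u i) {a : Fin m → Fin n → ℕ} {x : Fin n → ℕ}
    (ha : HoldsMat mem a A) (hx : HoldsVec mem x u.ofLp) :
    Computes mem (F.gramInv hm a x) ((40 * F.C + 52) * (n * (m : ℝ) ^ (ω - 1)))
      fun c m => HoldsMat m c (gram A u)⁻¹ := by
  have hC := F.one_le_C
  have key : Computes mem (F.gramInv hm a x) (m * (n * 2) +
      (8 * (F.C + 3) * ((m : ℝ) * n * m * (m : ℝ) ^ (ω - 3)) + (32 * F.C + 26) * (m : ℝ) ^ ω))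
      fun c m => HoldsMat m c (gram A u)⁻¹ := by
    refine Computes.bind (R := fun c m => HoldsMat m c (A * diagonal fun i => u i ^ 2)) ?_
      fun s m1 h1 hs => ?_
    · have := computes_mat (mem := mem) (M := A * diagonal fun i => u i ^ 2) (c := 2)
        fun i j => ((evals_cell (ha i j)).mul ((evals_cell (hx j)).mul (evals_cell (hx j)))).of_eq
          (by norm_num) (by rw [mul_diagonal]; ring)
      simpa using this
    refine Computes.bind (R := fun c m => HoldsMat m c (gram A u)) ?_ fun g m2 h2 hg => ?_
    · have := F.computes_mulRect hω hm (by simp) (by simpa using hmn) (by simp) hs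
        (N := Aᵀ) (b := fun j i => a i j) (fun j i => (ha.mono h1) i j)
      simpa [gram] using this
    · have := F.computes_inv hω hω' (by simpa using hm) (gram_posDef hA hu).isUnit hg
      simpa using this
  refine key.mono_cost ?_
  have hm1 : (1 : ℝ) ≤ m := by exact_mod_cast hm
  have hm0 : (0 : ℝ) < m := by linarith
  have hmn' : (m : ℝ) ≤ n := by exact_mod_cast hmn
  have e1 : (m : ℝ) * n * m * (m : ℝ) ^ (ω - 3) = n * (m : ℝ) ^ (ω - 1) := by
    rw [show ω - 1 = (ω - 3) + (2 : ℕ) by push_cast; ring, Real.rpow_add hm0, Real.rpow_natCast]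
    ring
  have e2 : (m : ℝ) ^ ω ≤ n * (m : ℝ) ^ (ω - 1) := by
    rw [show ω = (ω - 1) + 1 by ring, Real.rpow_add hm0, Real.rpow_one, add_sub_cancel_right,
      mul_comm]
    gcongr
  have e3 : (m : ℝ) ≤ (m : ℝ) ^ (ω - 1) := by
    conv_lhs => rw [← Real.rpow_one (m : ℝ)]
    exact Real.rpow_le_rpow_of_exponent_le hm1 (by linarith)
  have e4 : (m : ℝ) * n ≤ n * (m : ℝ) ^ (ω - 1) := by rw [mul_comm]; gcongr
  rw [e1]
  nlinarith

/-- Updating `(A X̄² Aᵀ)⁻¹` after a change of the coordinates in `S`, by the binomial inverse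
theorem. -/
noncomputable def woodbury (a : Fin m → Fin n → ℕ) (g : Fin m → Fin m → ℕ) (x x' : Fin n → ℕ)
    (S : Finset (Fin n)) (hS : 0 < S.card) : Prog Empty (Fin m → Fin m → ℕ) :=
  (F.mulRect S.card hS g (fun i (j : S) => a i j)).bind fun w =>
  (F.mulRect S.card hS (fun (j : S) i => a i j) w).bind fun s =>
  (collect fun i : S => collect fun j : S => natE (if i = j then 1 else 0) +
    (cellE (x' i) * cellE (x' i) - cellE (x i) * cellE (x i)) * cellE (s i j)).bind fun b =>
  (F.inv b).bind fun c =>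
  (collect fun i : S => collect fun j : Fin m =>
    (cellE (x' i) * cellE (x' i) - cellE (x i) * cellE (x i)) * cellE (w j i)).bind fun v =>
  (F.mulRect S.card hS c v).bind fun y =>
  (F.mulRect S.card hS w y).bind fun z =>
  collect fun i => collect fun j => cellE (g i j) - cellE (z i j)

/-- Every product has the dimensions `m`, `r` and `m` or `r`, with `r = |S| ≤ m`, and is computed in
blocks of size `r`; this costs at most `O(m² r ^ (ω - 2))`. -/
lemma computes_woodbury (hω : 2 ≤ ω) (hω' : ω ≤ 5 / 2)
    {A : Matrix (Fin m) (Fin n) ℝ} (hA : A.rank = m) {u u' : EuclideanSpace ℝ (Fin n)}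
    (hu : ∀ i, 0 < u i) (hu' : ∀ i, 0 < u' i) {S : Finset (Fin n)} (hS : 0 < S.card)
    (hSm : S.card ≤ m) (h : ∀ i ∉ S, u' i = u i)
    {a : Fin m → Fin n → ℕ} {g : Fin m → Fin m → ℕ} {x x' : Fin n → ℕ}
    (ha : HoldsMat mem a A) (hg : HoldsMat mem g (gram A u)⁻¹) (hx : HoldsVec mem x u.ofLp)
    (hx' : HoldsVec mem x' u'.ofLp) :
    Computes mem (F.woodbury a g x x' S hS)
      ((64 * F.C + 140) * (m * m * (S.card : ℝ) ^ (ω - 2)))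
      fun c m => HoldsMat m c (gram A u')⁻¹ := by
  have hC := F.one_le_C
  set U : Matrix (Fin m) S ℝ := A.submatrix id Subtype.val with hU
  set W : Matrix (Fin m) S ℝ := (gram A u)⁻¹ * U with hW
  set D : Matrix S S ℝ := diagonal (fun i : S => u' i ^ 2 - u i ^ 2) with hD
  obtain ⟨hB, hinv⟩ := inv_gram_update hA hu hu' h hU hW hD
  have hUa : HoldsMat mem (fun i (j : S) => a i j) U := fun i j => ha i j
  have hdiff : ∀ {mem' : List ℝ}, mem <+: mem' → ∀ i : S,
      Evals mem' (cellE (x' i) * cellE (x' i) - cellE (x i) * cellE (x i)) 3 (u' i ^ 2 - u i ^ 2) :=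
    fun hm i => (((evals_cell ((hx'.mono hm) i)).mul (evals_cell ((hx'.mono hm) i))).sub
      ((evals_cell ((hx.mono hm) i)).mul (evals_cell ((hx.mono hm) i)))).of_eq
        (by norm_num) (by ring)
  have key : Computes mem (F.woodbury a g x x' S hS)
      (8 * (F.C + 3) * ((m : ℝ) * m * S.card * (S.card : ℝ) ^ (ω - 3)) +
      (8 * (F.C + 3) * ((S.card : ℝ) * m * S.card * (S.card : ℝ) ^ (ω - 3)) +
      (S.card * (S.card * 6) + ((32 * F.C + 26) * (S.card : ℝ) ^ ω + (S.card * (m * 4) +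
      (8 * (F.C + 3) * ((S.card : ℝ) * S.card * m * (S.card : ℝ) ^ (ω - 3)) +
      (8 * (F.C + 3) * ((m : ℝ) * S.card * m * (S.card : ℝ) ^ (ω - 3)) +
      m * (m * 1))))))))
      fun c m => HoldsMat m c (gram A u')⁻¹ := by
    refine Computes.bind (R := fun c m => HoldsMat m c W) ?_ fun w m1 h1 hw => ?_
    · have := F.computes_mulRect hω hS (by simpa using hSm) (by simpa using hSm) (by simp) hg hUa
      simpa using this
    refine Computes.bind (R := fun c m => HoldsMat m c (Uᵀ * W)) ?_ fun s m2 h2 hs => ?_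
    · have := F.computes_mulRect hω hS (by simp) (by simpa using hSm) (by simp) (M := Uᵀ)
        (a := fun (j : S) i => a i j) (fun j i => (hUa.mono h1) i j) hw
      simpa using this
    have h02 := h1.trans h2
    refine Computes.bind (R := fun c m => HoldsMat m c (1 + D * (Uᵀ * W))) ?_ fun b m3 h3 hb => ?_
    · have := computes_mat (mem := m2) (M := 1 + D * (Uᵀ * W)) (c := 6) fun i j =>
        ((evals_nat (if i = j then 1 else 0)).add ((hdiff h02 i).mul (evals_cell (hs i j)))).of_eq
          (by norm_num)
          (by rw [Matrix.add_apply, hD, diagonal_mul, Matrix.one_apply]; split_ifs <;> simp)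
      simpa using this
    refine Computes.bind (R := fun c m => HoldsMat m c (1 + D * (Uᵀ * W))⁻¹) ?_ fun c m4 h4 hc => ?_
    · have := F.computes_inv hω hω' (by simpa using hS) hB hb
      simpa using this
    have h24 := h3.trans h4
    refine Computes.bind (R := fun c m => HoldsMat m c (D * Wᵀ)) ?_ fun v m5 h5 hv => ?_
    · have := computes_mat (mem := m4) (M := D * Wᵀ) (c := 4) fun (i : S) (j : Fin m) =>
        ((hdiff (h02.trans h24) i).mul (evals_cell ((hw.mono (h2.trans h24)) j i))).of_eq
          (by norm_num) (by rw [hD, diagonal_mul, transpose_apply])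
      simpa using this
    refine Computes.bind (R := fun c m => HoldsMat m c ((1 + D * (Uᵀ * W))⁻¹ * (D * Wᵀ))) ?_
      fun y m6 h6 hy => ?_
    · have := F.computes_mulRect hω hS (by simp) (by simp) (by simpa using hSm) (hc.mono h5) hv
      simpa using this
    have h16 := h2.trans (h24.trans (h5.trans h6))
    refine Computes.bind (R := fun c m => HoldsMat m c (W * ((1 + D * (Uᵀ * W))⁻¹ * (D * Wᵀ)))) ?_
      fun z m7 h7 hz => ?_
    · have := F.computes_mulRect hω hS (by simpa using hSm) (by simp) (by simpa using hSm)
        (hw.mono h16) hy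
      simpa using this
    · have := computes_mat (mem := m7) (M := (gram A u')⁻¹) (c := 1) fun i j =>
        ((evals_cell ((hg.mono (h1.trans (h16.trans h7))) i j)).sub (evals_cell (hz i j))).of_eq
          (by norm_num) (by rw [hinv, Matrix.sub_apply])
      simpa using this
  refine key.mono_cost ?_
  set r := S.card with hr
  set ρ := (r : ℝ) ^ (ω - 3) with hρ
  have hr1 : (1 : ℝ) ≤ r := by exact_mod_cast hS
  have hr0 : (0 : ℝ) < r := by linarith
  have hrm : (r : ℝ) ≤ m := by exact_mod_cast hSm
  set σ := (r : ℝ) ^ (ω - 2) with hσ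
  have hσ1 : 1 ≤ σ := Real.one_le_rpow hr1 (by linarith)
  have hρr : ρ * r = σ := by
    rw [hσ, show ω - 2 = (ω - 3) + 1 by ring, Real.rpow_add hr0, Real.rpow_one]
  have hrω : (r : ℝ) ^ ω = r * r * σ := by
    rw [show ω = (ω - 2) + (2 : ℕ) by push_cast; ring, Real.rpow_add hr0, Real.rpow_natCast]
    ring
  have h1 : (m : ℝ) * m * r * ρ = m * m * σ := by rw [← hρr]; ring
  have h2 : (r : ℝ) * m * r * ρ ≤ m * m * σ := by
    calc (r : ℝ) * m * r * ρ = r * m * σ := by rw [← hρr]; ring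
      _ ≤ _ := by gcongr
  have h3 : (r : ℝ) * r * m * ρ ≤ m * m * σ := by
    calc (r : ℝ) * r * m * ρ = r * m * σ := by rw [← hρr]; ring
      _ ≤ _ := by gcongr
  have h4 : (m : ℝ) * r * m * ρ = m * m * σ := by rw [← hρr]; ring
  have h5 : (r : ℝ) ^ ω ≤ m * m * σ := by rw [hrω]; gcongr
  have h6 : (m : ℝ) * m ≤ m * m * σ := le_mul_of_one_le_right (by positivity) hσ1
  have h7 : (r : ℝ) * r ≤ m * m := by gcongr
  have h8 : (r : ℝ) * m ≤ m * m := by gcongr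
  calc _ ≤ 8 * (F.C + 3) * (m * m * σ) + (8 * (F.C + 3) * (m * m * σ) +
      (6 * (m * m * σ) + ((32 * F.C + 26) * (m * m * σ) + (4 * (m * m * σ) +
      (8 * (F.C + 3) * (m * m * σ) + (8 * (F.C + 3) * (m * m * σ) + m * m * σ)))))) := by
        rw [h1, h4]
        gcongr ?_ + (8 * (F.C + 3) * ?_ + (?_ + ((32 * F.C + 26) * ?_ + (?_ +
          (8 * (F.C + 3) * ?_ + (?_ + ?_)))))) <;> linarith
    _ ≤ (64 * F.C + 140) * (m * m * σ) := by nlinarith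

/-- Updating `(A X̄² Aᵀ)⁻¹` after a change of the coordinates in `S`. Up to `m` changed coordinates,
the binomial inverse theorem is used; for more of them, starting from scratch is cheaper. -/
noncomputable def updateInv (hm : 0 < m) (a : Fin m → Fin n → ℕ) (g : Fin m → Fin m → ℕ)
    (x x' : Fin n → ℕ) (S : Finset (Fin n)) : Prog Empty (Fin m → Fin m → ℕ) :=
  if hS : 0 < S.card then
    if S.card ≤ m then F.woodbury a g x x' S hS else F.gramInv hm a x'
  else .ret g

/-- Both ways of updating cost `O(n m √|S|)` steps, because `ω ≤ 5 / 2`. -/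
lemma computes_updateInv (hω : 2 ≤ ω) (hω' : ω ≤ 5 / 2) (hm : 0 < m) (hmn : m ≤ n)
    {A : Matrix (Fin m) (Fin n) ℝ} (hA : A.rank = m) {u u' : EuclideanSpace ℝ (Fin n)}
    (hu : ∀ i, 0 < u i) (hu' : ∀ i, 0 < u' i) {S : Finset (Fin n)} (h : ∀ i ∉ S, u' i = u i)
    {a : Fin m → Fin n → ℕ} {g : Fin m → Fin m → ℕ} {x x' : Fin n → ℕ}
    (ha : HoldsMat mem a A) (hg : HoldsMat mem g (gram A u)⁻¹) (hx : HoldsVec mem x u.ofLp)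
    (hx' : HoldsVec mem x' u'.ofLp) :
    Computes mem (F.updateInv hm a g x x' S) ((64 * F.C + 140) * (n * m * √(S.card : ℝ)))
      fun c m => HoldsMat m c (gram A u')⁻¹ := by
  have hC := F.one_le_C
  have hm1 : (1 : ℝ) ≤ m := by exact_mod_cast hm
  have hmn' : (m : ℝ) ≤ n := by exact_mod_cast hmn
  unfold updateInv
  split_ifs with hS hSm
  · refine (F.computes_woodbury hω hω' hA hu hu' hS hSm h ha hg hx hx').mono_cost ?_
    have hr1 : (1 : ℝ) ≤ S.card := by exact_mod_cast hS
    have : (S.card : ℝ) ^ (ω - 2) ≤ √(S.card : ℝ) := by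
      rw [Real.sqrt_eq_rpow]
      exact Real.rpow_le_rpow_of_exponent_le hr1 (by linarith)
    gcongr
  · refine (F.computes_gramInv hω hω' hm hmn hA hu' ha hx').mono_cost ?_
    have hm0 : (0 : ℝ) < m := by linarith
    have : (m : ℝ) ^ (ω - 1) ≤ m * √(S.card : ℝ) := by
      rw [show ω - 1 = 1 + (ω - 2) by ring, Real.rpow_add hm0, Real.rpow_one]
      gcongr
      calc (m : ℝ) ^ (ω - 2) ≤ √(m : ℝ) := by
            rw [Real.sqrt_eq_rpow]
            exact Real.rpow_le_rpow_of_exponent_le hm1 (by linarith)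
        _ ≤ _ := Real.sqrt_le_sqrt (by exact_mod_cast (not_le.1 hSm).le)
    rw [mul_assoc (n : ℝ)]
    gcongr
    · linarith
    · norm_num
  · have hS0 : S.card = 0 := by omega
    have hS' : S = ∅ := Finset.card_eq_zero.1 hS0
    have huu : u' = u := by
      ext i; exact h i (by simp [hS'])
    rw [hS0, huu]
    exact (computes_ret fun _ hm => hg.mono hm).mono_cost (by simp)

end FastMul

/-! ### Programs with oracle calls and the stages of an iteration -/

section Oracle

variable {α β : Type} {n : ℕ} (f : EuclideanSpace ℝ (Fin n) → ℝ)

/-- From the memory `mem`, the program `p` with the first-order oracle of `f` takes at most `c`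
steps with at most `g` gradient evaluations, and its result and the final memory satisfy `R`. -/
structure Runs (p : Prog FirstOrder α) (mem : List ℝ) (c : ℝ) (g : ℕ)
    (R : α → List ℝ → Prop) : Prop where
  post : R (p.run (firstOrderOracle f) mem).out (p.run (firstOrderOracle f) mem).mem
  steps : ((p.run (firstOrderOracle f) mem).steps : ℝ) ≤ c
  calls : (p.run (firstOrderOracle f) mem).calls.countP FirstOrder.isGrad ≤ g

variable {f} {mem : List ℝ} {c c' : ℝ} {g : ℕ}

lemma Runs.mono {p : Prog FirstOrder α} {R : α → List ℝ → Prop} {g' : ℕ} (h : Runs f p mem c g R)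
    (hc : c ≤ c') (hg : g ≤ g') : Runs f p mem c' g' R :=
  ⟨h.post, h.steps.trans hc, h.calls.trans hg⟩

lemma runs_ret {a : α} {R : α → List ℝ → Prop} (h : R a mem) : Runs f (.ret a) mem 0 0 R :=
  ⟨h, by simp [Prog.run], by simp [Prog.run]⟩

lemma runs_lift_bind {p : Prog Empty α} {k : α → Prog FirstOrder β} {R : α → List ℝ → Prop}
    {R' : β → List ℝ → Prop} (h : Computes mem p c R)
    (hk : ∀ a mem', mem <+: mem' → R a mem' → Runs f (k a) mem' c' g R') :
    Runs f (p.lift.bind k) mem (c + c') g R' := by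
  obtain ⟨h1, h2⟩ := h mem List.prefix_rfl
  obtain ⟨h3, h4, h5⟩ := hk _ _ (Prog.prefix_run _ p mem) h1
  constructor
  · rw [Prog.run_bind, Prog.run_lift]; exact h3
  · rw [Prog.run_bind, Prog.run_lift]; push_cast; linarith
  · rw [Prog.run_bind, Prog.run_lift]; simpa using h5

lemma toLp_args {a : Fin n → ℕ} {x : EuclideanSpace ℝ (Fin n)} (hx : HoldsVec mem a x.ofLp) :
    (WithLp.toLp 2 fun i : Fin n => ((List.ofFn a).map (cell mem)).getD i 0) = x := by
  ext i
  simp [(hx i).cell]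

lemma runs_value {a : Fin n → ℕ} {k : ℕ → Prog FirstOrder α} {R : α → List ℝ → Prop}
    {x : EuclideanSpace ℝ (Fin n)} (hx : HoldsVec mem a x.ofLp)
    (hk : ∀ j mem', mem <+: mem' → At mem' j (f x) → Runs f (k j) mem' c g R) :
    Runs f (.call .value (List.ofFn a) k) mem (n + 2 + c) g R := by
  have h := hk mem.length (mem ++ [f x]) (List.prefix_append _ _) (at_append _ _ _)
  have e : firstOrderOracle f .value ((List.ofFn a).map (cell mem)) = [f x] := by
    rw [firstOrderOracle, toLp_args hx]
  refine ⟨?_, ?_, ?_⟩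
  · simp only [Prog.run, e]; exact h.post
  · simp only [Prog.run, e, List.length_ofFn, List.length_singleton]
    have := h.steps
    push_cast
    linarith
  · simp only [Prog.run, e]
    simpa [FirstOrder.isGrad] using h.calls

lemma runs_grad {a : Fin n → ℕ} {k : ℕ → Prog FirstOrder α} {R : α → List ℝ → Prop}
    {x : EuclideanSpace ℝ (Fin n)} (hx : HoldsVec mem a x.ofLp)
    (hk : ∀ j mem', mem <+: mem' → HoldsVec mem' (fun i : Fin n => j + i) (gradient f x).ofLp →
      Runs f (k j) mem' c g R) :
    Runs f (.call .grad (List.ofFn a) k) mem (2 * n + 1 + c) (1 + g) R := by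
  have h := hk mem.length (mem ++ List.ofFn fun i => gradient f x i) (List.prefix_append _ _)
    (fun i => by simp [At])
  have e : firstOrderOracle f .grad ((List.ofFn a).map (cell mem))
      = List.ofFn fun i => gradient f x i := by
    rw [firstOrderOracle, toLp_args hx]
  refine ⟨?_, ?_, ?_⟩
  · simp only [Prog.run, e]; exact h.post
  · simp only [Prog.run, e, List.length_ofFn]
    have := h.steps
    push_cast
    linarith
  · simp only [Prog.run, e]
    have := h.calls
    rw [List.countP_cons_of_pos (by rfl)]
    omega

end Oracle

section Stages

variable {n m : ℕ}

/-- The addresses of the parameters `ε`, `β`, `δ / (2 ⌈log₂ n⌉)` (which is `0` for `n = 1`, where it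
is irrelevant) and `-ε² / (2 l + 4 ε + 4)`. -/
structure Params where
  eps : ℕ
  rad : ℕ
  threshold : ℕ
  decrease : ℕ

/-- The cells `c` hold the parameters. -/
structure Params.Holds (c : Params) (n : ℕ) (ε l L : ℝ) (mem : List ℝ) : Prop where
  eps : At mem c.eps ε
  rad : At mem c.rad (radius ε l)
  threshold : At mem c.threshold (tolerance ε l L / (2 * Nat.clog 2 n))
  decrease : At mem c.decrease (-(ε ^ 2 / (2 * l + 4 * ε + 4)))

lemma Params.Holds.mono {c : Params} {ε l L : ℝ} {mem mem' : List ℝ} (h : c.Holds n ε l L mem)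
    (hm : mem <+: mem') : c.Holds n ε l L mem' :=
  ⟨h.eps.mono hm, h.rad.mono hm, h.threshold.mono hm, h.decrease.mono hm⟩

/-- Computing the parameters from `ε`, `l`, `L` in the cells `0`, `1`, `2`. -/
def paramsProg (n : ℕ) : Prog Empty Params :=
  (cellE 0 / (cellE 1 + natE 2 * cellE 0 + natE 2)).bind fun r =>
  (cellE 0 / (natE 15 * cellE 2)).bind fun p =>
  (cellE r / (natE 92 * cellE 2)).bind fun q =>
  (leE (cellE p) (cellE q)).bind fun b =>
  (cellE (if b then p else q) / (natE 2 * natE (Nat.clog 2 n))).bind fun s =>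
  (natE 0 - cellE 0 * cellE 0 / (natE 2 * cellE 1 + natE 4 * cellE 0 + natE 4)).bind fun d =>
  .ret ⟨0, r, s, d⟩

lemma computes_paramsProg {mem : List ℝ} {ε l L : ℝ} (h0 : At mem 0 ε) (h1 : At mem 1 l)
    (h2 : At mem 2 L) :
    Computes mem (paramsProg n) 30 fun c m => c.Holds n ε l L m := by
  have key : Computes mem (paramsProg n) (6 + (3 + (3 + (1 + (4 + 11)))))
      fun c m => c.Holds n ε l L m := by
    refine Computes.bind (R := fun a m => At m a (radius ε l))
      (((evals_cell h0).div (((evals_cell h1).add ((evals_nat 2).mul (evals_cell h0))).add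
        (evals_nat 2))).of_eq (by norm_num) (by rw [radius]; norm_num)) fun r m1 e1 hr => ?_
    refine Computes.bind (R := fun a m => At m a (ε / (15 * L)))
      (((evals_cell (h0.mono e1)).div ((evals_nat 15).mul (evals_cell (h2.mono e1)))).of_eq
        (by norm_num) (by norm_num)) fun p m2 e2 hp => ?_
    have e02 := e1.trans e2
    refine Computes.bind (R := fun a m => At m a (radius ε l / (92 * L)))
      (((evals_cell (hr.mono e2)).div ((evals_nat 92).mul (evals_cell (h2.mono e02)))).of_eq
        (by norm_num) (by norm_num)) fun q m3 e3 hq => ?_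
    have e03 := e02.trans e3
    refine Computes.bind ((computes_le (evals_cell (hp.mono e3)) (evals_cell hq)).mono_cost
      (by norm_num)) fun b m4 e4 hb => ?_
    have hδ : At m4 (if b then p else q) (tolerance ε l L) := by
      rw [tolerance]
      by_cases hle : ε / (15 * L) ≤ radius ε l / (92 * L)
      · rw [min_eq_left hle]
        simpa [hb.2 hle] using hp.mono (e3.trans e4)
      · rw [min_eq_right (not_le.1 hle).le]
        simpa [mt hb.1 hle] using hq.mono e4
    refine Computes.bind (R := fun a m => At m a (tolerance ε l L / (2 * Nat.clog 2 n)))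
      (((evals_cell hδ).div ((evals_nat 2).mul (evals_nat (Nat.clog 2 n)))).of_eq
        (by norm_num) (by norm_num)) fun s m5 e5 hs => ?_
    have e05 := e03.trans (e4.trans e5)
    refine Computes.bind_ret (R := fun a m => At m a (-(ε ^ 2 / (2 * l + 4 * ε + 4))))
      (((evals_nat 0).sub (((evals_cell (h0.mono e05)).mul (evals_cell (h0.mono e05))).div
        ((((evals_nat 2).mul (evals_cell (h1.mono e05))).add
        ((evals_nat 4).mul (evals_cell (h0.mono e05)))).add (evals_nat 4)))).of_eq
        (by norm_num) (by push_cast; ring)) fun d m6 e6 hd => ?_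
    exact ⟨h0.mono (e05.trans e6), hr.mono (e2.trans (e3.trans (e4.trans (e5.trans e6)))),
      hs.mono e6, hd⟩
  exact key.mono_cost (by norm_num)

/-- The logarithms of the coordinates of a point, and the value of the potential, from the
address `v` of the value of the objective function. -/
noncomputable def potentialProg (c : Params) (x : Fin n → ℕ) (v : ℕ) : Prog Empty ((Fin n → ℕ) × ℕ) :=
  (collect fun i => Prog.unary .log (cellE (x i))).bind fun y =>
  (cellE v - cellE c.eps * sumE n fun i => cellE (y i)).bind fun p => .ret (y, p)

lemma computes_potentialProg {mem : List ℝ} {c : Params} {ε l L : ℝ} {x : Fin n → ℕ} {v : ℕ}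
    {f : EuclideanSpace ℝ (Fin n) → ℝ} {z : EuclideanSpace ℝ (Fin n)} (hc : c.Holds n ε l L mem)
    (hx : HoldsVec mem x z.ofLp) (hv : At mem v (f z)) :
    Computes mem (potentialProg c x v) (2 * n + 3) fun a m =>
      HoldsVec m a.1 (lnVec z).ofLp ∧ At m a.2 (potential f ε z) := by
  have key : Computes mem (potentialProg c x v) (n * 1 + (n + 3)) fun a m =>
      HoldsVec m a.1 (lnVec z).ofLp ∧ At m a.2 (potential f ε z) := by
    refine Computes.bind (R := fun a m => HoldsVec m a (lnVec z).ofLp) ?_ fun y m1 e1 hy => ?_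
    · have := computes_vec (mem := mem) (v := (lnVec z).ofLp) fun i =>
        (evals_cell (hx i)).log.of_eq (c' := 1) (by norm_num) rfl
      simpa using this
    · exact Computes.bind_ret (R := fun a m => At m a (potential f ε z))
        (((evals_cell (hv.mono e1)).sub ((evals_cell (hc.eps.mono e1)).mul
          (evals_sum n fun i => evals_cell (hy i)))).of_eq (by linarith) rfl)
        fun p m2 e2 hp => ⟨hy.mono e2, hp⟩
  exact key.mono_cost (by linarith)

/-- The next iterate, from the gradient in the cells from `k` on. The matrix `R` is never formed:
applying its factors to the scaled gradient, from the right, takes `O(n m)` steps. -/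
noncomputable def stepProg (c : Params) (a : Fin m → Fin n → ℕ) (x xbar : Fin n → ℕ)
    (g : Fin m → Fin m → ℕ) (k : ℕ) : Prog Empty (Fin n → ℕ) :=
  (collect fun i : Fin n => cellE (x i) * cellE (k + i) - cellE c.eps).bind fun v =>
  (collect fun i : Fin n => cellE (x i) * cellE (v i)).bind fun p =>
  (collect fun i : Fin m => sumE n fun j => cellE (a i j) * cellE (p j)).bind fun w =>
  (collect fun i : Fin m => sumE m fun j => cellE (g i j) * cellE (w j)).bind fun u =>
  (collect fun j : Fin n => sumE m fun i => cellE (a i j) * cellE (u i)).bind fun z =>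
  (collect fun i : Fin n => cellE (v i) - natE 1 / cellE (x i) *
    (cellE (xbar i) * cellE (xbar i) * cellE (z i))).bind fun q =>
  (Prog.unary .sqrt (sumE n fun i => cellE (q i) * cellE (q i))).bind fun r =>
  (leE (cellE r) (natE 0)).bind fun b =>
  if b then .ret x else collect fun i : Fin n =>
    cellE (x i) + cellE (x i) * ((natE 0 - cellE c.rad / cellE r) * cellE (q i))

lemma computes_stepProg {mem : List ℝ} {c : Params} {ε l L : ℝ}
    {A : Matrix (Fin m) (Fin n) ℝ} {f : EuclideanSpace ℝ (Fin n) → ℝ}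
    {y ybar : EuclideanSpace ℝ (Fin n)} {a : Fin m → Fin n → ℕ} {x xbar : Fin n → ℕ}
    {g : Fin m → Fin m → ℕ} {k : ℕ} (hm : 0 < m) (hmn : m ≤ n)
    (hf : DifferentiableAt ℝ f y) (hy : ∀ i, 0 < y i) (hc : c.Holds n ε l L mem)
    (ha : HoldsMat mem a A) (hx : HoldsVec mem x y.ofLp) (hxb : HoldsVec mem xbar ybar.ofLp)
    (hg : HoldsMat mem g (gram A ybar)⁻¹)
    (hk : HoldsVec mem (fun i : Fin n => k + i) (gradient f y).ofLp) :
    Computes mem (stepProg c a x xbar g k) (30 * (n * m)) fun b m =>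
      HoldsVec m b (y + scale y (direction A f ε (radius ε l) y ybar)).ofLp := by
  set V := scale y (gradient (potential f ε) y) with hV
  have key : Computes mem (stepProg c a x xbar g k) (n * 2 + (n * 1 + (m * (n * 2 + 1) +
      (m * (m * 2 + 1) + (n * (m * 2 + 1) + (n * 6 + ((n * 2 + 2) + (2 + n * 6)))))))) fun b m =>
      HoldsVec m b (y + scale y (direction A f ε (radius ε l) y ybar)).ofLp := by
    refine Computes.bind (R := fun b m => HoldsVec m b V.ofLp) ?_ fun v m1 e1 hv => ?_
    · have := computes_vec (mem := mem) (v := V.ofLp) (c := 2) fun i =>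
        (((evals_cell (hx i)).mul (evals_cell (hk i))).sub (evals_cell hc.eps)).of_eq
          (by norm_num) (by
            have := (hy i).ne'
            rw [hV, scale_apply, gradient_potential hf hy]
            field_simp)
      simpa using this
    refine Computes.bind (R := fun b m => HoldsVec m b (scale y V).ofLp) ?_ fun p m2 e2 hp => ?_
    · have := computes_vec (mem := m1) (v := (scale y V).ofLp) (c := 1) fun i =>
        ((evals_cell ((hx.mono e1) i)).mul (evals_cell (hv i))).of_eq (by norm_num) rfl
      simpa using this
    have e02 := e1.trans e2
    refine Computes.bind (R := fun b m => HoldsVec m b (A.mulVec (scale y V).ofLp)) ?_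
      fun w m3 e3 hw => ?_
    · have := computes_vec (mem := m2) (v := A.mulVec (scale y V).ofLp) (c := n * 2 + 1) fun i =>
        (evals_sum n fun j => (evals_cell ((ha.mono e02) i j)).mul (evals_cell (hp j))).of_eq
          (by norm_num) rfl
      simpa using this
    have e03 := e02.trans e3
    refine Computes.bind (R := fun b m => HoldsVec m b (multiplier A y ybar V)) ?_
      fun u m4 e4 hu => ?_
    · have := computes_vec (mem := m3) (v := multiplier A y ybar V) (c := m * 2 + 1) fun i =>
        (evals_sum m fun j => (evals_cell ((hg.mono e03) i j)).mul (evals_cell (hw j))).of_eq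
          (by norm_num) rfl
      simpa using this
    have e04 := e03.trans e4
    refine Computes.bind (R := fun b m => HoldsVec m b
      (A.transpose.mulVec (multiplier A y ybar V))) ?_ fun z m5 e5 hz => ?_
    · have := computes_vec (mem := m4) (v := A.transpose.mulVec (multiplier A y ybar V))
        (c := m * 2 + 1) fun j =>
        (evals_sum m fun i => (evals_cell ((ha.mono e04) i j)).mul (evals_cell (hu i))).of_eq
          (by norm_num) rfl
      simpa using this
    have e05 := e04.trans e5
    set G := projGrad A f ε y ybar with hG
    refine Computes.bind (R := fun b m => HoldsVec m b G.ofLp) ?_ fun q m6 e6 hq => ?_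
    · have := computes_vec (mem := m5) (v := G.ofLp) (c := 6) fun i =>
        ((evals_cell ((hv.mono (e2.trans (e3.trans (e4.trans e5)))) i)).sub
          (((evals_nat 1).div (evals_cell ((hx.mono e05) i))).mul
          (((evals_cell ((hxb.mono e05) i)).mul (evals_cell ((hxb.mono e05) i))).mul
          (evals_cell (hz i))))).of_eq (by norm_num) (by
            rw [hG, projGrad_apply, Nat.cast_one, one_div, sq])
      simpa using this
    have e06 := e05.trans e6
    refine Computes.bind (R := fun b m => At m b ‖G‖) ?_ fun r m7 e7 hr => ?_
    · refine ((evals_sum n fun i => (evals_cell (hq i)).mul (evals_cell (hq i))).sqrt).of_eq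
        (by linarith) ?_
      rw [EuclideanSpace.norm_eq]
      congr 1
      exact Finset.sum_congr rfl fun i _ => by rw [Real.norm_eq_abs, sq_abs, sq]
    have e07 := e06.trans e7
    refine Computes.bind ((computes_le (evals_cell hr) (evals_nat 0)).mono_cost (by norm_num))
      fun b m8 e8 hb => ?_
    have e08 := e07.trans e8
    by_cases hG0 : G = 0
    · have hb' : b = true := by rw [hb]; simp [hG0]
      rw [if_pos hb', direction, if_pos hG0, scale_zero, add_zero]
      exact (computes_ret fun m9 e9 => hx.mono (e08.trans e9)).mono_cost (by positivity)
    · have hb' : ¬ b = true := by rw [hb]; simp [hG0]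
      rw [if_neg hb', direction, if_neg hG0]
      have := computes_vec (mem := m8) (v := (y + scale y (-(radius ε l / ‖G‖) • G)).ofLp) (c := 6)
        fun i => ((evals_cell ((hx.mono e08) i)).add ((evals_cell ((hx.mono e08) i)).mul
          (((evals_nat 0).sub ((evals_cell (hc.rad.mono e08)).div
          (evals_cell (hr.mono e8)))).mul (evals_cell ((hq.mono (e7.trans e8)) i))))).of_eq
          (by norm_num) (by simp [scale_apply])
      simpa using this
  refine key.mono_cost ?_
  have hm1 : (1 : ℝ) ≤ m := by exact_mod_cast hm
  have hmn' : (m : ℝ) ≤ n := by exact_mod_cast hmn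
  have h1 : (m : ℝ) * m ≤ n * m := by gcongr
  have h2 : (n : ℝ) ≤ n * m := le_mul_of_one_le_right (by linarith) hm1
  nlinarith

/-- The set of coordinates that the lazy update refreshes at time `t`; the cells `y s` hold the
logarithms of the iterate at time `s`. -/
noncomputable def refreshProg (c : Params) (y : ℕ → Fin n → ℕ) (t : ℕ) :
    Prog Empty (Finset (Fin n)) :=
  if 2 ^ Nat.clog 2 n ∣ t then .ret Finset.univ else
  (collect fun i => anyE (Nat.clog 2 n + 1) fun k =>
    if 2 ^ k ∣ t then
      (leE (cellE c.threshold) (cellE (y t i) - cellE (y (t - 2 ^ k) i))).bind fun p =>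
      (leE (cellE c.threshold) (cellE (y (t - 2 ^ k) i) - cellE (y t i))).bind fun q => .ret (p || q)
    else .ret false).bind fun b => .ret (Finset.univ.filter fun i => b i = true)

lemma computes_refreshProg {mem : List ℝ} {c : Params} {ε l L : ℝ} {y : ℕ → Fin n → ℕ}
    {z : ℕ → EuclideanSpace ℝ (Fin n)} {t : ℕ} (hc : c.Holds n ε l L mem)
    (hy : ∀ s ≤ t, HoldsVec mem (y s) (z s).ofLp) :
    Computes mem (refreshProg c y t) (n * ((Nat.clog 2 n + 1) * 4)) fun S _ =>
      S = refreshSet z t (tolerance ε l L) := by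
  classical
  unfold refreshProg
  split_ifs with hfull
  · refine (computes_ret fun _ _ => ?_).mono_cost (by positivity)
    ext i
    simp [refreshSet, hfull]
  set τ := tolerance ε l L / (2 * Nat.clog 2 n) with hτ
  refine Computes.bind_ret (R := fun b _ => ∀ i : Fin n, b i = true ↔ ∃ k < Nat.clog 2 n + 1,
    2 ^ k ∣ t ∧ τ ≤ |z t i - z (t - 2 ^ k) i|) ?_ fun b m1 e1 hb => ?_
  · have := computes_collect (mem := mem) (ι := Fin n)
      (f := fun i : Fin n => anyE (Nat.clog 2 n + 1) fun k =>
        if 2 ^ k ∣ t then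
          (leE (cellE c.threshold) (cellE (y t i) - cellE (y (t - 2 ^ k) i))).bind fun p =>
          (leE (cellE c.threshold) (cellE (y (t - 2 ^ k) i) - cellE (y t i))).bind fun q =>
          .ret (p || q)
        else .ret false)
      (R := fun i b _ => b = true ↔ ∃ k < Nat.clog 2 n + 1,
        2 ^ k ∣ t ∧ τ ≤ |z t i - z (t - 2 ^ k) i|) (c := (Nat.clog 2 n + 1 : ℕ) * 4)
      (fun _ _ _ _ _ h => h) (fun i => ?_)
    · simpa using this
    refine computes_any _ fun k _ => ?_
    split_ifs with hk
    · have h1 := hy t le_rfl i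
      have h2 := hy (t - 2 ^ k) (Nat.sub_le _ _) i
      refine Computes.mono_cost (c := 2 + 2) (Computes.bind ((computes_le (evals_cell hc.threshold)
        ((evals_cell h1).sub (evals_cell h2))).mono_cost (by norm_num)) fun p m2 e2 hp =>
        Computes.bind_ret ((computes_le (evals_cell (hc.threshold.mono e2))
        ((evals_cell (h2.mono e2)).sub (evals_cell (h1.mono e2)))).mono_cost (by norm_num))
        fun q m3 _ hq => ?_) (by norm_num)
      rw [Bool.or_eq_true, hp, hq, le_abs, neg_sub]
      simp [hk, hτ]
    · exact (computes_ret fun _ _ => by simp [hk]).mono_cost (by norm_num)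
  · ext i
    simp only [Finset.mem_filter, Finset.mem_univ, true_and, hb i, refreshSet,
      hfull, false_or, Nat.lt_succ_iff, hτ]

end Stages

/-! ### The loop of the algorithm -/

section Loop

variable {n m : ℕ}

/-- The addresses of the data that the loop maintains. -/
structure LoopState (n m : ℕ) where
  /-- the logarithms of all iterates so far -/
  logs : ℕ → Fin n → ℕ
  /-- the current iterate `x_t` -/
  point : Fin n → ℕ
  /-- its approximation `x̄_t` -/
  approx : Fin n → ℕ
  /-- the inverse of the Gram matrix `A X̄_t² Aᵀ` -/
  inv : Fin m → Fin m → ℕ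
  /-- the potential of `x_t` -/
  pot : ℕ

/-- The cells of the loop state hold the data of the algorithm at time `t`. -/
structure LoopState.Holds (st : LoopState n m) (A : Matrix (Fin m) (Fin n) ℝ)
    (f : EuclideanSpace ℝ (Fin n) → ℝ) (ε l L : ℝ) (x₀ : EuclideanSpace ℝ (Fin n)) (t : ℕ)
    (mem : List ℝ) : Prop where
  logs : ∀ s ≤ t, HoldsVec mem (st.logs s) (lnVec (iterate A f ε l L x₀ s)).ofLp
  point : HoldsVec mem st.point (iterate A f ε l L x₀ t).ofLp
  approx : HoldsVec mem st.approx (approxIterate A f ε l L x₀ t).ofLp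
  inv : HoldsMat mem st.inv (gram A (approxIterate A f ε l L x₀ t))⁻¹
  pot : At mem st.pot (potential f ε (iterate A f ε l L x₀ t))

variable {ω : ℝ} (F : FastMul ω)

/-- The loop of the algorithm at time `t`, with `fuel` iterations left. An iteration makes one
call of each oracle; the value of the potential is kept for the stopping test of the next one. -/
noncomputable def loopProg (hm : 0 < m) (c : Params) (a : Fin m → Fin n → ℕ) :
    (fuel t : ℕ) → LoopState n m → Prog FirstOrder (Bool × (Fin n → ℕ))
  | 0, _, st => .ret (false, st.point)
  | fuel + 1, t, st =>
    .call .grad (List.ofFn st.point) fun k =>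
    (stepProg c a st.point st.approx st.inv k).lift.bind fun x =>
    .call .value (List.ofFn x) fun v =>
    (potentialProg c x v).lift.bind fun yp =>
    (leE (cellE yp.2 - cellE st.pot) (cellE c.decrease)).lift.bind fun b =>
    if b then
      (refreshProg c (Function.update st.logs (t + 1) yp.1) (t + 1)).lift.bind fun S =>
      (F.updateInv hm a st.inv st.approx (fun i => if i ∈ S then x i else st.approx i) S).lift.bind
        fun g => loopProg hm c a fuel (t + 1)
        { logs := Function.update st.logs (t + 1) yp.1
          point := x
          approx := fun i => if i ∈ S then x i else st.approx i
          inv := g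
          pot := yp.2 }
    else .ret (true, st.point)

/-- A bound for the number of steps of iteration `t`. -/
noncomputable def iterationCost (A : Matrix (Fin m) (Fin n) ℝ) (f : EuclideanSpace ℝ (Fin n) → ℝ)
    (ε l L : ℝ) (x₀ : EuclideanSpace ℝ (Fin n)) (t : ℕ) : ℝ :=
  50 * (n * m * (Nat.clog 2 n + 1)) + (64 * F.C + 140) * (n * m * √((refreshSet
    (fun k => lnVec (iterate A f ε l L x₀ k)) (t + 1) (tolerance ε l L)).card : ℝ))

lemma iterationCost_nonneg (A : Matrix (Fin m) (Fin n) ℝ) (f : EuclideanSpace ℝ (Fin n) → ℝ)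
    (ε l L : ℝ) (x₀ : EuclideanSpace ℝ (Fin n)) (t : ℕ) :
    0 ≤ iterationCost F A f ε l L x₀ t := by
  have := F.one_le_C
  unfold iterationCost
  positivity

lemma outcome_of_stops {A : Matrix (Fin m) (Fin n) ℝ} {f : EuclideanSpace ℝ (Fin n) → ℝ}
    {ε l L : ℝ} {x₀ : EuclideanSpace ℝ (Fin n)} {T t : ℕ} (ht : t < T)
    (hs : Stops A f ε l L x₀ t) (hns : ∀ s < t, ¬ Stops A f ε l L x₀ s) :
    outcome A f ε l L x₀ T = (true, iterate A f ε l L x₀ t) := by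
  classical
  have h : ∃ t, t < T ∧ Stops A f ε l L x₀ t := ⟨t, ht, hs⟩
  have hfind : Nat.find h = t := (Nat.find_eq_iff h).2 ⟨⟨ht, hs⟩, fun s hst hh => hns s hst hh.2⟩
  rw [outcome, dif_pos h]
  congr 2

lemma outcome_of_not_stops {A : Matrix (Fin m) (Fin n) ℝ} {f : EuclideanSpace ℝ (Fin n) → ℝ}
    {ε l L : ℝ} {x₀ : EuclideanSpace ℝ (Fin n)} {T : ℕ}
    (hns : ∀ s < T, ¬ Stops A f ε l L x₀ s) :
    outcome A f ε l L x₀ T = (false, iterate A f ε l L x₀ T) := by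
  rw [outcome, dif_neg]
  rintro ⟨t, ht, hs⟩
  exact hns t ht hs

/-- The loop computes the outcome of the algorithm from every correct state that is reached without
stopping. -/
lemma runs_loopProg (hω : 2 ≤ ω) (hω' : ω ≤ 5 / 2) (hm : 0 < m) (hmn : m ≤ n)
    {A : Matrix (Fin m) (Fin n) ℝ} {b : Fin m → ℝ} {f : EuclideanSpace ℝ (Fin n) → ℝ}
    {ε l L : ℝ} {x₀ : EuclideanSpace ℝ (Fin n)} (hA : A.rank = m)
    (hf : DifferentiableOn ℝ f {x | ∀ i, 0 < x i}) (hε : 0 < ε) (hε2 : ε ≤ 1 / 2) (hl : 0 ≤ l)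
    (hx₀ : x₀ ∈ strictlyFeasible A b) {c : Params} {a : Fin m → Fin n → ℕ} {T : ℕ} (fuel : ℕ) :
    ∀ (t : ℕ) (st : LoopState n m) (mem : List ℝ), t + fuel = T →
      (∀ s < t, ¬ Stops A f ε l L x₀ s) → c.Holds n ε l L mem → HoldsMat mem a A →
      st.Holds A f ε l L x₀ t mem →
      Runs f (loopProg F hm c a fuel t st) mem
        (∑ s ∈ Finset.range fuel, iterationCost F A f ε l L x₀ (t + s)) fuel
        fun r mem' => r.1 = (outcome A f ε l L x₀ T).1 ∧
          HoldsVec mem' r.2 (outcome A f ε l L x₀ T).2.ofLp := by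
  have hn1 : (1 : ℝ) ≤ n := by exact_mod_cast hm.trans_le hmn
  have hm1 : (1 : ℝ) ≤ m := by exact_mod_cast hm
  have hnm : (n : ℝ) ≤ n * m := le_mul_of_one_le_right (by linarith) hm1
  induction fuel with
  | zero =>
    intro t st mem ht hns _ _ hst
    obtain rfl : t = T := by omega
    rw [outcome_of_not_stops hns]
    exact (runs_ret ⟨rfl, hst.point⟩).mono (by simp) le_rfl
  | succ fuel ih =>
    intro t st mem ht hns hc ha hst
    set x : ℕ → EuclideanSpace ℝ (Fin n) := iterate A f ε l L x₀ with hx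
    set u : ℕ → EuclideanSpace ℝ (Fin n) := approxIterate A f ε l L x₀ with hu
    set S := refreshSet (fun k => lnVec (x k)) (t + 1) (tolerance ε l L) with hS
    set K := Nat.clog 2 n with hK
    set rest := ∑ s ∈ Finset.range fuel, iterationCost F A f ε l L x₀ (t + 1 + s) with hrest
    have hrest0 : 0 ≤ rest := Finset.sum_nonneg fun s _ => iterationCost_nonneg F A f ε l L x₀ _
    have hC := F.one_le_C
    have hmem := iterate_mem (f := f) (L := L) hA hε hε2 hl hx₀
    rw [Finset.sum_range_succ']
    have hshift : ∑ s ∈ Finset.range fuel, iterationCost F A f ε l L x₀ (t + (s + 1)) = rest :=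
      Finset.sum_congr rfl fun s _ => by rw [show t + (s + 1) = t + 1 + s by ring]
    rw [hshift, add_zero]
    refine Runs.mono (c := 2 * n + 1 + (30 * (n * m) + (n + 2 + ((2 * n + 3) + (2 +
      (n * ((K + 1) * 4) + ((64 * F.C + 140) * (n * m * √(S.card : ℝ)) + rest)))))))
      (g := 1 + fuel) ?_ ?_ (by omega)
    · refine runs_grad hst.point fun k m1 e1 hk => ?_
      refine runs_lift_bind (computes_stepProg hm hmn (differentiableAt_of_pos hf (hmem t).2)
        (hmem t).2 (hc.mono e1) (ha.mono e1) (hst.point.mono e1) (hst.approx.mono e1)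
        (hst.inv.mono e1) hk) fun y m2 e2 hy => ?_
      rw [← iterate_succ, ← hx] at hy
      refine runs_value hy fun v m3 e3 hv => ?_
      have e03 := e1.trans (e2.trans e3)
      refine runs_lift_bind (computes_potentialProg (hc.mono e03) (hy.mono e3) hv)
        fun yp m4 e4 hyp => ?_
      have e04 := e03.trans e4
      refine runs_lift_bind ((computes_le ((evals_cell hyp.2).sub (evals_cell (hst.pot.mono e04)))
        (evals_cell (hc.decrease.mono e04))).mono_cost (by norm_num)) fun d m5 e5 hd => ?_
      have e05 := e04.trans e5
      by_cases hsmall : Stops A f ε l L x₀ t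
      · have hd' : ¬ d = true := by
          rw [hd]; exact not_le.2 hsmall
        rw [if_neg hd', outcome_of_stops (by omega) hsmall hns]
        exact (runs_ret ⟨rfl, hst.point.mono e05⟩).mono (by positivity) (Nat.zero_le _)
      · have hd' : d = true := hd.2 (not_lt.1 hsmall)
        rw [if_pos hd']
        have hlogs : ∀ s ≤ t + 1, HoldsVec m5 (Function.update st.logs (t + 1) yp.1 s)
            (lnVec (x s)).ofLp := by
          intro s hs
          rcases Nat.lt_or_ge s (t + 1) with hlt | hge
          · rw [Function.update_of_ne (by omega)]
            exact (hst.logs s (by omega)).mono e05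
          · obtain rfl : s = t + 1 := by omega
            rw [Function.update_self]
            exact hyp.1.mono e5
        refine runs_lift_bind (computes_refreshProg (z := fun k => lnVec (x k)) (hc.mono e05) hlogs)
          fun S' m6 e6 hS' => ?_
        rw [← hS] at hS'
        subst hS'
        have e06 := e05.trans e6
        have hnew : HoldsVec m6 (fun i => if i ∈ S then y i else st.approx i) (u (t + 1)).ofLp := by
          intro i
          rw [hu, approxIterate_succ hA hε hε2 hl hx₀]
          by_cases hi : i ∈ S
          · simp only [hi, if_true]
            rw [if_pos hi]
            exact hy.mono (e3.trans (e4.trans (e5.trans e6))) i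
          · simp only [hi, if_false]
            rw [if_neg hi]
            exact hst.approx.mono e06 i
        have hsame : ∀ i ∉ S, u (t + 1) i = u t i := by
          intro i hi
          rw [hu, approxIterate_succ hA hε hε2 hl hx₀, if_neg hi]
        refine runs_lift_bind (F.computes_updateInv hω hω' hm hmn hA
          (approxIterate_pos A f ε l L x₀ t) (approxIterate_pos A f ε l L x₀ (t + 1)) hsame
          (ha.mono e06) (hst.inv.mono e06) (hst.approx.mono e06) hnew) fun g m7 e7 hg => ?_
        refine ih (t + 1) _ m7 (by omega) (fun s hs => ?_) (hc.mono (e06.trans e7))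
          (ha.mono (e06.trans e7)) ⟨fun s hs => (hlogs s hs).mono (e6.trans e7),
            hy.mono (e3.trans (e4.trans (e5.trans (e6.trans e7)))), hnew.mono e7, hg,
            hyp.2.mono (e5.trans (e6.trans e7))⟩
        rcases Nat.lt_or_ge s t with hlt | hge
        · exact hns s hlt
        · obtain rfl : s = t := by omega
          exact hsmall
    · have hK0 : (0 : ℝ) ≤ K := Nat.cast_nonneg _
      have h1 : (n : ℝ) * (K + 1) ≤ n * m * (K + 1) := by gcongr
      have h2 : (n : ℝ) * m ≤ n * m * (K + 1) := le_mul_of_one_le_right (by positivity) (by linarith)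
      have hcost : iterationCost F A f ε l L x₀ t = 50 * (n * m * (K + 1)) +
        (64 * F.C + 140) * (n * m * √(S.card : ℝ)) := rfl
      rw [hcost]
      linarith

/-- The program: the parameters, the initial potential and the initial inverse, then the loop. In
the input, the cells `0`, `1`, `2` hold `ε`, `l`, `L`, the cells from `3` on the starting point,
and those from `3 + n` on the matrix, row by row. -/
noncomputable def mainProg (n m T : ℕ) : Prog FirstOrder (Bool × (Fin n → ℕ)) :=
  if hm : 0 < m then
    (paramsProg n).lift.bind fun c =>
    .call .value (List.ofFn fun j : Fin n => 3 + (j : ℕ)) fun v =>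
    (potentialProg c (fun j : Fin n => 3 + (j : ℕ)) v).lift.bind fun yp =>
    (F.gramInv hm (fun i (j : Fin n) => 3 + n + (i * n + j)) fun j => 3 + (j : ℕ)).lift.bind fun g =>
    loopProg F hm c (fun i j => 3 + n + (i * n + j)) T 0
      { logs := fun _ => yp.1
        point := fun j => 3 + (j : ℕ)
        approx := fun j => 3 + (j : ℕ)
        inv := g
        pot := yp.2 }
  else .ret (false, fun _ => 0)

lemma at_inputMem_matrix (A : Matrix (Fin m) (Fin n) ℝ) (ε l L : ℝ)
    (x₀ : EuclideanSpace ℝ (Fin n)) :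
    HoldsMat (inputMem A ε l L x₀)
      (fun (i : Fin m) (j : Fin n) => 3 + n + ((i : ℕ) * n + j)) A := by
  intro i j
  have hn : 0 < n := Fin.pos j
  have hlt : (i : ℕ) * n + j < m * n := by
    calc (i : ℕ) * n + j < i * n + n := by omega
      _ = (i + 1) * n := by ring
      _ ≤ m * n := Nat.mul_le_mul_right n i.2
  have hdiv : ∀ (i' : Fin m) (j' : Fin n), ((i' : ℕ) * n + j') / n = i' := fun i' j' => by
    rw [mul_comm, Nat.mul_add_div hn, Nat.div_eq_of_lt j'.2, add_zero]
  have hmod : ∀ (i' : Fin m) (j' : Fin n), ((i' : ℕ) * n + j') % n = j' := fun i' j' => by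
    rw [mul_comm, Nat.mul_add_mod, Nat.mod_eq_of_lt j'.2]
  have hfl : (List.ofFn fun i => List.ofFn fun j => A i j).flatten = List.ofFn
      fun k : Fin (m * n) =>
        A ⟨k / n, Nat.div_lt_of_lt_mul (lt_of_lt_of_eq k.2 (Nat.mul_comm m n))⟩
        ⟨k % n, Nat.mod_lt _ hn⟩ := by
    rw [List.ofFn_mul]
    congr 2
    funext i'
    congr 1
    funext j'
    have e1 := hdiv i' j'
    have e2 := hmod i' j'
    simp only [e1, e2]
  have hlen : ([ε, l, L] ++ List.ofFn fun j => x₀ j).length = 3 + n := by simp; omega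
  have e1 := hdiv i j
  have e2 := hmod i j
  change (inputMem A ε l L x₀)[3 + n + ((i : ℕ) * n + j)]? = some (A i j)
  rw [inputMem, hfl, List.getElem?_append_right (by omega), hlen, Nat.add_sub_cancel_left,
    List.getElem?_ofFn, dif_pos hlt]
  simp only [e1, e2]

lemma at_inputMem_point (A : Matrix (Fin m) (Fin n) ℝ) (ε l L : ℝ)
    (x₀ : EuclideanSpace ℝ (Fin n)) :
    HoldsVec (inputMem A ε l L x₀) (fun j : Fin n => 3 + (j : ℕ)) x₀.ofLp := by
  intro j
  change (inputMem A ε l L x₀)[3 + (j : ℕ)]? = some (x₀ j)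
  rw [inputMem, List.getElem?_append_left (by simp; omega),
    List.getElem?_append_right (by simp)]
  simp

lemma runs_mainProg (hω : 2 ≤ ω) (hω' : ω ≤ 5 / 2) (hm : 0 < m) (hmn : m ≤ n)
    {A : Matrix (Fin m) (Fin n) ℝ} {b : Fin m → ℝ} {f : EuclideanSpace ℝ (Fin n) → ℝ}
    {ε l L : ℝ} {x₀ : EuclideanSpace ℝ (Fin n)} (hA : A.rank = m)
    (hf : DifferentiableOn ℝ f {x | ∀ i, 0 < x i}) (hε : 0 < ε) (hε2 : ε ≤ 1 / 2) (hl : 0 ≤ l)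
    (hx₀ : x₀ ∈ strictlyFeasible A b) (T : ℕ) :
    Runs f (mainProg F n m T) (inputMem A ε l L x₀) ((40 * F.C + 90) * (n * (m : ℝ) ^ (ω - 1)) +
        ∑ s ∈ Finset.range T, iterationCost F A f ε l L x₀ s) T
      fun r mem' => r.1 = (outcome A f ε l L x₀ T).1 ∧
        HoldsVec mem' r.2 (outcome A f ε l L x₀ T).2.ofLp := by
  have hn1 : (1 : ℝ) ≤ n := by exact_mod_cast hm.trans_le hmn
  have hm1 : (1 : ℝ) ≤ m := by exact_mod_cast hm
  have ha := at_inputMem_matrix A ε l L x₀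
  have hx := at_inputMem_point A ε l L x₀
  have h0 : At (inputMem A ε l L x₀) 0 ε := rfl
  have h1 : At (inputMem A ε l L x₀) 1 l := rfl
  have h2 : At (inputMem A ε l L x₀) 2 L := rfl
  have hu : approxIterate A f ε l L x₀ 0 = x₀ := by
    ext i; exact approxIterate_zero hx₀.2 i
  refine Runs.mono (c := 30 + (n + 2 + (2 * n + 3 + ((40 * F.C + 52) * (n * (m : ℝ) ^ (ω - 1)) +
    ∑ s ∈ Finset.range T, iterationCost F A f ε l L x₀ s)))) (g := T) ?_ ?_ le_rfl
  · rw [mainProg, dif_pos hm]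
    refine runs_lift_bind (computes_paramsProg h0 h1 h2) fun c m1 e1 hc => ?_
    refine runs_value (hx.mono e1) fun v m2 e2 hv => ?_
    have e02 := e1.trans e2
    refine runs_lift_bind (computes_potentialProg (hc.mono e2) (hx.mono e02) hv)
      fun yp m3 e3 hyp => ?_
    have e03 := e02.trans e3
    refine runs_lift_bind (F.computes_gramInv hω hω' hm hmn hA hx₀.2 (ha.mono e03) (hx.mono e03))
      fun g m4 e4 hg => ?_
    have e04 := e03.trans e4
    have := runs_loopProg F hω hω' hm hmn hA hf hε hε2 hl hx₀ (T := T) T 0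
      { logs := fun _ => yp.1
        point := fun j => 3 + (j : ℕ)
        approx := fun j => 3 + (j : ℕ)
        inv := g
        pot := yp.2 } m4 (by omega) (fun s hs => by omega) (hc.mono (e2.trans (e3.trans e4)))
        (ha.mono e04) ⟨fun s hs => by
          obtain rfl : s = 0 := by omega
          exact hyp.1.mono e4, hx.mono e04, by rw [hu]; exact hx.mono e04,
          by rw [hu]; exact hg, hyp.2.mono e4⟩
    simpa using this
  · have h3 : (n : ℝ) ≤ n * (m : ℝ) ^ (ω - 1) :=
      le_mul_of_one_le_right (by linarith) (Real.one_le_rpow hm1 (by linarith))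
    linarith

end Loop

/-! ### The number of iterations and the total running time -/

section Bounds

variable {n m : ℕ}

/-- The constant `8` comes from `2 l + 4 ε + 4 ≤ 2 l + 6 ≤ 8 max l 1`. -/
lemma maxIter_le {Δ C₀ ε l : ℝ} (hε : 0 < ε) (hε2 : ε ≤ 1 / 2) (hl : 0 ≤ l) :
    (maxIter Δ C₀ ε l : ℝ) ≤ (8 * (1 + |C₀|) + 1) * (max l 1 * max Δ ε / ε ^ 2) := by
  set M := max l 1 with hM
  set W := max Δ ε with hW
  have hl1 : l ≤ M := le_max_left _ _
  have hM1 : 1 ≤ M := le_max_right _ _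
  have hΔW : Δ ≤ W := le_max_left _ _
  have hεW : ε ≤ W := le_max_right _ _
  have hW0 : 0 < W := hε.trans_le hεW
  have hC := le_abs_self C₀
  have hC0 := abs_nonneg C₀
  -- this absorbs the rounding up of the number of iterations
  have hone : 1 ≤ M * W / ε ^ 2 := by
    rw [le_div_iff₀ (by positivity)]
    nlinarith
  have h2 : Δ + (C₀ - 1) * ε ≤ (1 + |C₀|) * W := by
    nlinarith [mul_le_mul_of_nonneg_left hεW hC0, mul_le_mul_of_nonneg_right hC hε.le]
  have h3 : 2 * l + 4 * ε + 4 ≤ 8 * M := by linarith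
  have h1 : (Δ + (C₀ - 1) * ε) * (2 * l + 4 * ε + 4) / ε ^ 2 ≤
      8 * (1 + |C₀|) * (M * W / ε ^ 2) :=
    calc _ ≤ ((1 + |C₀|) * W) * (8 * M) / ε ^ 2 := by gcongr
      _ = _ := by ring
  rw [add_one_mul]
  refine (Nat.cast_le.2 (Nat.ceil_mono h1)).trans ?_
  exact (Nat.ceil_lt_add_one (by positivity)).le.trans (by linarith)

lemma clog_add_one_le {ε : ℝ} (hn : 0 < n) (hε : 0 < ε) (hε2 : ε ≤ 1 / 2) :
    (Nat.clog 2 n + 1 : ℝ) ≤ 2 * (1 + Real.log (n / ε)) := by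
  have hn1 : (1 : ℝ) ≤ n := by exact_mod_cast hn
  have hlog : Real.log n ≤ Real.log (n / ε) :=
    Real.log_le_log (by linarith) (le_div_self (by linarith) hε (by linarith))
  have hlog0 := Real.log_nonneg hn1
  rcases Nat.eq_or_lt_of_le hn with rfl | hn2
  · simp at hlog ⊢
    linarith
  · have hK : 0 < Nat.clog 2 n := Nat.clog_pos one_lt_two (by omega)
    have hpow : ((2 : ℝ)) ^ (Nat.clog 2 n - 1) ≤ n := by
      exact_mod_cast (Nat.pow_pred_clog_lt_self one_lt_two (by omega)).le
    have h := Real.log_le_log (by positivity) hpow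
    rw [Real.log_pow, Nat.cast_sub hK, Nat.cast_one] at h
    have h2 := Real.log_two_gt_d9
    have h3 : (1 : ℝ) ≤ Nat.clog 2 n := by exact_mod_cast hK
    nlinarith

lemma outcome_cases (A : Matrix (Fin m) (Fin n) ℝ) (f : EuclideanSpace ℝ (Fin n) → ℝ)
    (ε l L : ℝ) (x₀ : EuclideanSpace ℝ (Fin n)) (T : ℕ) :
    (∃ t, Stops A f ε l L x₀ t ∧ outcome A f ε l L x₀ T = (true, iterate A f ε l L x₀ t)) ∨
      (∀ t < T, ¬ Stops A f ε l L x₀ t) ∧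
        outcome A f ε l L x₀ T = (false, iterate A f ε l L x₀ T) := by
  classical
  by_cases h : ∃ t, t < T ∧ Stops A f ε l L x₀ t
  · exact Or.inl ⟨Nat.find h, (Nat.find_spec h).2,
      outcome_of_stops (Nat.find_spec h).1 (Nat.find_spec h).2 fun s hs hst =>
        Nat.find_min h hs ⟨hs.trans (Nat.find_spec h).1, hst⟩⟩
  · have hns : ∀ t < T, ¬ Stops A f ε l L x₀ t := fun t ht hst => h ⟨t, ht, hst⟩
    exact Or.inr ⟨hns, outcome_of_not_stops hns⟩

variable {ω : ℝ} (F : FastMul ω)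

/-- The refreshed coordinates are so few that the `T` iterations together cost `O(n m T log² n)`:
a level `k` of the dyadic scheme is active in every `2 ^ k`-th iteration, and then contributes
`O(2 ^ k log n)` to `√|S|`. -/
lemma sum_iterationCost_le {A : Matrix (Fin m) (Fin n) ℝ} {b : Fin m → ℝ}
    {f : EuclideanSpace ℝ (Fin n) → ℝ} {ε l L : ℝ} {x₀ : EuclideanSpace ℝ (Fin n)}
    (hA : A.rank = m) (hε : 0 < ε) (hε2 : ε ≤ 1 / 2) (hl : 0 ≤ l) (hL : 0 < L)
    (hx₀ : x₀ ∈ strictlyFeasible A b) (T : ℕ) :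
    ∑ t ∈ Finset.range T, iterationCost F A f ε l L x₀ t ≤
      (50 + (64 * F.C + 140) * (1 + 368 * L)) * (Nat.clog 2 n + 1) ^ 2 * T * (n * m) := by
  have hC := F.one_le_C
  set K : ℕ := Nat.clog 2 n with hK
  have hK0 : (0 : ℝ) ≤ K := Nat.cast_nonneg _
  have hδ := tolerance_pos hε hl hL
  have hβ := radius_pos hε hl
  have hmax : max 1 (2 * K * (2 * radius ε l) / tolerance ε l L) ≤ (1 + 368 * L) * (K + 1) := by
    have h1 := mul_le_mul_of_nonneg_left (radius_div_tolerance_le hε hl hL)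
      (by positivity : (0 : ℝ) ≤ 4 * K)
    have h2 : 2 * K * (2 * radius ε l) / tolerance ε l L =
      4 * K * (radius ε l / tolerance ε l L) := by ring
    rw [h2]
    have h3 : 0 ≤ L * K := by positivity
    exact max_le (by nlinarith) (by nlinarith)
  have hcard : ∀ t ∈ Finset.range T, iterationCost F A f ε l L x₀ t ≤
      50 * (n * m * (K + 1)) + (64 * F.C + 140) * (n * m * ((1 + 368 * L) * (K + 1) *
        ∑ k ∈ (Finset.range (K + 1)).filter (fun k => 2 ^ k ∣ t + 1), (2 : ℝ) ^ k)) := by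
    intro t _
    have h := (sqrt_card_refreshSet_le (y := fun k => lnVec (iterate A f ε l L x₀ k)) hδ
      (by positivity) (norm_lnVec_iterate_sub_le hA hε hε2 hl hx₀) t.succ_pos).trans
      (mul_le_mul_of_nonneg_right hmax (Finset.sum_nonneg fun k _ => by positivity))
    exact add_le_add le_rfl (mul_le_mul_of_nonneg_left
      (mul_le_mul_of_nonneg_left h (by positivity)) (by positivity))
  have hdyadic := sum_dyadic_le K T
  refine (Finset.sum_le_sum hcard).trans ?_
  rw [Finset.sum_add_distrib, Finset.sum_const, Finset.card_range, nsmul_eq_mul,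
    ← Finset.mul_sum, ← Finset.mul_sum, ← Finset.mul_sum]
  generalize (∑ t ∈ Finset.range T, ∑ k ∈ (Finset.range (K + 1)).filter
    (fun k => 2 ^ k ∣ t + 1), (2 : ℝ) ^ k) = σ at hdyadic ⊢
  have h1 : (T : ℝ) * (50 * (n * m * (K + 1))) ≤ T * (50 * (n * m * (K + 1) ^ 2)) := by
    gcongr
    exact le_self_pow₀ (by linarith) two_ne_zero
  have h2 : (64 * F.C + 140) * (n * m * ((1 + 368 * L) * (K + 1) * σ)) ≤
      (64 * F.C + 140) * (n * m * ((1 + 368 * L) * (K + 1) * ((K + 1) * T))) := by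
    gcongr
  linarith

end Bounds

end IPTR

open IPTR

theorem mainTheorem1 (ω : ℝ) (hω₂ : 2 ≤ ω) (hω : ω ≤ 5 / 2) (hmul : IsMatMulExponent ω) :
    ∃ (P : (n m T : ℕ) → Prog FirstOrder (Bool × (Fin n → ℕ))) (p : ℕ),
    ∀ C₀ : ℝ, ∃ K₁ : ℝ,
    ∀ l Lφ D : ℝ, 0 ≤ l → 0 < Lφ → ∃ K₂ : ℝ,
    ∀ (n m : ℕ) (A : Matrix (Fin m) (Fin n) ℝ) (b : Fin m → ℝ)
      (f : EuclideanSpace ℝ (Fin n) → ℝ) (γ ε : ℝ) (x₀ xstar : EuclideanSpace ℝ (Fin n)),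
      0 < m → m ≤ n → A.rank = m →
      ContinuousOn f {x | ∀ i, 0 ≤ x i} →
      DifferentiableOn ℝ f {x | ∀ i, 0 < x i} →
      γ < 1 → 0 < ε → ε ≤ min γ (1 / 2) →
      ScaledGradLipschitz A b f γ l →
      ScaledPotentialGradBound A b f ε Lφ →
      IsApproxAnalyticCenter A b C₀ x₀ →
      xstar ∈ feasible A b → IsMinOn f (feasible A b) xstar →
      f x₀ - f xstar ≤ D →
      let T : ℕ := maxIter (f x₀ - f xstar) C₀ ε l
      let res := outcome A f ε l Lφ x₀ T
      let r := (P n m T).run (firstOrderOracle f) (inputMem A ε l Lφ x₀)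
      -- the outcome of the algorithm
      (res.1 = true →
        IsApproxKKT f (fun i x => A.mulVec x.ofLp i - b i) (fun i x => x i) (2 * ε) res.2) ∧
      (res.1 = false → f res.2 - f xstar ≤ ε) ∧
      -- the program `P n m T` computes this outcome
      r.out.1 = res.1 ∧ (∀ i, r.mem[r.out.2 i]? = some (res.2 i)) ∧
      -- number of gradient evaluations
      ((r.calls.countP FirstOrder.isGrad : ℕ) : ℝ)
        ≤ K₁ * (max l 1 * max (f x₀ - f xstar) ε / ε ^ 2) ∧
      -- running time
      (r.steps : ℝ) ≤ K₂ * (1 + Real.log (n / ε)) ^ p *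
        (n * (m : ℝ) ^ (ω - 1) + n * m / ε ^ 2) := by
  obtain ⟨F⟩ := hmul.nonempty_fastMul
  refine ⟨mainProg F, 2, fun C₀ => ⟨8 * (1 + |C₀|) + 1, fun l Lφ D hl hL =>
    ⟨(40 * F.C + 90) + 4 * (50 + (64 * F.C + 140) * (1 + 368 * Lφ)) *
      ((8 * (1 + |C₀|) + 1) * (max l 1 * max D 1)), ?_⟩⟩⟩
  intro n m A b f γ ε x₀ xstar hm hmn hA _ hf _ hε hεmin hlip hbound hx₀ _ hmin hD T res r
  obtain ⟨hεγ, hε2⟩ := le_min_iff.1 hεmin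
  have hstar : ∀ x ∈ strictlyFeasible A b, f xstar ≤ f x := fun x hx =>
    hmin ⟨hx.1, fun i => (hx.2 i).le⟩
  have hrun := runs_mainProg F hω₂ hω hm hmn hA hf hε hε2 hl (L := Lφ) hx₀.1 T
  have hT : (T : ℝ) ≤ (8 * (1 + |C₀|) + 1) * (max l 1 * max (f x₀ - f xstar) ε / ε ^ 2) :=
    maxIter_le hε hε2 hl
  have hn : 0 < n := hm.trans_le hmn
  refine ⟨fun htrue => ?_, fun hfalse => ?_, hrun.post.1, hrun.post.2,
    (Nat.cast_le.2 hrun.calls).trans hT, hrun.steps.trans ?_⟩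
  · rcases outcome_cases A f ε l Lφ x₀ T with ⟨t, hsmall, hres⟩ | ⟨-, hres⟩
    · obtain ⟨η, hη0, hηL, hη⟩ := exists_accuracy hA hf hε hl hL hbound hstar hx₀.1
      rw [Stops, iterate_succ] at hsmall
      rw [show res = _ from hres]
      exact isApproxKKT_of_small_decrease hA hf hε hεγ hε2 hl hlip hbound
        (iterate_mem hA hε hε2 hl hx₀.1 _) (approxIterate_pos A f ε l Lφ x₀ _) (hη _) hη0 hηL hsmall
    · rw [show res = _ from hres] at htrue
      exact absurd htrue Bool.false_ne_true
  · rcases outcome_cases A f ε l Lφ x₀ T with ⟨t, -, hres⟩ | ⟨hns, hres⟩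
    · rw [show res = _ from hres] at hfalse
      exact absurd hfalse.symm Bool.false_ne_true
    · rw [show res = _ from hres]
      exact objective_gap_le hA hε hε2 hl hx₀ hns
  · have hC := F.one_le_C
    set c₁ := 8 * (1 + |C₀|) + 1 with hc₁
    have hc₁0 : 0 ≤ c₁ := by positivity
    set M := 50 + (64 * F.C + 140) * (1 + 368 * Lφ) with hMdef
    have hM0 : 0 ≤ M := by positivity
    set Λ := 1 + Real.log (n / ε) with hΛ
    have hK := clog_add_one_le hn hε hε2
    have hΛ1 : 1 ≤ Λ := by
      have : 0 ≤ Real.log (n / ε) := by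
        have hn1 : (1 : ℝ) ≤ n := by exact_mod_cast hn
        exact Real.log_nonneg ((one_le_div hε).2 (by linarith))
      linarith
    have hmax : max (f x₀ - f xstar) ε ≤ max D 1 := max_le_max hD (by linarith)
    have hD0 : 0 < max D 1 := lt_max_of_lt_right one_pos
    have hl0 : 0 < max l 1 := lt_max_of_lt_right one_pos
    have hfull : 0 ≤ (n : ℝ) * (m : ℝ) ^ (ω - 1) := by positivity
    have hsum := sum_iterationCost_le F (f := f) hA hε hε2 hl hL hx₀.1 T
    have h1 : M * (Nat.clog 2 n + 1) ^ 2 * T * (n * m) ≤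
        4 * M * (c₁ * (max l 1 * max D 1)) * Λ ^ 2 * (n * m / ε ^ 2) :=
      calc M * (Nat.clog 2 n + 1) ^ 2 * T * (n * m)
        _ ≤ M * (2 * Λ) ^ 2 * (c₁ * (max l 1 * max D 1 / ε ^ 2)) * (n * m) := by
          gcongr
          exact hT.trans (by gcongr)
        _ = _ := by ring
    have h2 : (40 * F.C + 90) * (n * (m : ℝ) ^ (ω - 1)) ≤
        (40 * F.C + 90) * Λ ^ 2 * (n * (m : ℝ) ^ (ω - 1)) := by
      gcongr
      exact le_mul_of_one_le_right (by positivity) (one_le_pow₀ hΛ1)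
    have h3 : 0 ≤ 4 * M * (c₁ * (max l 1 * max D 1)) * Λ ^ 2 * (n * (m : ℝ) ^ (ω - 1)) := by
      positivity
    have h4 : 0 ≤ (40 * F.C + 90) * Λ ^ 2 * (n * m / ε ^ 2) := by positivity
    linarith
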